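/- **Setting.** A *generalized polynomial-like (GPL) map* is a holomorphic map $g:\bigcup_i W_i\to V$, where $V\subset\mathbb C$ is a topological disk and the $W_i\Subset V$ are (finitely or infinitely many) topological disks with pairwise disjoint closures, such that each $g:W_i\to V$ is a branched covering, all but finitely many of degree one. It is *unicritical of local degree $d$* if $0$ is its only critical point and $d$ is its local degree at $0$; $W=W_0\ni 0$ denotes the central domain. For a map $F$, $F^{-k}(B)|z$ denotes the component of $F^{-k}(B)$ containing $z$; the postcritical set $\mathcal O_F$ is the closure of the orbit of $0$. Suppose that $g^k(0)\in W$ for $0\le k<N$ and $g^N(0)\notin W$. Put $\Omega_k=g^{-k}(V)|0$ for $0\le k\le N$, and $U=\Omega_N$. Let $h_W:\bigcup_i X_i\to W$ be the first return map of $g$ to $W$ (with components $X_i$), let $X_s\ni g^{N-1}(0)$, and let $A=g^{-(N-1)}(X_s)|0$ (the *king*). The *kingdom renormalization* $G=R(g)$ is the map equal to: $h_W\circ g^{N-1}$ on $A$; $h_W\circ g^{k-1}$ on the pullbacks not containing $0$ of the domains $X_i\not\ni 0$ under $g^{k-1}:\Omega_k\to W$, $1\le k\le N$, that meet $\mathcal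 O_g$; and $g$ on the components of $\{z\in U: g(z)\in U\}$ that meet $\mathcal O_g$. The *king's apartment* is $\Delta=g^{-N}(W_j)|0$, where $W_j\ni g^N(0)$. The map $r(G)$ is the first return map of $G$ to $A$, restricted to those components of its domain that meet $\mathcal O_G$. Let $g=g_0:\bigcup_i W^0_i\to V^0$ be a unicritical GPL map of local degree $d$, and let $G_j=R(g_j)$, $g_{j+1}=r(G_j)$ be its *dynasty of kingdoms*; $V^j$, $W^j$, $\Delta^j$ denote the range, the central domain and the apartment of level $j$, so that $V^{j+1}=A^j$. Write $E^{2j}=V^j$, $E^{2j+1}=W^j$, and define enlargements by $\hat W^j=V^j$ and $\hat V^{j}=\Delta^{j-1}$ for $j\ge1$, so that $\hat E^i\supset E^i$. Let $\mathrm{Time}(P,Q)$ be the $l$ with $g^l(P)=Q$. Let $m\ge 1$ and $n>\log_2 m+5$ be integers, and suppose that the dynasty reaches level $n$ (for each $j<n$ the critical orbit of $g_j$ leaves $W^j$ after finitely many iterates, and the critical point lies in the domain of $g_{j+1}$). Let $l_0<l_1<\dots$ be the consecutive moments $l\ge \mathrm{Time}(V^n,V^0)$ with $g^l(W^n)\subset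 W^0$, and let $\Lambda_k=g^{l_k}(W^n)$. For $2n-3\le i\le 2n+1$ let $O_i$ be the family of those $\Lambda_k$, $0\le k\le m$, with $$\mathrm{Time}(W^n,E^i)<l_k\le \mathrm{Time}(W^n,E^{i-1}).$$ Let $F=F_i=g^{-s}(\hat E^{i-1})|0$ with $s=\mathrm{Time}(W^n,E^{i-1})$. For $\Lambda_k\in O_i$ let $\Lambda'_k=g^{l_k}(F)$ (the *buffer* of $\Lambda_k$) and $\Upsilon=\Upsilon_k=g^{-l_k}(V^0)|0$. **Claim.** The moments $l_0<\dots<l_m$ exist, and some $O_i$, $2n-3\le i\le 2n+1$, contains at least $m/2$ domains $\Lambda_k$. For every $i$ in this range (in particular, for such a choice of $i$) and every $\Lambda=\Lambda_k\in O_i$ with buffer $\Lambda'=\Lambda'_k$, we have $W^n\subset F\subset\Upsilon$ and $\Lambda\subset\Lambda'\subset V^0$, and $g^{l_k}:W^n\to\Lambda$ extends to the branched covering $\Psi=g^{l_k}:(\Upsilon,F,W^n)\to(V^0,\Lambda',\Lambda)$ (a branched covering on each of the three domains), such that - (P1) $\deg(\Psi:\Upsilon\to V^0)\le d^{2n+m}$;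 - (P2) $\deg(\Psi:F\to\Lambda')\le d^5$; - (P3) $\Upsilon\subset V^n$; - (P4) $\operatorname{mod}(\Lambda'\smallsetminus\Lambda)=\operatorname{mod}(\hat E^{i-1}\smallsetminus E^{i-1})$. Moreover, for every such $i$ the buffers $\Lambda'_k$ of the domains $\Lambda_k\in O_i$ are pairwise disjoint. -/

import Mathlib

open Set

noncomputable section

/-- A topological disk in the plane: an open set homeomorphic to the open unit disk. -/
def IsTopologicalDisk (D : Set ℂ) : Prop :=
  IsOpen D ∧ Nonempty (D ≃ₜ Metric.ball (0 : ℂ) 1)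

/-- `A ⋐ B`: the closure of `A` is a compact subset of `B`. -/
def CompactlyContained (A B : Set ℂ) : Prop :=
  IsCompact (closure A) ∧ closure A ⊆ B

/-- `f : U → V` is a (holomorphic) branched covering between plane domains, that is, a proper
holomorphic map.  (Properness forces `f` to be non-constant, of finite degree and onto `V`.) -/
structure IsBranchedCovering (f : ℂ → ℂ) (U V : Set ℂ) : Prop where
  isOpen_source : IsOpen U
  isConnected_source : IsConnected U
  isOpen_target : IsOpen V
  isConnected_target : IsConnected V
  holomorphic : DifferentiableOn ℂ f U
  proper : ∃ h : MapsTo f U V, IsProperMap (h.restrict f U V)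

/-- The degree of a branched covering `f : U → V`: the number of preimages of a generic point of
`V`, which is the largest number of points in a fibre. -/
def coveringDegree (f : ℂ → ℂ) (U V : Set ℂ) : ℕ∞ :=
  ⨆ w ∈ V, (U ∩ f ⁻¹' {w}).encard

/-- The round annulus `{1 < |z| < r}`. -/
def roundAnnulus (r : ℝ) : Set ℂ := {z | 1 < ‖z‖ ∧ ‖z‖ < r}

/-- The modulus `mod (U ∖ K)` of the annulus between the disk `U` and its compactly contained subset
`K`: the supremum of `log r / 2π` over all conformal embeddings `φ` of round annuli `{1 < |z| < r}`
into `U ∖ K` that go around `K` in `U` (each component of `U ∖ im φ` that meets `K` is compact).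
For a doubly connected domain that is conformally equivalent to `{1 < |z| < R}` this is
`log R / 2π`, by monotonicity of the modulus; the supremum makes sense for arbitrary disks. -/
def annulusModulus (U K : Set ℂ) : ENNReal :=
  ⨆ (r : ℝ) (φ : ℂ → ℂ) (_ : 1 < r) (_ : DifferentiableOn ℂ φ (roundAnnulus r))
    (_ : InjOn φ (roundAnnulus r)) (_ : MapsTo φ (roundAnnulus r) (U \ K))
    (_ : ∀ a ∈ K, IsCompact (connectedComponentIn (U \ φ '' roundAnnulus r) a)),
    ENNReal.ofReal (Real.log r / (2 * Real.pi))

/-- A map from a subset `dom` of the plane to the plane (the values of `toFun` outside `dom` are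
irrelevant). -/
structure PlaneMap where
  dom : Set ℂ
  toFun : ℂ → ℂ

namespace PlaneMap

/-- The set of points at which the `k`-th iterate is defined. -/
def iterDom (F : PlaneMap) (k : ℕ) : Set ℂ := {z | ∀ j < k, F.toFun^[j] z ∈ F.dom}

/-- The full preimage `F⁻ᵏ(B)`. -/
def preimage (F : PlaneMap) (k : ℕ) (B : Set ℂ) : Set ℂ :=
  {z | z ∈ F.iterDom k ∧ F.toFun^[k] z ∈ B}

/-- The pullback `F⁻ᵏ(B) | z`: the component of `F⁻ᵏ(B)` containing `z`. -/
def pullback (F : PlaneMap) (k : ℕ) (B : Set ℂ) (z : ℂ) : Set ℂ :=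
  connectedComponentIn (F.preimage k B) z

/-- The component of the domain of definition containing `z`. -/
def piece (F : PlaneMap) (z : ℂ) : Set ℂ := connectedComponentIn F.dom z

/-- The components of the domain of definition. -/
def pieces (F : PlaneMap) : Set (Set ℂ) := {C | ∃ z ∈ F.dom, C = F.piece z}

/-- The postcritical set: the closure of the orbit of `0`. -/
def postcritical (F : PlaneMap) : Set ℂ :=
  closure {w | ∃ k, (0 : ℂ) ∈ F.iterDom k ∧ F.toFun^[k] 0 = w}

/-- The time `Time_F (P, Q)`, i.e. the moment `l` with `F^l P = Q`. -/
def time (F : PlaneMap) (P Q : Set ℂ) : ℕ :=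
  sInf {l | P ⊆ F.iterDom l ∧ F.toFun^[l] '' P = Q}

/-- The first return time of `z` to `A`. -/
def returnTime (F : PlaneMap) (A : Set ℂ) (z : ℂ) : ℕ := sInf {k | 1 ≤ k ∧ z ∈ F.preimage k A}

/-- The first return map to `A`. -/
def firstReturn (F : PlaneMap) (A : Set ℂ) : PlaneMap where
  dom := {z | z ∈ A ∧ ∃ k, 1 ≤ k ∧ z ∈ F.preimage k A}
  toFun := fun z => F.toFun^[F.returnTime A z] z

/-- Restriction to the union of those components of the domain that intersect `P`. -/
def restrictMeeting (F : PlaneMap) (P : Set ℂ) : PlaneMap where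
  dom := {z | z ∈ F.dom ∧ (F.piece z ∩ P).Nonempty}
  toFun := F.toFun

/-- The first return map to `A`, restricted to those components of its domain that intersect the
postcritical set of `F`: the generalized renormalization of `F` on `A`. -/
def renorm (F : PlaneMap) (A : Set ℂ) : PlaneMap := (F.firstReturn A).restrictMeeting F.postcritical

/-- `g : ⋃ W_i → V` is a generalized polynomial-like map; the disks `W_i` are the components of the
domain of `g`. -/
structure IsGPL (g : PlaneMap) (V : Set ℂ) : Prop where
  disk_range : IsTopologicalDisk V
  isOpen_dom : IsOpen g.dom
  disk_piece : ∀ C ∈ g.pieces, IsTopologicalDisk C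
  compactly_contained : ∀ C ∈ g.pieces, CompactlyContained C V
  disjoint_closure : ∀ C ∈ g.pieces, ∀ C' ∈ g.pieces, C ≠ C' → Disjoint (closure C) (closure C')
  branched : ∀ C ∈ g.pieces, IsBranchedCovering g.toFun C V
  almost_univalent : {C | C ∈ g.pieces ∧ coveringDegree g.toFun C V ≠ 1}.Finite

/-- A unicritical generalized polynomial-like map: `0` is its only critical point, and `d` is the
local degree at `0`. -/
structure IsUnicriticalGPL (g : PlaneMap) (V : Set ℂ) (d : ℕ) : Prop extends IsGPL g V where
  critical : {z | z ∈ g.dom ∧ deriv g.toFun z = 0} = {0}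
  local_degree : analyticOrderAt (fun z => g.toFun z - g.toFun 0) 0 = d

/-! ### The kingdom renormalization of `g : ⋃ W_i → V` -/

/-- The central domain `W = W_0`. -/
def central (g : PlaneMap) : Set ℂ := g.piece 0

/-- The central cascade has finite length: the critical orbit leaves `W`. -/
def HasFiniteCascade (g : PlaneMap) : Prop := ∃ k, g.toFun^[k] 0 ∉ g.central

/-- The length `N ≥ 1` of the central cascade: `g^k(0) ∈ W` for `k < N`, but `g^N(0) ∉ W`. -/
def cascadeLength (g : PlaneMap) : ℕ := sInf {k | g.toFun^[k] 0 ∉ g.central}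

/-- The disks `V = Ω_0 ⊃ W = Ω_1 ⊃ … ⊃ Ω_N = U` of the central cascade. -/
def cascade (g : PlaneMap) (V : Set ℂ) (k : ℕ) : Set ℂ := g.pullback k V 0

/-- The castle `U = Ω_N`. -/
def castle (g : PlaneMap) (V : Set ℂ) : Set ℂ := g.cascade V g.cascadeLength

/-- The king `A`: the pullback `g^{-(N-1)}(X_s) | 0` of the domain `X_s` of the first return map to
`W` that contains `g^{N-1}(0)`. -/
def king (g : PlaneMap) : Set ℂ :=
  g.pullback (g.cascadeLength - 1)
    ((g.firstReturn g.central).piece (g.toFun^[g.cascadeLength - 1] 0)) 0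

/-- The king's subjects of level `k ∈ [1, N]`: the non-critical pullbacks, under
`g^{k-1} : Ω_k → W`, of the domains `X_i ∌ 0` of the first return map to `W`, that intersect the
postcritical set. -/
def subjects (g : PlaneMap) (V : Set ℂ) (k : ℕ) : Set (Set ℂ) :=
  {D | 1 ≤ k ∧ k ≤ g.cascadeLength ∧ (∃ X ∈ (g.firstReturn g.central).pieces, (0 : ℂ) ∉ X ∧
      ∃ z ∈ g.cascade V k ∩ g.preimage (k - 1) X,
        D = connectedComponentIn (g.cascade V k ∩ g.preimage (k - 1) X) z) ∧
    (0 : ℂ) ∉ D ∧ (D ∩ g.postcritical).Nonempty}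

/-- The king's men: the pullbacks of the castle `U` under `g : U → g(U)` that intersect the
postcritical set. -/
def men (g : PlaneMap) (V : Set ℂ) : Set (Set ℂ) :=
  {M | (∃ z ∈ g.castle V ∩ g.preimage 1 (g.castle V),
        M = connectedComponentIn (g.castle V ∩ g.preimage 1 (g.castle V)) z) ∧
    (M ∩ g.postcritical).Nonempty}

open Classical in
/-- The kingdom renormalization `G = R(g)`.  With `h` the first return map of `g` to `W`, it is
`h ∘ g^{N-1}` on the king, `h ∘ g^{k-1}` on a subject of level `k`, and `g` on the king's men. -/
def kingdom (g : PlaneMap) (V : Set ℂ) : PlaneMap where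
  dom := g.king ∪ (⋃ k, ⋃₀ g.subjects V k) ∪ ⋃₀ g.men V
  toFun := fun z =>
    if z ∈ g.king then (g.firstReturn g.central).toFun (g.toFun^[g.cascadeLength - 1] z)
    else if ∃ k, z ∈ ⋃₀ g.subjects V k then
      (g.firstReturn g.central).toFun (g.toFun^[sInf {k | z ∈ ⋃₀ g.subjects V k} - 1] z)
    else g.toFun z

/-- The king's apartment `Δ = g^{-N}(W_j) | 0`, where `W_j ∋ g^N(0)`. -/
def apartment (g : PlaneMap) : Set ℂ :=
  g.pullback g.cascadeLength (g.piece (g.toFun^[g.cascadeLength] 0)) 0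

/-! ### The dynasty of kingdoms -/

/-- The pairs `(g_n, V^n)` of the dynasty: `g_0 = g`, `V^0 = V`, and, with `G_n = R(g_n)`,
`V^{n+1} = A^n` is the king of `G_n` and `g_{n+1} = r(G_n)` is the first return map of `G_n` to
`A^n`, restricted to the components that intersect the postcritical set of `G_n`. -/
def dynasty (g : PlaneMap) (V : Set ℂ) : ℕ → PlaneMap × Set ℂ
  | 0 => (g, V)
  | n + 1 =>
    let p := dynasty g V n
    ((p.1.kingdom p.2).renorm p.1.king, p.1.king)

/-- The map `g_n`. -/
def level (g : PlaneMap) (V : Set ℂ) (n : ℕ) : PlaneMap := (g.dynasty V n).1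

/-- The domain `V^n`. -/
def nestV (g : PlaneMap) (V : Set ℂ) (n : ℕ) : Set ℂ := (g.dynasty V n).2

/-- The domain `W^n`. -/
def nestW (g : PlaneMap) (V : Set ℂ) (n : ℕ) : Set ℂ := (g.level V n).central

/-- The dynasty does not terminate before `(g_n, V^n, W^n)`: for `j < n` the map `g_j` has a finite
central cascade, and the critical point returns to the king `V^{j+1}` (so that `g_{j+1}` is defined
at `0`, and `W^{j+1}` exists). -/
def DynastyReaches (g : PlaneMap) (V : Set ℂ) (n : ℕ) : Prop :=
  ∀ j < n, (g.level V j).HasFiniteCascade ∧ (0 : ℂ) ∈ (g.level V (j + 1)).dom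

/-- The modified principal nest in uniform numbering: `E^{2n} = V^n`, `E^{2n+1} = W^n`. -/
def nestE (g : PlaneMap) (V : Set ℂ) (i : ℕ) : Set ℂ :=
  if i % 2 = 0 then g.nestV V (i / 2) else g.nestW V (i / 2)

/-- The enlargements of the domains of the nest, for `i ≥ 1`: the enlargement of `W^n` is `V^n`, and
the enlargement of `V^n`, `n ≥ 1`, is the apartment `Δ^{n-1}`. -/
def hatE (g : PlaneMap) (V : Set ℂ) (i : ℕ) : Set ℂ :=
  if i % 2 = 0 then (g.level V (i / 2 - 1)).apartment else g.nestV V (i / 2)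

/-! ### The combinatorial choices -/

/-- `l` is a moment `≥ Time (V^n, V^0)` at which `W^n` visits `W^0`. -/
def IsReturnMoment (g : PlaneMap) (V : Set ℂ) (n l : ℕ) : Prop :=
  g.time (g.nestV V n) V ≤ l ∧
    g.nestW V n ⊆ g.iterDom l ∧ g.toFun^[l] '' g.nestW V n ⊆ g.nestW V 0

/-- The consecutive return moments `l_0 < l_1 < …`. -/
def moment (g : PlaneMap) (V : Set ℂ) (n k : ℕ) : ℕ := Nat.nth (g.IsReturnMoment V n) k

open Classical in
/-- The indices `k ≤ m` of the domains `Λ_k = g^{l_k}(W^n)` in the orbit piece `O_i`, that is, after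
`E^i` and not after `E^{i-1}` in the orbit of `W^n`. -/
def orbitPiece (g : PlaneMap) (V : Set ℂ) (m n i : ℕ) : Finset ℕ :=
  (Finset.range (m + 1)).filter fun k =>
    g.time (g.nestW V n) (g.nestE V i) < g.moment V n k ∧
      g.moment V n k ≤ g.time (g.nestW V n) (g.nestE V (i - 1))

/-- The map `Ψ_k = g^{l_k}`. -/
def psi (g : PlaneMap) (V : Set ℂ) (n k : ℕ) : ℂ → ℂ := g.toFun^[g.moment V n k]

/-- The domain `Λ_k = g^{l_k}(W^n)`. -/
def lam (g : PlaneMap) (V : Set ℂ) (n k : ℕ) : Set ℂ := g.psi V n k '' g.nestW V n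

/-- The domain `F ⊃ W^n`: the pullback of the enlargement of `E^{i-1}` along the orbit
`W^n → … → E^{i-1}`. -/
def bufferF (g : PlaneMap) (V : Set ℂ) (n i : ℕ) : Set ℂ :=
  g.pullback (g.time (g.nestW V n) (g.nestE V (i - 1))) (g.hatE V (i - 1)) 0

/-- The buffer `Λ'_k = g^{l_k}(F)`. -/
def lamBuffer (g : PlaneMap) (V : Set ℂ) (n i k : ℕ) : Set ℂ := g.psi V n k '' g.bufferF V n i

/-- The domain `Υ = g^{-l_k}(V^0) | 0`. -/
def upsilon (g : PlaneMap) (V : Set ℂ) (n k : ℕ) : Set ℂ := g.pullback (g.moment V n k) V 0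

end PlaneMap

end

/-!
All domains in the theorem turn out to be puzzle pieces of `g`, that is, components
`g.pullback t V z` of the preimages `g⁻ᵗ(V)`, and everything is deduced from the combinatorics of
these pieces. Two pieces are nested or disjoint, `g^s` is a branched covering of a piece of depth
`s + t` onto a piece of depth `t` (`IsGPL.isBranchedCovering_iterate`), and a piece determines its
depth, because the range of a generalized polynomial-like map is not contained in its domain.

*Degrees.* Say that a piece hits the critical point at the moment `l` if its image under `g^l`
contains `0` (`Hits`). The degree of an iterate on a piece is at most `d` to the number of hits, and
the iterate is injective if there are none (`encard_fibre_iterate`, `injOn_iterate`). This needs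
that `g` is injective on every piece that does not contain `0`, including those inside the central
domain. There `g - g(0)` is the `d`-th power of an injective function
(`IsProperOn.exists_injOn_root`), which is found by lifting the exponential through `g`; and since
pieces have no holes, there is a branch of the `d`-th root of `w - g(0)` on every piece that avoids
the critical value `g(0)`.

*Renormalization.* The maps `g_j` and their kingdoms are piecewise iterates of `g` on puzzle pieces
(`Pieced`, `IsLevel`), and they do not skip hits: between two consecutive moments of such a map the
critical point is not hit (`NoHits`). For a first return map this holds because a hit would be an
earlier return. For the kingdom it rests on the fact that the central domain of the first return map
to `W` contains all points of `W` that are mapped into `W` when the cascade has length at least two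
(`zero_mem_return_piece`). Hence `V^j`, `W^j` and the apartments are pieces around `0` whose depths
are described by a few numerical relations (`NestTimes`), and the orbit of the enlargement of
`E^{i-1}` pulled back to `W^n` hits the critical point only when it passes through the domains
`E^{2n+1}, …, E^i` (`eq_of_hits_hat`). This yields the bound `d^5` and the injectivity of the map
from the buffer to the enlargement of `E^{i-1}`, so that the moduli agree.

*Counting.* Let `x_j` be the number of visits of the critical orbit to the central domain on the way
from `V^{j+1}` to `W^j`. The itinerary repeats after each return, which gives `x_{j+1} ≥ 2 x_j`, so
`x_j ≥ 2^j`. Therefore each step `E^i → E^{i-1}` under consideration contains more than `m` visits,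
the first `m + 1` return moments meet at most two adjacent steps, and one of them contains at least
half of the moments. If two buffers met, they would be nested, and the critical orbit would be
periodic in itinerary until it enters `E^{i-1}`, with at most `m` visits in a period; but within a
period the orbit returns to `V^{n-3}`, which takes more visits than that (`disjoint_lamBuffer`).
-/

/-! ### Proper maps between plane sets -/

open Topology Filter

/-- `f : U → V` is continuous and proper, in terms of compact subsets of `V`. -/
structure IsProperOn (f : ℂ → ℂ) (U V : Set ℂ) : Prop where
  continuousOn : ContinuousOn f U
  mapsTo : MapsTo f U V
  isCompact_preimage : ∀ K ⊆ V, IsCompact K → IsCompact (U ∩ f ⁻¹' K)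

theorem isProperOn_of_isProperMap {f : ℂ → ℂ} {U V : Set ℂ}
    (H : ∃ h : MapsTo f U V, IsProperMap (h.restrict f U V)) : IsProperOn f U V := by
  obtain ⟨h, hp⟩ := H
  refine ⟨?_, h, fun K hKV hK => ?_⟩
  · rw [continuousOn_iff_continuous_domRestrict]
    exact continuous_subtype_val.comp hp.continuous
  · have h1 : IsCompact ((↑) ⁻¹' K : Set V) := by
      rw [Subtype.isCompact_iff, Subtype.image_preimage_coe, inter_eq_self_of_subset_right hKV]
      exact hK
    have h2 := (hp.isCompact_preimage h1).image continuous_subtype_val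
    convert h2 using 1
    ext z
    simp only [mem_inter_iff, mem_preimage, mem_image, Subtype.exists, MapsTo.val_restrict_apply]
    constructor
    · rintro ⟨a, b⟩; exact ⟨z, a, b, rfl⟩
    · rintro ⟨a, b, c, rfl⟩; exact ⟨b, c⟩

theorem IsProperOn.isProperMap {f : ℂ → ℂ} {U V : Set ℂ} (hV : IsOpen V) (H : IsProperOn f U V) :
    ∃ h : MapsTo f U V, IsProperMap (h.restrict f U V) := by
  have : LocallyCompactSpace V := hV.locallyCompactSpace
  refine ⟨H.mapsTo, ?_⟩
  rw [isProperMap_iff_isCompact_preimage]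
  refine ⟨H.continuousOn.mapsToRestrict H.mapsTo, fun K hK => ?_⟩
  rw [Subtype.isCompact_iff]
  have h1 := H.isCompact_preimage ((↑) '' K) (by rintro _ ⟨x, -, rfl⟩; exact x.2)
    (hK.image continuous_subtype_val)
  convert h1 using 1
  ext z
  simp only [mem_inter_iff, mem_preimage, mem_image, Subtype.exists, exists_and_right,
    exists_eq_right]
  constructor
  · rintro ⟨a, b⟩; exact ⟨a, H.mapsTo a, b⟩
  · rintro ⟨a, b, c⟩; exact ⟨a, c⟩

theorem IsProperOn.comp {f g : ℂ → ℂ} {U V T : Set ℂ} (hg : IsProperOn g V T)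
    (hf : IsProperOn f U V) : IsProperOn (g ∘ f) U T := by
  refine ⟨hg.continuousOn.comp hf.continuousOn hf.mapsTo, hg.mapsTo.comp hf.mapsTo,
    fun K hK hKc => ?_⟩
  have := hf.isCompact_preimage _ inter_subset_left (hg.isCompact_preimage K hK hKc)
  convert this using 1
  ext z
  simp only [mem_inter_iff, mem_preimage, Function.comp]
  exact ⟨fun h => ⟨h.1, hf.mapsTo h.1, h.2⟩, fun h => ⟨h.1, h.2.2⟩⟩

/-- Connected components are relatively closed. -/
theorem closure_connectedComponentIn_inter_subset (S : Set ℂ) (z : ℂ) :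
    closure (connectedComponentIn S z) ∩ S ⊆ connectedComponentIn S z := by
  by_cases hz : z ∈ S
  · refine IsPreconnected.subset_connectedComponentIn
      (isPreconnected_connectedComponentIn.subset_closure
        (subset_inter subset_closure (connectedComponentIn_subset S z)) inter_subset_left)
      ⟨subset_closure (mem_connectedComponentIn hz), hz⟩ inter_subset_right
  · rw [connectedComponentIn_eq_empty hz]; simp

theorem IsProperOn.restrict_component {f : ℂ → ℂ} {C V Q : Set ℂ} (H : IsProperOn f C V)
    (hQ : Q ⊆ V) (z : ℂ) : IsProperOn f (connectedComponentIn (C ∩ f ⁻¹' Q) z) Q := by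
  set S := C ∩ f ⁻¹' Q
  have hP := connectedComponentIn_subset S z
  refine ⟨H.continuousOn.mono (hP.trans inter_subset_left), fun w hw => (hP hw).2,
    fun K hK hKc => ?_⟩
  have h1 := H.isCompact_preimage K (hK.trans hQ) hKc
  convert h1.inter_left (isClosed_closure (s := connectedComponentIn S z)) using 1
  ext w
  simp only [mem_inter_iff, mem_preimage]
  refine ⟨fun h => ⟨subset_closure h.1, (hP h.1).1, h.2⟩, fun h => ⟨?_, h.2.2⟩⟩
  exact closure_connectedComponentIn_inter_subset S z ⟨h.1, h.2.1, hK h.2.2⟩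

/-- A proper open map onto a connected set is surjective. -/
theorem IsProperOn.image_eq {f : ℂ → ℂ} {U V : Set ℂ} (H : IsProperOn f U V)
    (hV : IsOpen V) (hVc : IsPreconnected V) (hne : U.Nonempty) (ho : IsOpen (f '' U)) :
    f '' U = V := by
  refine (H.mapsTo.image_subset).antisymm ?_
  refine hVc.subset_of_closure_inter_subset ho ?_ ?_
  · obtain ⟨z, hz⟩ := hne
    exact ⟨f z, H.mapsTo hz, z, hz, rfl⟩
  · rintro y ⟨hy, hyV⟩
    obtain ⟨ε, hε, hb⟩ := Metric.nhds_basis_closedBall.mem_iff.1 (hV.mem_nhds hyV)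
    have hK := H.isCompact_preimage _ hb (isCompact_closedBall y ε)
    have hK2 := (hK.image_of_continuousOn (H.continuousOn.mono inter_subset_left)).isClosed
    have : y ∈ closure (f '' (U ∩ f ⁻¹' Metric.closedBall y ε)) := by
      rw [mem_closure_iff_nhds] at hy ⊢
      intro t ht
      obtain ⟨w, ⟨hw1, hw2⟩, ⟨x, hx, rfl⟩⟩ := hy _ (inter_mem ht (Metric.closedBall_mem_nhds y hε))
      exact ⟨f x, hw1, x, ⟨hx, hw2⟩, rfl⟩
    rw [hK2.closure_eq] at this
    obtain ⟨x, hx, hxy⟩ := this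
    exact ⟨x, hx.1, hxy⟩

theorem not_isCompact_of_isOpen {U : Set ℂ} (hU : IsOpen U) (hne : U.Nonempty) :
    ¬ IsCompact U := by
  intro h
  have := (isClopen_iff.1 ⟨h.isClosed, hU⟩).resolve_left hne.ne_empty
  exact noncompact_univ ℂ (this ▸ h)

/-- A proper holomorphic map between plane domains is open. -/
theorem IsProperOn.isOpen_image {f : ℂ → ℂ} {C V : Set ℂ} (H : IsProperOn f C V)
    (hC : IsOpen C) (hCc : IsPreconnected C) (hf : DifferentiableOn ℂ f C) {s : Set ℂ}
    (hs : s ⊆ C) (hso : IsOpen s) : IsOpen (f '' s) := by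
  rcases C.eq_empty_or_nonempty with rfl | ⟨z, hz⟩
  · rw [subset_empty_iff.1 hs]; simp
  rcases (hf.analyticOnNhd hC).is_constant_or_isOpen hCc with ⟨w, hw⟩ | h
  · exfalso
    have hwV : w ∈ V := hw z hz ▸ H.mapsTo hz
    have := H.isCompact_preimage {w} (by simpa using hwV) isCompact_singleton
    rw [inter_eq_self_of_subset_left (show C ⊆ f ⁻¹' {w} from fun x hx => hw x hx)] at this
    exact not_isCompact_of_isOpen hC ⟨z, hz⟩ this
  · exact h s hs hso

/-! ### Plane sets without holes -/

/-- An open plane set `Q` has no holes: it contains every bounded open set whose frontier lies in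
`Q`. -/
def HasNoHoles (Q : Set ℂ) : Prop :=
  ∀ O : Set ℂ, IsOpen O → Bornology.IsBounded O → frontier O ⊆ Q → O ⊆ Q

theorem frontier_connectedComponentIn_inter {S : Set ℂ} (hS : IsOpen S) (z : ℂ) :
    Disjoint (frontier (connectedComponentIn S z)) S := by
  rw [Set.disjoint_left]
  intro x hx hxS
  have h1 := closure_connectedComponentIn_inter_subset S z ⟨hx.1, hxS⟩
  exact hx.2 ((hS.connectedComponentIn (x := z)).interior_eq.symm ▸ h1)

theorem frontier_nonempty_of_bounded {O : Set ℂ} (ho : IsOpen O) (hb : Bornology.IsBounded O)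
    (hne : O.Nonempty) : (frontier O).Nonempty := by
  rw [nonempty_iff_ne_empty]
  intro h
  have hc : IsClosed O := (frontier_eq_empty_iff.1 h).elim (fun h => by simp [h])
    (fun h => by simp [h])
  exact not_isCompact_of_isOpen ho hne (Metric.isCompact_of_isClosed_isBounded hc hb)

/-- The absence of holes passes to components of preimages under proper holomorphic maps. -/
theorem HasNoHoles.component {f : ℂ → ℂ} {C V Q : Set ℂ} (hCn : HasNoHoles C) (hQn : HasNoHoles Q)
    (H : IsProperOn f C V) (hC : IsOpen C) (hCc : IsPreconnected C)
    (hf : DifferentiableOn ℂ f C) (hQ : IsOpen Q) (z : ℂ) :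
    HasNoHoles (connectedComponentIn (C ∩ f ⁻¹' Q) z) := by
  intro O ho hb hfr
  set S := C ∩ f ⁻¹' Q with hS
  have hSo : IsOpen S := H.continuousOn.isOpen_inter_preimage hC hQ
  set P := connectedComponentIn S z with hPdef
  have hPS : P ⊆ S := connectedComponentIn_subset S z
  have hOC : O ⊆ C := hCn O ho hb (hfr.trans (hPS.trans inter_subset_left))
  have hclO : closure O ⊆ C := by
    rw [closure_eq_self_union_frontier]
    exact union_subset hOC (hfr.trans (hPS.trans inter_subset_left))
  have hcl : IsCompact (closure O) := hb.isCompact_closure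
  have hcomp : IsCompact (f '' closure O) := hcl.image_of_continuousOn (H.continuousOn.mono hclO)
  have hfO : IsOpen (f '' O) := H.isOpen_image hC hCc hf hOC ho
  have hOQ : f '' O ⊆ Q := by
    refine hQn _ hfO (hcomp.isBounded.subset (image_mono subset_closure)) ?_
    rintro y ⟨hy1, hy2⟩
    rw [hfO.interior_eq] at hy2
    have : y ∈ f '' closure O := closure_minimal (image_mono subset_closure) hcomp.isClosed hy1
    obtain ⟨x, hx, rfl⟩ := this
    have hxf : x ∈ frontier O := by
      refine ⟨hx, fun h => hy2 ⟨x, interior_subset h, rfl⟩⟩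
    exact (hPS (hfr hxf)).2
  have hOS : O ⊆ S := fun x hx => ⟨hOC hx, hOQ ⟨x, hx, rfl⟩⟩
  intro x hx
  have hxS := hOS hx
  by_contra hxP
  set P' := connectedComponentIn S x with hP'
  have hdis : Disjoint P' P := by
    rw [Set.disjoint_left]
    intro y hy hy'
    have e1 : connectedComponentIn S x = connectedComponentIn S y := connectedComponentIn_eq hy
    have e2 : connectedComponentIn S z = connectedComponentIn S y := connectedComponentIn_eq hy'
    have : x ∈ connectedComponentIn S x := mem_connectedComponentIn hxS
    rw [e1, ← e2] at this
    exact hxP this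
  have hP'O : P' ⊆ O := by
    refine isPreconnected_connectedComponentIn.subset_of_closure_inter_subset ho
      ⟨x, mem_connectedComponentIn hxS, hx⟩ ?_
    rintro y ⟨hy1, hy2⟩
    by_contra hyO
    exact Set.disjoint_left.1 hdis hy2 (hfr ⟨hy1, fun h => hyO (interior_subset h)⟩)
  obtain ⟨y, hy⟩ := frontier_nonempty_of_bounded (hSo.connectedComponentIn (x := x))
    (hb.subset hP'O) ⟨x, mem_connectedComponentIn hxS⟩
  refine Set.disjoint_left.1 (frontier_connectedComponentIn_inter hSo x) hy ?_
  have : y ∈ closure O := closure_mono hP'O hy.1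
  rw [closure_eq_self_union_frontier] at this
  exact this.elim (fun h => hOS h) (fun h => hPS (hfr h))

/-! ### Branches of the logarithm -/

theorem IsTopologicalDisk.isSimplyConnected {D : Set ℂ} (hD : IsTopologicalDisk D) :
    IsSimplyConnected D := by
  obtain ⟨-, ⟨e⟩⟩ := hD
  have : ContractibleSpace (Metric.ball (0 : ℂ) 1) :=
    (convex_ball (0 : ℂ) 1).contractibleSpace ⟨0, by simp⟩
  have : SimplyConnectedSpace (Metric.ball (0 : ℂ) 1) := inferInstance
  exact e.toHomotopyEquiv.simplyConnectedSpace

/-- There is no continuous function `M` with `exp (M z) = z - a` on a circle around `a`: along the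
circle a branch of the logarithm increases by `2πi`. -/
theorem no_continuous_log_near_infinity (M : ℂ → ℂ) (hM : Continuous M) (a : ℂ) (R : ℝ) (hR : 0 < R)
    (h : ∀ z, ‖z - a‖ = R → Complex.exp (M z) = z - a) : False := by
  let c : ℝ → ℂ := fun θ => a + R * Complex.exp (θ * Complex.I)
  have hc : ∀ θ, ‖c θ - a‖ = R := by
    intro θ
    simp [c, Complex.norm_exp_ofReal_mul_I, abs_of_pos hR]
  have hcc : Continuous c := by fun_prop
  let u : ℝ → ℂ := fun θ => M (c θ) - θ * Complex.I - Complex.log R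
  have hu : Continuous u := by fun_prop
  have hR' : (R : ℂ) ≠ 0 := by exact_mod_cast hR.ne'
  have hu1 : ∀ θ, Complex.exp (u θ) = 1 := by
    intro θ
    simp only [u, Complex.exp_sub, h _ (hc θ), Complex.exp_log hR']
    simp only [c, add_sub_cancel_left]
    field_simp
  have hconst : ∀ θ, u θ = u 0 := by
    intro θ
    have := Complex.isAddQuotientCoveringMap_exp.isCoveringMap.eq_of_comp_eq hu
      (continuous_const (y := u 0)) (by funext x; simp [hu1]) 0 rfl
    exact congrFun this θ
  have h2 := hconst (2 * Real.pi)
  have hcp : c (2 * Real.pi) = c 0 := by simp [c, Complex.exp_two_pi_mul_I]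
  simp only [u, hcp] at h2
  have : (2 * Real.pi : ℂ) * Complex.I = 0 := by
    push_cast at h2
    linear_combination -h2
  simp [Real.pi_ne_zero] at this

/-- A topological disk in the plane has no holes. -/
theorem IsTopologicalDisk.hasNoHoles {D : Set ℂ} (hD : IsTopologicalDisk D) : HasNoHoles D := by
  intro O ho hb hfr a haO
  by_contra haD
  obtain ⟨L, hL, hLe⟩ := Complex.exists_continuousOn_eqOn_exp_comp hD.isSimplyConnected hD.1
    (g := fun z => z - a) (by fun_prop)
    (by rintro ⟨x, hx, hxa⟩; exact haD (by rwa [sub_eq_zero.1 hxa] at hx))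
  -- The logarithm extends from the frontier of `O` to the plane; `exp` of the extension, continued
  -- by `z - a` outside `O`, vanishes nowhere, so it has a logarithm on the whole plane.
  let l : C(frontier O, ℂ) := ⟨fun x => L x, (hL.mono hfr).comp_continuous
    continuous_subtype_val (fun x => x.2)⟩
  obtain ⟨l', hl'⟩ := ContinuousMap.exists_restrict_eq isClosed_frontier l
  classical
  let f : ℂ → ℂ := fun z => if z ∈ O then Complex.exp (l' z) else z - a
  have hf : Continuous f := by
    refine continuous_if (fun z hz => ?_) ?_ ?_
    · have h1 : l' z = L z := DFunLike.congr_fun hl' (⟨z, hz⟩ : frontier O)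
      have h2 := hLe (hfr hz)
      simp only [Function.comp_apply] at h2
      rw [h1, h2]
    · exact (Complex.continuous_exp.comp l'.continuous).continuousOn
    · fun_prop
  have hf0 : ∀ z, f z ≠ 0 := by
    intro z
    by_cases hz : z ∈ O
    · simp [f, hz]
    · simp only [f, hz, if_false]
      intro h
      exact hz (by rwa [sub_eq_zero.1 h])
  have huniv : IsSimplyConnected (univ : Set ℂ) := by
    have : SimplyConnectedSpace ℂ := inferInstance
    exact (Homeomorph.Set.univ ℂ).toHomotopyEquiv.simplyConnectedSpace
  obtain ⟨M, hM, hMe⟩ := Complex.exists_continuousOn_eqOn_exp_comp huniv isOpen_univ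
    hf.continuousOn (by rintro ⟨x, -, hx⟩; exact hf0 x hx)
  obtain ⟨R, hR⟩ := hb.subset_ball a
  have hR0 : 0 < R := by
    have := hR haO
    simpa using this
  refine no_continuous_log_near_infinity M (continuousOn_univ.1 hM) a R hR0 fun z hz => ?_
  have := hMe (mem_univ z)
  simp only [Function.comp_apply] at this
  rw [this]
  have hzO : z ∉ O := fun h => by
    have := hR h
    rw [Metric.mem_ball, dist_eq_norm, hz] at this
    exact lt_irrefl _ this
  simp [f, hzO]

theorem exists_log_near_one {K : Set ℂ} {u : ℂ → ℂ} (hu : ContinuousOn u K)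
    (h : ∀ z ∈ K, ‖u z - 1‖ < 1) :
    ∃ l : ℂ → ℂ, ContinuousOn l K ∧ ∀ z ∈ K, Complex.exp (l z) = u z := by
  have hs : ∀ z ∈ K, u z ∈ Complex.slitPlane := fun z hz => by
    apply Complex.ball_one_subset_slitPlane
    simpa [dist_eq_norm] using h z hz
  exact ⟨fun z => Complex.log (u z), hu.clog hs,
    fun z hz => Complex.exp_log (Complex.slitPlane_ne_zero (hs z hz))⟩

/-- On a compact subset of a set without holes there is a branch of `log (z - a)` for each `a`
outside the set: `a` can be moved to infinity in small steps that avoid the set. -/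
theorem HasNoHoles.exists_log_on_compact {Q : Set ℂ} (hQn : HasNoHoles Q) (hQ : IsOpen Q)
    {K : Set ℂ} (hK : IsCompact K) (hKQ : K ⊆ Q) {a : ℂ} (ha : a ∉ Q) :
    ∃ l : ℂ → ℂ, ContinuousOn l K ∧ ∀ z ∈ K, Complex.exp (l z) = z - a := by
  obtain ⟨δ, hδ, hδQ⟩ := hK.exists_thickening_subset_open hQ hKQ
  have hfar : ∀ b ∉ Q, ∀ z ∈ K, δ ≤ ‖z - b‖ := by
    intro b hb z hz
    by_contra hlt
    push Not at hlt
    refine hb (hδQ (Metric.mem_thickening_iff.2 ⟨z, hz, ?_⟩))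
    rw [dist_comm, dist_eq_norm]; exact hlt
  obtain ⟨R, hR⟩ := hK.isBounded.exists_norm_le
  by_contra hno
  -- the points outside `Q` for which there is no branch
  let S : Set ℂ :=
    {b | b ∉ Q ∧ ¬ ∃ l : ℂ → ℂ, ContinuousOn l K ∧ ∀ z ∈ K, Complex.exp (l z) = z - b}
  have hSb : ∀ b ∈ S, ‖b‖ ≤ R := by
    rintro b ⟨-, hb⟩
    by_contra hlt
    push Not at hlt
    apply hb
    rcases K.eq_empty_or_nonempty with rfl | ⟨z0, hz0⟩
    · exact ⟨0, by simp, by simp⟩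
    have hR0 : 0 ≤ R := (norm_nonneg _).trans (hR z0 hz0)
    have hb0 : b ≠ 0 := by rintro rfl; simp at hlt; linarith
    obtain ⟨l, hl, hle⟩ := exists_log_near_one (K := K) (u := fun z => 1 - z / b) (by fun_prop)
      (fun z hz => by
        have : ‖(1 - z / b) - 1‖ = ‖z‖ / ‖b‖ := by
          rw [show (1 - z / b) - 1 = -(z / b) by ring, norm_neg, norm_div]
        rw [this, div_lt_one (norm_pos_iff.2 hb0)]
        exact (hR z hz).trans_lt hlt)
    refine ⟨fun z => l z + Complex.log (-b), hl.add continuousOn_const, fun z hz => ?_⟩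
    rw [Complex.exp_add, hle z hz, Complex.exp_log (neg_ne_zero.2 hb0)]
    field_simp
    ring
  have hSstep : ∀ b ∈ S, ∀ b' ∉ Q, dist b' b < δ → b' ∈ S := by
    rintro b ⟨hbQ, hb⟩ b' hb' hd
    refine ⟨hb', ?_⟩
    rintro ⟨l, hl, hle⟩
    apply hb
    have hne : ∀ z ∈ K, z - b' ≠ 0 := fun z hz h => by
      have := hfar b' hb' z hz
      rw [h, norm_zero] at this
      linarith
    obtain ⟨l2, hl2, hle2⟩ := exists_log_near_one (K := K) (u := fun z => (z - b) / (z - b'))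
      (ContinuousOn.div (by fun_prop) (by fun_prop) hne)
      (fun z hz => by
        have : (z - b) / (z - b') - 1 = (b' - b) / (z - b') := by
          rw [div_sub_one (hne z hz)]; ring
        rw [this, norm_div, div_lt_one (norm_pos_iff.2 (hne z hz)), ← dist_eq_norm]
        exact hd.trans_le (hfar b' hb' z hz))
    refine ⟨fun z => l z + l2 z, hl.add hl2, fun z hz => ?_⟩
    rw [Complex.exp_add, hle z hz, hle2 z hz, mul_div_cancel₀ _ (hne z hz)]
  have haS : a ∈ S := ⟨ha, hno⟩
  let O : Set ℂ := ⋃ b ∈ S, Metric.ball b (δ / 2)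
  have hO : O ⊆ Q := by
    refine hQn O (isOpen_biUnion fun _ _ => Metric.isOpen_ball) ?_ ?_
    · refine (Metric.isBounded_ball (x := (0 : ℂ)) (r := R + δ)).subset ?_
      intro x hx
      simp only [O, mem_iUnion, Metric.mem_ball, exists_prop] at hx
      obtain ⟨b, hb, hxb⟩ := hx
      rw [Metric.mem_ball, dist_zero_right]
      have h1 := hSb b hb
      have h2 : ‖x‖ ≤ dist x b + ‖b‖ := by
        rw [dist_eq_norm]; simpa using norm_add_le (x - b) b
      linarith
    · rintro x ⟨hx1, hx2⟩
      by_contra hxQ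
      obtain ⟨y, hy, hxy⟩ := Metric.mem_closure_iff.1 hx1 (δ / 2) (by positivity)
      simp only [O, mem_iUnion, Metric.mem_ball, exists_prop] at hy
      obtain ⟨b, hb, hyb⟩ := hy
      have hxS : x ∈ S := hSstep b hb x hxQ ((dist_triangle x y b).trans_lt (by linarith))
      refine hx2 (mem_interior.2 ⟨Metric.ball x (δ / 2), ?_, Metric.isOpen_ball,
        Metric.mem_ball_self (by positivity)⟩)
      exact subset_biUnion_of_mem (u := fun b => Metric.ball b (δ / 2)) hxS
  exact ha (hO (mem_biUnion haS (Metric.mem_ball_self (by positivity))))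

/-- On a domain without holes there is a branch of `log (z - a)` for each `a` outside. -/
theorem HasNoHoles.exists_log {Q : Set ℂ} (hQn : HasNoHoles Q) (hQ : IsOpen Q)
    (hQc : IsConnected Q) {a : ℂ} (ha : a ∉ Q) :
    ∃ l : ℂ → ℂ, ContinuousOn l Q ∧ ∀ z ∈ Q, Complex.exp (l z) = z - a := by
  classical
  have : PathConnectedSpace Q :=
    isPathConnected_iff_pathConnectedSpace.1 ((hQ.isConnected_iff_isPathConnected).1 hQc)
  have : LocallyPathConnectedSpace Q := hQ.locallyPathConnectedSpace
  obtain ⟨x₀, hx₀⟩ := hQc.nonempty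
  have hne : ∀ z ∈ Q, z - a ≠ 0 := fun z hz h => ha (by rwa [← sub_eq_zero.1 h])
  let f : C(Q, {z : ℂ // z ≠ 0}) :=
    ⟨fun z => ⟨z - a, hne z z.2⟩, by fun_prop⟩
  have cov := Complex.isCoveringMap_exp
  have he : (⟨_, (Complex.log (x₀ - a)).exp_ne_zero⟩ : {z : ℂ // z ≠ 0}) = f ⟨x₀, hx₀⟩ :=
    Subtype.ext (Complex.exp_log (hne x₀ hx₀))
  obtain ⟨F, ⟨-, hF⟩, -⟩ := cov.isLocalHomeomorph.existsUnique_continuousMap_lifts f ⟨x₀, hx₀⟩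
    (Complex.log (x₀ - a)) he
    (fun γ hγ => by
      obtain ⟨Γ, h1, h2⟩ := cov.exists_path_lifts (f.comp γ) (Complex.log (x₀ - a))
        (by simp [hγ, he])
      exact ⟨Γ, h2, h1⟩)
    (by
      intro γ γ' Γ Γ' hγ hγ' hΓ hΓ' hl hl' h1
      let K : Set ℂ := range (fun t => (γ t : ℂ)) ∪ range (fun t => (γ' t : ℂ))
      have hK : IsCompact K := (isCompact_range (by fun_prop)).union (isCompact_range (by fun_prop))
      have hKQ : K ⊆ Q := by rintro _ (⟨t, rfl⟩ | ⟨t, rfl⟩) <;> exact Subtype.prop _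
      obtain ⟨l, hlc, hle⟩ := hQn.exists_log_on_compact hQ hK hKQ ha
      -- A lift of a path in `K` differs from the branch of the logarithm by a constant.
      have key : ∀ (η : C(unitInterval, Q)) (E : C(unitInterval, ℂ)), (∀ t, (η t : ℂ) ∈ K) →
          ((fun z : ℂ ↦ (⟨_, z.exp_ne_zero⟩ : {z : ℂ // z ≠ 0})) ∘ E = f.comp η) →
          E 1 = l (η 1) + (E 0 - l (η 0)) := by
        intro η E hη hE
        have hc : Continuous fun t => l (η t) :=
          hlc.comp_continuous (by fun_prop) hη
        have hexp : ∀ t, Complex.exp (E t) = (η t : ℂ) - a := fun t => by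
          have := congrArg Subtype.val (congrFun hE t)
          simpa [f] using this
        have := cov.eq_of_comp_eq (g₁ := fun t => E t)
          (g₂ := fun t => l (η t) + (E 0 - l (η 0))) (by fun_prop) (hc.add continuous_const) (by
            funext t
            simp only [Function.comp_apply, Subtype.mk.injEq]
            rw [Complex.exp_add, Complex.exp_sub, hexp, hexp, hle _ (hη t), hle _ (hη 0),
              div_self (hne _ (η 0).2), mul_one]) 0 (by simp)
        exact congrFun this 1
      rw [key γ Γ (fun t => Or.inl ⟨t, rfl⟩) hl, key γ' Γ' (fun t => Or.inr ⟨t, rfl⟩) hl', hγ, hγ',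
        hΓ, hΓ', h1])
  refine ⟨fun z => if hz : z ∈ Q then F ⟨z, hz⟩ else 0, ?_, fun z hz => ?_⟩
  · rw [continuousOn_iff_continuous_domRestrict]
    convert F.continuous using 1
    ext z
    simp
  · have := congrArg Subtype.val (congrFun hF ⟨z, hz⟩)
    simpa [hz, f] using this

/-! ### Coverings between plane domains -/

/-- A proper holomorphic map is a covering over the set of regular values. -/
theorem IsProperOn.isCoveringMapOn {f : ℂ → ℂ} {C V : Set ℂ} (H : IsProperOn f C V)
    (hC : IsOpen C) (hV : IsOpen V) (hf : DifferentiableOn ℂ f C) (s : Set V)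
    (hs : ∀ z : C, H.mapsTo.restrict f C V z ∈ s → deriv f z ≠ 0) :
    IsCoveringMapOn (H.mapsTo.restrict f C V) s := by
  obtain ⟨_, hp⟩ := H.isProperMap hV
  have hloc : IsLocalHomeomorphOn (H.mapsTo.restrict f C V) (H.mapsTo.restrict f C V ⁻¹' s) := by
    refine IsLocalHomeomorphOn.of_comp_left (g := ((↑) : V → ℂ)) ?_
      ((hV.isOpenEmbedding_subtypeVal.isLocalHomeomorph).isLocalHomeomorphOn.mono (subset_univ _))
      (fun x _ => hp.continuous.continuousAt)
    have h1 : IsLocalHomeomorphOn f (C ∩ {z | deriv f z ≠ 0}) := by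
      rintro x ⟨hx, hx'⟩
      have hsd : HasStrictDerivAt f (deriv f x) x :=
        ((hf.analyticOnNhd hC) x hx).hasStrictDerivAt
      exact ⟨_, (hsd.hasStrictFDerivAt_equiv hx').mem_toOpenPartialHomeomorph_source, by simp⟩
    have h2 : IsLocalHomeomorphOn ((↑) : C → ℂ) (H.mapsTo.restrict f C V ⁻¹' s) :=
      hC.isOpenEmbedding_subtypeVal.isLocalHomeomorph.isLocalHomeomorphOn.mono (subset_univ _)
    exact h1.comp h2 (fun x hx => ⟨x.2, hs x hx⟩)
  refine hp.isClosedMap.isCoveringMapOn_of_isLocalHomeomorphOn (fun x hx => ?_) hloc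
  refine (hp.isCompact_preimage isCompact_singleton).finite
    (.of_openPartialHomeomorph (H.mapsTo.restrict f C V) subset_rfl fun e he => ?_)
  obtain ⟨φ, h1, h2⟩ := hloc e (by
    have : H.mapsTo.restrict f C V e = x := he
    rw [mem_preimage, this]; exact hx)
  exact ⟨φ, h1, h2.symm⟩

/-- A proper holomorphic map without critical points onto a simply connected domain is
injective. -/
theorem IsProperOn.injOn_of_deriv_ne_zero {f : ℂ → ℂ} {C V : Set ℂ} (H : IsProperOn f C V)
    (hC : IsOpen C) (hCc : IsPreconnected C) (hV : IsOpen V) (hVs : IsSimplyConnected V)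
    (hf : DifferentiableOn ℂ f C) (hd : ∀ z ∈ C, deriv f z ≠ 0) : InjOn f C := by
  rcases C.eq_empty_or_nonempty with rfl | ⟨c, hc⟩
  · simp
  have : SimplyConnectedSpace V := hVs.simplyConnectedSpace
  have : LocallyPathConnectedSpace V := hV.locallyPathConnectedSpace
  have : PreconnectedSpace C := isPreconnected_iff_preconnectedSpace.1 hCc
  have cov : IsCoveringMap (H.mapsTo.restrict f C V) :=
    isCoveringMap_iff_isCoveringMapOn_univ.2
      (H.isCoveringMapOn hC hV hf univ fun z _ => hd z z.2)
  obtain ⟨S, ⟨hS0, hS⟩, -⟩ := cov.existsUnique_continuousMap_lifts (ContinuousMap.id V)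
    (H.mapsTo.restrict f C V ⟨c, hc⟩) ⟨c, hc⟩ rfl
  have h1 : (S ∘ H.mapsTo.restrict f C V) = id :=
    cov.eq_of_comp_eq (S.continuous.comp cov.continuous) continuous_id
      (by rw [← Function.comp_assoc, hS]; rfl) ⟨c, hc⟩ hS0
  intro x hx y hy hxy
  have hx1 := congrFun h1 ⟨x, hx⟩
  have hy1 := congrFun h1 ⟨y, hy⟩
  have h2 : H.mapsTo.restrict f C V ⟨x, hx⟩ = H.mapsTo.restrict f C V ⟨y, hy⟩ := Subtype.ext hxy
  simp only [Function.comp_apply, id] at hx1 hy1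
  rw [h2, hy1] at hx1
  exact (congrArg Subtype.val hx1).symm

theorem isDiscrete_rootsOfUnity_set {d : ℕ} (hd : d ≠ 0) : IsDiscrete {z : ℂ | z ^ d = 1} := by
  have : {z : ℂ | z ^ d = 1}.Finite := by
    have h := (Polynomial.nthRoots d (1 : ℂ)).toFinset.finite_toSet
    refine h.subset fun z hz => ?_
    simp only [Multiset.mem_toFinset, Finset.mem_coe]
    exact (Polynomial.mem_nthRoots (Nat.pos_of_ne_zero hd)).2 hz
  exact this.isDiscrete

/-- A continuous function on a connected set whose `d`-th power is `1` is constant. -/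
theorem IsPreconnected.eq_of_pow_eq_one {α : Type*} [TopologicalSpace α] {S : Set α}
    (hS : IsPreconnected S) {R : α → ℂ} (hR : ContinuousOn R S) {d : ℕ} (hd : d ≠ 0)
    (h : ∀ x ∈ S, R x ^ d = 1) {x y : α} (hx : x ∈ S) (hy : y ∈ S) : R x = R y :=
  hS.constant_of_mapsTo (isDiscrete_rootsOfUnity_set hd) hR (fun x hx => h x hx) hx hy

/-- A continuous `d`-th root `κ` of a function analytic and non-zero at `0` is strictly
differentiable at `0`. -/
theorem hasStrictDerivAt_root {u κ : ℂ → ℂ} {d : ℕ} (hd : d ≠ 0) (hu : AnalyticAt ℂ u 0)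
    (hκc : ContinuousAt κ 0) (hκ : ∀ᶠ z in 𝓝 0, κ z ^ d = u z) (hκ0 : κ 0 ≠ 0) :
    ∃ κ' : ℂ, HasStrictDerivAt κ κ' 0 := by
  have hpow : HasStrictDerivAt (fun x : ℂ => x ^ d) ((d : ℂ) * κ 0 ^ (d - 1)) (κ 0) :=
    hasStrictDerivAt_pow d (κ 0)
  have hne : (d : ℂ) * κ 0 ^ (d - 1) ≠ 0 := mul_ne_zero (by exact_mod_cast hd) (pow_ne_zero _ hκ0)
  have h1 := hpow.to_localInverse hne
  have h0 : κ 0 ^ d = u 0 := hκ.self_of_nhds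
  simp only [h0] at h1
  have h2 := HasStrictDerivAt.comp (0 : ℂ) h1 hu.hasStrictDerivAt
  refine ⟨_, h2.congr_of_eventuallyEq ?_⟩
  have h3 := hκc.eventually (hpow.eventually_left_inverse hne)
  filter_upwards [h3, hκ] with z hz1 hz2
  simp only [Function.comp_apply, ← hz2]
  exact hz1

/-- The fibre of a non-constant proper holomorphic map is finite. -/
theorem IsProperOn.finite_fibre {f : ℂ → ℂ} {C V : Set ℂ} (H : IsProperOn f C V)
    (hC : IsOpen C) (hCc : IsPreconnected C) (hf : DifferentiableOn ℂ f C) {v : ℂ} (hv : v ∈ V) :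
    (C ∩ f ⁻¹' {v}).Finite := by
  by_contra hinf
  have hcomp := H.isCompact_preimage {v} (by simpa using hv) isCompact_singleton
  obtain ⟨z, hz, hacc⟩ :=
    Set.Infinite.exists_accPt_of_subset_isCompact hinf hcomp Subset.rfl
  have := (hf.analyticOnNhd hC).eqOn_of_preconnected_of_frequently_eq
    (g := fun _ => v) analyticOnNhd_const hCc hz.1 (by
      rw [accPt_iff_frequently_nhdsNE] at hacc
      exact hacc.mono fun w hw => hw.2)
  rw [inter_eq_self_of_subset_left (show C ⊆ f ⁻¹' {v} from fun x hx => this hx)] at hcomp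
  exact not_isCompact_of_isOpen hC ⟨z, hz.1⟩ hcomp

/-- A disk can be mapped homeomorphically onto the plane, with a given point going to `0`. -/
theorem IsTopologicalDisk.exists_homeomorph_plane {D : Set ℂ} (hD : IsTopologicalDisk D) (v : D) :
    ∃ e : D ≃ₜ ℂ, e v = 0 := by
  obtain ⟨-, ⟨e⟩⟩ := hD
  let e' : D ≃ₜ ℂ := e.trans Homeomorph.unitBall.symm
  exact ⟨e'.trans (Homeomorph.addRight (-e' v)), by simp⟩

/-! ### Unicritical coverings between disks -/

/-- Let `f : C → V` be a proper holomorphic map between disks with `0` as its only critical point.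
The universal covering `exp` of `ℂ ∖ {0}`, transported to `V ∖ {f 0}`, lifts through `f` to a map
`F` of the plane onto the complement of the fibre of `f 0`. -/
theorem IsProperOn.exists_exp_lift {f : ℂ → ℂ} {C V : Set ℂ} (H : IsProperOn f C V)
    (hC : IsTopologicalDisk C) (hV : IsTopologicalDisk V) (hf : DifferentiableOn ℂ f C)
    (h0 : (0 : ℂ) ∈ C) (hd : ∀ z ∈ C, deriv f z = 0 → z = 0) :
    ∃ (e : V ≃ₜ ℂ) (F : ℂ → ℂ), e ⟨f 0, H.mapsTo h0⟩ = 0 ∧ Continuous F ∧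
      (∀ ζ, ∃ h : F ζ ∈ C, e ⟨f (F ζ), H.mapsTo h⟩ = Complex.exp ζ) ∧
      (∀ z ∈ C, f z ≠ f 0 → ∃ ζ, F ζ = z) ∧
      (∀ a ζ₀, F (ζ₀ + a) = F ζ₀ → Complex.exp a = 1 → ∀ ζ, F (ζ + a) = F ζ) := by
  set v : V := ⟨f 0, H.mapsTo h0⟩ with hv
  obtain ⟨e, he⟩ := hV.exists_homeomorph_plane v
  have hCc : IsConnected C := by
    have := hC.isSimplyConnected.isPathConnected
    exact this.isConnected
  have hVc : IsConnected V := hV.isSimplyConnected.isPathConnected.isConnected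
  set p := H.mapsTo.restrict f C V with hp
  have cov0 : IsCoveringMapOn p ({v}ᶜ : Set V) :=
    H.isCoveringMapOn hC.1 hV.1 hf _ fun z hz hz' => hz (by
      have := hd z z.2 hz'
      apply Subtype.ext
      simp [hv, this])
  have cov := cov0.isCoveringMap_restrictPreimage
  set p' := ({v}ᶜ : Set V).restrictPreimage p with hp'
  have hne : ∀ ζ : ℂ, e.symm (Complex.exp ζ) ∈ ({v}ᶜ : Set V) := by
    intro ζ h
    have h1 : e.symm (Complex.exp ζ) = v := h
    rw [Homeomorph.symm_apply_eq, he] at h1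
    exact Complex.exp_ne_zero ζ h1
  let E : C(ℂ, ({v}ᶜ : Set V)) := ⟨fun ζ => ⟨e.symm (Complex.exp ζ), hne ζ⟩, by fun_prop⟩
  -- the base point of the lift
  have hsurj : f '' C = V := H.image_eq hV.1 hVc.isPreconnected ⟨0, h0⟩
    (H.isOpen_image hC.1 hCc.isPreconnected hf Subset.rfl hC.1)
  obtain ⟨w, hwC, hw⟩ : (E 0 : V).1 ∈ f '' C := hsurj ▸ (E 0 : V).2
  let w₀ : p ⁻¹' ({v}ᶜ : Set V) := ⟨⟨w, hwC⟩, by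
    have : p ⟨w, hwC⟩ = (E 0 : V) := Subtype.ext hw
    rw [mem_preimage, this]; exact (E 0).2⟩
  have hw₀ : p' w₀ = E 0 := Subtype.ext (Subtype.ext hw)
  obtain ⟨F, ⟨hF0, hF⟩, -⟩ := cov.existsUnique_continuousMap_lifts E (0 : ℂ) w₀ hw₀
  have hpF : ∀ ζ, p (F ζ).1 = e.symm (Complex.exp ζ) := fun ζ =>
    congrArg Subtype.val (congrFun hF ζ)
  refine ⟨e, fun ζ => ((F ζ).1 : ℂ), he, by fun_prop, fun ζ => ⟨(F ζ).1.2, ?_⟩, ?_, ?_⟩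
  · rw [← Homeomorph.eq_symm_apply]
    exact hpF ζ
  · -- every point off the fibre is joined to the base point by a path that avoids the fibre
    intro z hz hzv
    obtain ⟨e', -⟩ := hC.exists_homeomorph_plane ⟨0, h0⟩
    have hZ : (p ⁻¹' {v}).Finite := by
      refine Set.Finite.of_finite_image (f := ((↑) : C → ℂ)) ?_ Subtype.val_injective.injOn
      refine (H.finite_fibre hC.1 hCc.isPreconnected hf v.2).subset ?_
      rintro _ ⟨x, hx, rfl⟩
      exact ⟨x.2, congrArg Subtype.val (show p x = v from hx)⟩
    have hZc : IsPathConnected (e' '' (p ⁻¹' {v}))ᶜ :=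
      (hZ.image e').countable.isPathConnected_compl_of_one_lt_rank (by simp)
    have hmem : ∀ x : C, p x ≠ v → e' x ∈ (e' '' (p ⁻¹' {v}))ᶜ := by
      rintro x hx ⟨y, hy, hxy⟩
      exact hx (e'.injective hxy ▸ hy)
    obtain ⟨γ, hγ⟩ := hZc.joinedIn _ (hmem w₀.1 w₀.2) _
      (hmem ⟨z, hz⟩ fun h => hzv (congrArg Subtype.val h))
    have hγ' : ∀ t, e'.symm (γ t) ∈ p ⁻¹' ({v}ᶜ : Set V) := fun t ht =>
      hγ t ⟨e'.symm (γ t), ht, by simp⟩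
    let G : C(unitInterval, p ⁻¹' ({v}ᶜ : Set V)) := ⟨fun t => ⟨e'.symm (γ t), hγ' t⟩, by fun_prop⟩
    have hex : ∀ x : ({v}ᶜ : Set V), e x ≠ 0 := fun x hx => x.2 (by
      rw [← he] at hx
      exact e.injective hx)
    let η : C(unitInterval, {z : ℂ // z ≠ 0}) :=
      ⟨fun t => ⟨e (p' (G t)), hex _⟩, by
        have := cov.continuous
        fun_prop⟩
    have hG0 : G 0 = w₀ := by
      apply Subtype.ext
      simp [G]
    obtain ⟨Γ, hΓ, hΓ0⟩ := Complex.isCoveringMap_exp.exists_path_lifts η 0 (by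
      apply Subtype.ext
      simp [η, hG0, hw₀, E])
    have hlift : (F ∘ Γ) = G := by
      refine cov.eq_of_comp_eq (F.continuous.comp Γ.continuous) G.continuous ?_ 0 ?_
      · funext t
        have h1 := congrArg Subtype.val (congrFun hΓ t)
        simp only [Function.comp_apply, η, ContinuousMap.coe_mk] at h1
        have h2 := congrFun hF (Γ t)
        simp only [Function.comp_apply] at h2 ⊢
        change p' (F (Γ t)) = _
        rw [h2]
        apply Subtype.ext
        simp [E, h1]
      · simp [hΓ0, hG0, hF0]
    refine ⟨Γ 1, ?_⟩
    have := congrFun hlift 1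
    simp only [Function.comp_apply] at this
    change ((F (Γ 1)).1 : ℂ) = z
    rw [this]
    simp [G]
  · intro a ζ₀ h1 ha ζ
    have := cov.eq_of_comp_eq (g₁ := fun ζ => F (ζ + a)) (g₂ := F) (by fun_prop) F.continuous (by
      rw [hF]
      funext ζ
      have h2 := congrFun hF (ζ + a)
      simp only [Function.comp_apply] at h2 ⊢
      change p' (F (ζ + a)) = _
      rw [h2]
      apply Subtype.ext
      simp [E, Complex.exp_add, ha]) ζ₀ (Subtype.ext (Subtype.ext h1))
    exact congrArg (fun x => ((x.1 : C) : ℂ)) (congrFun this ζ)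

/-- Values of a proper map close to `v` are only taken close to the fibre of `v`. -/
theorem IsProperOn.exists_ball_preimage_subset {f : ℂ → ℂ} {C V : Set ℂ} (H : IsProperOn f C V)
    (hV : IsOpen V) (e : V ≃ₜ ℂ) (v : V) (he : e v = 0) {U : Set ℂ} (hU : IsOpen U)
    (hfib : ∀ z ∈ C, f z = v → z ∈ U) :
    ∃ ε > 0, ∀ (z : ℂ) (hz : z ∈ C), ‖e ⟨f z, H.mapsTo hz⟩‖ < ε → z ∈ U := by
  obtain ⟨_, hp⟩ := H.isProperMap hV
  have hcl : IsClosed (H.mapsTo.restrict f C V '' ((↑) ⁻¹' Uᶜ)) :=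
    hp.isClosedMap _ (hU.isClosed_compl.preimage continuous_subtype_val)
  have hcl2 : IsClosed (e '' (H.mapsTo.restrict f C V '' ((↑) ⁻¹' Uᶜ))) := e.isClosedMap _ hcl
  have hnot : (0 : ℂ) ∈ (e '' (H.mapsTo.restrict f C V '' ((↑) ⁻¹' Uᶜ)))ᶜ := by
    rintro ⟨_, ⟨x, hx, rfl⟩, hx0⟩
    rw [← he] at hx0
    exact hx (hfib x x.2 (congrArg Subtype.val (e.injective hx0)))
  obtain ⟨ε, hε, hb⟩ := Metric.isOpen_iff.1 hcl2.isOpen_compl 0 hnot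
  refine ⟨ε, hε, fun z hz hzε => ?_⟩
  by_contra hzU
  exact hb (mem_ball_zero_iff.2 hzε) ⟨_, ⟨⟨z, hz⟩, hzU, rfl⟩, rfl⟩

/-- A proper holomorphic map between disks that has `0` as its only critical point takes the
value `f 0` only at `0`. -/
theorem IsProperOn.eq_zero_of_eq {f : ℂ → ℂ} {C V : Set ℂ} (H : IsProperOn f C V)
    (hC : IsTopologicalDisk C) (hV : IsTopologicalDisk V) (hf : DifferentiableOn ℂ f C)
    (h0 : (0 : ℂ) ∈ C) (hd : ∀ z ∈ C, deriv f z = 0 → z = 0) {z : ℂ} (hz : z ∈ C)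
    (hfz : f z = f 0) : z = 0 := by
  obtain ⟨e, F, he, hF, hexp, hsurj, -⟩ := H.exists_exp_lift hC hV hf h0 hd
  have hCc : IsConnected C := hC.isSimplyConnected.isPathConnected.isConnected
  by_contra hz0
  have hfin := H.finite_fibre hC.1 hCc.isPreconnected hf (H.mapsTo h0)
  set Z := C ∩ f ⁻¹' {f 0} with hZ
  obtain ⟨U₁, U₂, hU₁, hU₂, h1, h2, hdis⟩ := SeparatedNhds.of_isCompact_isCompact_isClosed
    (isCompact_singleton (x := (0 : ℂ))) (hfin.subset (sdiff_subset (s := Z) (t := {0}))).isCompact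
    (hfin.subset (sdiff_subset (s := Z) (t := {0}))).isClosed disjoint_sdiff_right
  obtain ⟨ε, hε, hb⟩ := H.exists_ball_preimage_subset hV.1 e _ he (hU₁.union hU₂)
    (fun x hx hfx => by
      by_cases hx0 : x = 0
      · exact Or.inl (h1 hx0)
      · exact Or.inr (h2 ⟨⟨hx, hfx⟩, hx0⟩))
  -- the image of a left half-plane is connected and accumulates on the whole fibre
  let L : Set ℂ := {ζ | ζ.re < Real.log ε}
  have hL : IsPreconnected L := (convex_halfSpace_re_lt _).isPreconnected
  have hLε : ∀ ζ : ℂ, ζ ∈ L ↔ ‖Complex.exp ζ‖ < ε := fun ζ => by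
    rw [Complex.norm_exp, ← Real.lt_log_iff_exp_lt hε]; rfl
  have hFL : F '' L ⊆ U₁ ∪ U₂ := by
    rintro _ ⟨ζ, hζ, rfl⟩
    obtain ⟨hC', hEq⟩ := hexp ζ
    exact hb _ hC' (by rw [hEq]; exact (hLε ζ).1 hζ)
  have hmeet : ∀ U : Set ℂ, IsOpen U → ∀ x ∈ C, f x = f 0 → x ∈ U → (F '' L ∩ U).Nonempty := by
    intro U hU x hx hfx hxU
    have hcont : ContinuousOn (fun y : C => e ⟨f y, H.mapsTo y.2⟩) univ := by
      have : Continuous (H.mapsTo.restrict f C V) := H.continuousOn.mapsToRestrict H.mapsTo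
      exact (e.continuous.comp this).continuousOn
    have hopen :
        IsOpen ((↑) '' ((fun y : C => e ⟨f y, H.mapsTo y.2⟩) ⁻¹' Metric.ball 0 ε) : Set ℂ) :=
      hC.1.isOpenEmbedding_subtypeVal.isOpenMap _
        ((continuousOn_univ.1 hcont).isOpen_preimage _ Metric.isOpen_ball)
    set B : Set ℂ := (↑) '' ((fun y : C => e ⟨f y, H.mapsTo y.2⟩) ⁻¹' Metric.ball 0 ε) with hB
    have hxB : x ∈ B ∩ U := by
      refine ⟨⟨⟨x, hx⟩, ?_, rfl⟩, hxU⟩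
      have : (⟨f x, H.mapsTo hx⟩ : V) = ⟨f 0, H.mapsTo h0⟩ := Subtype.ext hfx
      simp only [mem_preimage, this, he, Metric.mem_ball, dist_self, hε]
    have hinf : (B ∩ U).Infinite := fun hfin' =>
      not_isCompact_of_isOpen (hopen.inter hU) ⟨x, hxB⟩ hfin'.isCompact
    obtain ⟨y, ⟨⟨y', hy', rfl⟩, hyU⟩, hyZ⟩ := hinf.exists_notMem_finite hfin
    obtain ⟨ζ, hζ⟩ := hsurj y' y'.2 (fun h => hyZ ⟨y'.2, h⟩)
    obtain ⟨hC', hEq⟩ := hexp ζ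
    refine ⟨y', ⟨ζ, (hLε ζ).2 ?_, hζ⟩, hyU⟩
    rw [← hEq]
    have h3 : (⟨f (F ζ), H.mapsTo hC'⟩ : V) = ⟨f y', H.mapsTo y'.2⟩ :=
      Subtype.ext (congrArg f hζ)
    rw [h3]
    simpa using hy'
  obtain ⟨x, hxL, hx⟩ := hL.image F hF.continuousOn U₁ U₂ hU₁ hU₂ hFL
    (hmeet U₁ hU₁ 0 h0 rfl (h1 rfl)) (hmeet U₂ hU₂ z hz hfz (h2 ⟨⟨hz, hfz⟩, hz0⟩))
  exact Set.disjoint_left.1 hdis hx.1 hx.2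

/-- Uniformizing coordinate of a unicritical branched covering between disks: up to the
translation by `f 0`, the map is the `d`-th power of an injective continuous function. -/
theorem IsProperOn.exists_injOn_root {f : ℂ → ℂ} {C V : Set ℂ} (H : IsProperOn f C V)
    (hC : IsTopologicalDisk C) (hV : IsTopologicalDisk V) (hf : DifferentiableOn ℂ f C)
    (h0 : (0 : ℂ) ∈ C) (hd : ∀ z ∈ C, deriv f z = 0 → z = 0) {d : ℕ} (hd0 : d ≠ 0)
    (hord : analyticOrderAt (fun z => f z - f 0) 0 = d) :
    ∃ ψ : ℂ → ℂ, ContinuousOn ψ C ∧ InjOn ψ C ∧ ∀ z ∈ C, ψ z ^ d = f z - f 0 := by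
  classical
  have hfa : AnalyticAt ℂ (fun z => f z - f 0) 0 :=
    ((hf.analyticOnNhd hC.1) 0 h0).sub analyticAt_const
  have hfib : ∀ z ∈ C, f z = f 0 → z = 0 := fun z hz h => H.eq_zero_of_eq hC hV hf h0 hd hz h
  obtain ⟨u₀, hu₀, hu₀0, hu₀e⟩ := hfa.analyticOrderAt_eq_natCast.1 hord
  simp only [sub_zero, smul_eq_mul] at hu₀e
  let u : ℂ → ℂ := fun z => if z = 0 then u₀ 0 else (f z - f 0) / z ^ d
  have hue : u =ᶠ[𝓝 0] u₀ := by
    filter_upwards [hu₀e] with z hz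
    by_cases hz0 : z = 0
    · simp [u, hz0]
    · simp only [u, hz0, if_false, hz]
      field_simp
  have hua : AnalyticAt ℂ u 0 := hu₀.congr hue.symm
  have huc : ContinuousOn u C := by
    intro z hz
    by_cases hz0 : z = 0
    · subst hz0; exact hua.continuousAt.continuousWithinAt
    · have h1 : ContinuousAt (fun z => (f z - f 0) / z ^ d) z := by
        have h2 : ContinuousAt f z := (hf.differentiableAt (hC.1.mem_nhds hz)).continuousAt
        exact (h2.sub continuousAt_const).div (continuousAt_id.pow d) (pow_ne_zero d hz0)
      refine (h1.congr ?_).continuousWithinAt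
      filter_upwards [isOpen_ne.mem_nhds hz0] with w hw
      simp [u, show w ≠ 0 from hw]
  have hu0 : ∀ z ∈ C, u z ≠ 0 := by
    intro z hz
    by_cases hz0 : z = 0
    · simpa [u, hz0] using hu₀0
    · simp only [u, hz0, if_false]
      exact div_ne_zero (sub_ne_zero.2 fun h => hz0 (hfib z hz h)) (pow_ne_zero d hz0)
  obtain ⟨κ, hκc, hκ⟩ := Complex.exists_continuousOn_pow_eq hC.isSimplyConnected hC.1 huc
    (by rintro ⟨z, hz, h⟩; exact hu0 z hz h) hd0
  have hκ0 : κ 0 ≠ 0 := fun h => hu0 0 h0 (by rw [← hκ, h, zero_pow hd0])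
  let ψ : ℂ → ℂ := fun z => z * κ z
  have hψd : ∀ z ∈ C, ψ z ^ d = f z - f 0 := by
    intro z hz
    by_cases hz0 : z = 0
    · simp [ψ, hz0, hd0]
    · simp only [ψ, mul_pow, hκ, u, hz0, if_false]
      field_simp
  have hψc : ContinuousOn ψ C := continuousOn_id.mul hκc
  obtain ⟨κ', hκ'⟩ := hasStrictDerivAt_root hd0 hua (hκc.continuousAt (hC.1.mem_nhds h0))
    (Eventually.of_forall hκ) hκ0
  have hψ' : HasStrictDerivAt ψ (κ 0) 0 := by
    have := (hasStrictDerivAt_id (0 : ℂ)).mul hκ'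
    simp only [id, one_mul, zero_mul, add_zero] at this
    exact this
  obtain ⟨B, hBo, hB0, hBinj⟩ : ∃ B : Set ℂ, IsOpen B ∧ (0 : ℂ) ∈ B ∧ InjOn ψ B := by
    let φ := (hψ'.hasStrictFDerivAt_equiv hκ0).toOpenPartialHomeomorph ψ
    refine ⟨φ.source, φ.open_source,
      (hψ'.hasStrictFDerivAt_equiv hκ0).mem_toOpenPartialHomeomorph_source, ?_⟩
    have := φ.injOn
    simpa [φ] using this
  obtain ⟨e, F, he, hF, hexp, hsurj, hper⟩ := H.exists_exp_lift hC hV hf h0 hd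
  obtain ⟨ε, hε, hb⟩ := H.exists_ball_preimage_subset hV.1 e _ he hBo
    (fun z hz h => (hfib z hz h).symm ▸ hB0)
  have hFC : ∀ ζ, F ζ ∈ C := fun ζ => (hexp ζ).1
  have hFE : ∀ ζ, e ⟨f (F ζ), H.mapsTo (hFC ζ)⟩ = Complex.exp ζ := fun ζ => (hexp ζ).2
  have hψ0 : ∀ z ∈ C, ψ z = 0 → z = 0 := fun z hz h => hfib z hz (by
    have := hψd z hz
    rw [h, zero_pow hd0] at this
    exact (sub_eq_zero.1 this.symm))
  refine ⟨ψ, hψc, ?_, hψd⟩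
  intro x hx y hy hxy
  have hfxy : f x = f y := by
    have h1 := hψd x hx
    have h2 := hψd y hy
    rw [hxy, h2] at h1
    linear_combination -h1
  by_cases hx0 : f x = f 0
  · rw [hfib x hx hx0, hfib y hy (hfxy ▸ hx0)]
  obtain ⟨ζ, rfl⟩ := hsurj x hx hx0
  obtain ⟨ζ', rfl⟩ := hsurj y hy (hfxy ▸ hx0)
  -- the two points are `F ζ` and `F (ζ + a)` for a period `a` of `exp`
  set a := ζ' - ζ with ha
  have hζ' : ζ' = ζ + a := by rw [ha]; ring
  have ha1 : Complex.exp a = 1 := by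
    rw [ha, Complex.exp_sub, ← hFE ζ', ← hFE ζ]
    have h3 : (⟨f (F ζ'), H.mapsTo (hFC ζ')⟩ : V) = ⟨f (F ζ), H.mapsTo (hFC ζ)⟩ :=
      Subtype.ext hfxy.symm
    rw [h3]
    refine div_self ?_
    rw [hFE]
    exact Complex.exp_ne_zero _
  have hFper : ∀ t, f (F (t + a)) = f (F t) := by
    intro t
    have h3 : (⟨f (F (t + a)), H.mapsTo (hFC _)⟩ : V) = ⟨f (F t), H.mapsTo (hFC t)⟩ := by
      apply e.injective
      rw [hFE, hFE, Complex.exp_add, ha1, mul_one]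
    exact congrArg Subtype.val h3
  have hne : ∀ t, ψ (F t) ≠ 0 := by
    intro t h
    have h1 := hψ0 _ (hFC t) h
    have h2 := hFE t
    have h3 : (⟨f (F t), H.mapsTo (hFC t)⟩ : V) = ⟨f 0, H.mapsTo h0⟩ := Subtype.ext (by
      simp only [h1])
    rw [h3, he] at h2
    exact Complex.exp_ne_zero t h2.symm
  have hψF : Continuous fun t => ψ (F t) := hψc.comp_continuous hF hFC
  have hconst : ∀ t, ψ (F (t + a)) / ψ (F t) = ψ (F (ζ + a)) / ψ (F ζ) := by
    intro t
    refine isPreconnected_univ.eq_of_pow_eq_one (R := fun t => ψ (F (t + a)) / ψ (F t))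
      (Continuous.continuousOn ?_) hd0 (fun s _ => ?_) (mem_univ t) (mem_univ ζ)
    · exact (hψF.comp (continuous_add_const a)).div hψF hne
    · rw [div_pow, hψd _ (hFC _), hψd _ (hFC _), hFper, ← hψd _ (hFC s)]
      exact div_self (pow_ne_zero d (hne s))
  have hone : ∀ t, ψ (F (t + a)) = ψ (F t) := by
    intro t
    have h1 := hconst t
    rw [← hζ', ← hxy, div_self (hne ζ), div_eq_one_iff_eq (hne t)] at h1
    exact h1
  -- close to the critical point `ψ` is injective, so that `a` is a period of `F`
  let t₀ : ℂ := ((Real.log ε - 1 : ℝ) : ℂ)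
  have hnear : ‖Complex.exp t₀‖ < ε := by
    rw [Complex.norm_exp, ← Real.lt_log_iff_exp_lt hε]
    simp [t₀]
  have h5 : F (t₀ + a) = F t₀ := by
    refine hBinj (hb _ (hFC _) ?_) (hb _ (hFC _) ?_) (hone t₀)
    · rw [hFE, Complex.exp_add, ha1, mul_one]; exact hnear
    · rw [hFE]; exact hnear
  rw [hζ']
  exact (hper a t₀ h5 ha1 ζ).symm

/-- The fibres of a function whose translate is the `d`-th power of an injective function have at
most `d` points. -/
theorem encard_fibre_le_of_root {f ψ : ℂ → ℂ} {C : Set ℂ} {d : ℕ} (hd0 : d ≠ 0) {v : ℂ}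
    (hψ : InjOn ψ C) (hψd : ∀ z ∈ C, ψ z ^ d = f z - v) (w : ℂ) :
    (C ∩ f ⁻¹' {w}).encard ≤ d := by
  classical
  rw [← (hψ.mono inter_subset_left).encard_image]
  have h1 : ψ '' (C ∩ f ⁻¹' {w}) ⊆ ((Polynomial.nthRoots d (w - v)).toFinset : Set ℂ) := by
    rintro _ ⟨z, ⟨hz, hzw⟩, rfl⟩
    simp only [Multiset.mem_toFinset, Finset.mem_coe]
    rw [Polynomial.mem_nthRoots (Nat.pos_of_ne_zero hd0), hψd z hz]
    rw [show f z = w from hzw]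
  refine (encard_le_encard h1).trans ?_
  rw [encard_coe_eq_coe_finsetCard]
  exact_mod_cast (Multiset.toFinset_card_le _).trans (Polynomial.card_nthRoots d (w - v))

/-- Over a set without holes that avoids the critical value, a unicritical branched covering is
injective on connected sets. -/
theorem injOn_of_root {f ψ : ℂ → ℂ} {C Q P : Set ℂ} {d : ℕ} (hd0 : d ≠ 0) {v : ℂ}
    (hψc : ContinuousOn ψ C) (hψ : InjOn ψ C) (hψd : ∀ z ∈ C, ψ z ^ d = f z - v)
    (hf : ContinuousOn f C) (hQn : HasNoHoles Q) (hQ : IsOpen Q) (hQc : IsConnected Q)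
    (hv : v ∉ Q) (hP : IsPreconnected P) (hPC : P ⊆ C) (hPQ : MapsTo f P Q) : InjOn f P := by
  obtain ⟨l, hl, hle⟩ := hQn.exists_log hQ hQc hv
  have hdC : (d : ℂ) ≠ 0 := by exact_mod_cast hd0
  let ρ : ℂ → ℂ := fun z => Complex.exp (l (f z) / d)
  have hρd : ∀ z ∈ P, ρ z ^ d = f z - v := fun z hz => by
    simp only [ρ, ← Complex.exp_nat_mul, mul_div_cancel₀ _ hdC]
    exact hle _ (hPQ hz)
  have hρc : ContinuousOn ρ P := by
    have : ContinuousOn (fun z => l (f z)) P := hl.comp (hf.mono hPC) hPQ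
    exact (this.div_const _).cexp
  intro x hx y hy hxy
  have h1 : ψ x / ρ x = ψ y / ρ y := by
    refine hP.eq_of_pow_eq_one (R := fun z => ψ z / ρ z)
      ((hψc.mono hPC).div hρc fun z _ => Complex.exp_ne_zero _) hd0 (fun z hz => ?_) hx hy
    rw [div_pow, hψd z (hPC hz), hρd z hz]
    exact div_self (sub_ne_zero.2 fun h => hv (h ▸ hPQ hz))
  have h2 : ρ x = ρ y := by simp only [ρ, hxy]
  rw [h2, div_left_inj' (Complex.exp_ne_zero _)] at h1
  exact hψ (hPC hx) (hPC hy) h1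

namespace PlaneMap

/-! ### Pullbacks of the range: the puzzle pieces -/

variable {g : PlaneMap} {V : Set ℂ}

theorem mem_iterDom_zero (g : PlaneMap) (z : ℂ) : z ∈ g.iterDom 0 := by simp [iterDom]

theorem mem_iterDom_succ {k : ℕ} {z : ℂ} :
    z ∈ g.iterDom (k + 1) ↔ z ∈ g.dom ∧ g.toFun z ∈ g.iterDom k := by
  simp only [iterDom, mem_ofPred_eq]
  constructor
  · intro h
    exact ⟨h 0 (by omega), fun j hj => by simpa using h (j + 1) (by omega)⟩
  · rintro ⟨h0, h1⟩ j hj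
    rcases j with _ | j
    · exact h0
    · simpa using h1 j (by omega)

theorem mem_iterDom_add {s t : ℕ} {z : ℂ} :
    z ∈ g.iterDom (s + t) ↔ z ∈ g.iterDom s ∧ g.toFun^[s] z ∈ g.iterDom t := by
  induction s generalizing z with
  | zero => simp [mem_iterDom_zero]
  | succ s ih =>
    rw [show s + 1 + t = (s + t) + 1 by ring, mem_iterDom_succ, mem_iterDom_succ, ih]
    simp [and_assoc]

theorem mem_preimage_zero {B : Set ℂ} {z : ℂ} : z ∈ g.preimage 0 B ↔ z ∈ B := by
  simp [preimage, mem_iterDom_zero]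

theorem mem_preimage_add {s t : ℕ} {B : Set ℂ} {z : ℂ} :
    z ∈ g.preimage (s + t) B ↔ z ∈ g.iterDom s ∧ g.toFun^[s] z ∈ g.preimage t B := by
  have h : g.toFun^[s + t] z = g.toFun^[t] (g.toFun^[s] z) := by
    rw [add_comm, Function.iterate_add_apply]
  simp only [preimage, mem_ofPred_eq, mem_iterDom_add, and_assoc, h]

theorem mem_preimage_succ {k : ℕ} {B : Set ℂ} {z : ℂ} :
    z ∈ g.preimage (k + 1) B ↔ z ∈ g.dom ∧ g.toFun z ∈ g.preimage k B := by
  rw [add_comm, mem_preimage_add]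
  simp [mem_iterDom_succ, mem_iterDom_zero]

theorem iterDom_anti {s t : ℕ} (h : s ≤ t) : g.iterDom t ⊆ g.iterDom s :=
  fun _ hz j hj => hz j (hj.trans_le h)

theorem pullback_subset (g : PlaneMap) (t : ℕ) (B : Set ℂ) (z : ℂ) :
    g.pullback t B z ⊆ g.preimage t B := connectedComponentIn_subset _ _

theorem mem_pullback_self {t : ℕ} {B : Set ℂ} {z : ℂ} (h : z ∈ g.preimage t B) :
    z ∈ g.pullback t B z := mem_connectedComponentIn h

theorem mem_preimage_of_mem_pullback {t : ℕ} {B : Set ℂ} {z w : ℂ} (h : w ∈ g.pullback t B z) :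
    z ∈ g.preimage t B := by
  by_contra hz
  simp [pullback, connectedComponentIn_eq_empty hz] at h

theorem pullback_eq_of_mem {t : ℕ} {B : Set ℂ} {z w : ℂ} (h : w ∈ g.pullback t B z) :
    g.pullback t B w = g.pullback t B z := (connectedComponentIn_eq h).symm

theorem mem_pullback_comm {t : ℕ} {B : Set ℂ} {z w : ℂ} (h : w ∈ g.pullback t B z) :
    z ∈ g.pullback t B w := by
  rw [pullback_eq_of_mem h]
  exact mem_pullback_self (mem_preimage_of_mem_pullback h)

theorem isPreconnected_pullback (g : PlaneMap) (t : ℕ) (B : Set ℂ) (z : ℂ) :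
    IsPreconnected (g.pullback t B z) := isPreconnected_connectedComponentIn

theorem isConnected_pullback {t : ℕ} {B : Set ℂ} {z : ℂ} (h : z ∈ g.preimage t B) :
    IsConnected (g.pullback t B z) := isConnected_connectedComponentIn_iff.2 h

theorem IsGPL.dom_subset (hg : g.IsGPL V) : g.dom ⊆ V := fun z hz =>
  (hg.compactly_contained _ ⟨z, hz, rfl⟩).2 (subset_closure (mem_connectedComponentIn hz))

theorem IsGPL.isOpen_piece (hg : g.IsGPL V) (z : ℂ) : IsOpen (g.piece z) :=
  hg.isOpen_dom.connectedComponentIn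

theorem IsGPL.isProperOn_piece (hg : g.IsGPL V) {z : ℂ} (hz : z ∈ g.dom) :
    IsProperOn g.toFun (g.piece z) V :=
  isProperOn_of_isProperMap (hg.branched _ ⟨z, hz, rfl⟩).proper

theorem IsGPL.differentiableAt (hg : g.IsGPL V) {z : ℂ} (hz : z ∈ g.dom) :
    DifferentiableAt ℂ g.toFun z :=
  (hg.branched _ ⟨z, hz, rfl⟩).holomorphic.differentiableAt
    ((hg.isOpen_piece z).mem_nhds (mem_connectedComponentIn hz))

theorem IsGPL.mapsTo (hg : g.IsGPL V) {z : ℂ} (hz : z ∈ g.dom) : g.toFun z ∈ V :=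
  (hg.isProperOn_piece hz).mapsTo (mem_connectedComponentIn hz)

theorem IsGPL.isConnected_range (hg : g.IsGPL V) : IsConnected V :=
  hg.disk_range.isSimplyConnected.isPathConnected.isConnected

theorem IsGPL.isOpen_preimage (hg : g.IsGPL V) {B : Set ℂ} (hB : IsOpen B) (k : ℕ) :
    IsOpen (g.preimage k B) := by
  induction k with
  | zero =>
    convert hB using 1
    ext z; exact mem_preimage_zero
  | succ k ih =>
    have : g.preimage (k + 1) B = g.dom ∩ g.toFun ⁻¹' (g.preimage k B) := by
      ext z; exact mem_preimage_succ
    rw [this]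
    refine ContinuousOn.isOpen_inter_preimage (fun z hz => ?_) hg.isOpen_dom ih
    exact (hg.differentiableAt hz).continuousAt.continuousWithinAt

theorem IsGPL.preimage_subset_range (hg : g.IsGPL V) (t : ℕ) : g.preimage t V ⊆ V := by
  intro z hz
  rcases t with _ | t
  · exact mem_preimage_zero.1 hz
  · exact hg.dom_subset (mem_preimage_succ.1 hz).1

theorem IsGPL.preimage_anti (hg : g.IsGPL V) {s t : ℕ} (h : s ≤ t) :
    g.preimage t V ⊆ g.preimage s V := by
  obtain ⟨r, rfl⟩ := Nat.exists_eq_add_of_le h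
  intro z hz
  rw [mem_preimage_add] at hz
  exact ⟨hz.1, hg.preimage_subset_range r hz.2⟩

theorem IsGPL.isOpen_pullback (hg : g.IsGPL V) (t : ℕ) (z : ℂ) : IsOpen (g.pullback t V z) :=
  (hg.isOpen_preimage hg.disk_range.1 t).connectedComponentIn

theorem IsGPL.pullback_anti (hg : g.IsGPL V) {s t : ℕ} (h : s ≤ t) (z : ℂ) :
    g.pullback t V z ⊆ g.pullback s V z :=
  connectedComponentIn_mono z (hg.preimage_anti h)

theorem IsGPL.pullback_zero (hg : g.IsGPL V) {z : ℂ} (hz : z ∈ V) : g.pullback 0 V z = V := by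
  have : g.preimage 0 V = V := by ext z; exact mem_preimage_zero
  rw [pullback, this]
  exact (connectedComponentIn_subset V z).antisymm
    (hg.isConnected_range.isPreconnected.subset_connectedComponentIn hz Subset.rfl)

theorem IsGPL.preimage_one (hg : g.IsGPL V) : g.preimage 1 V = g.dom := by
  ext z
  rw [show 1 = 0 + 1 from rfl, mem_preimage_succ, mem_preimage_zero]
  exact ⟨fun h => h.1, fun h => ⟨h, hg.mapsTo h⟩⟩

theorem IsGPL.pullback_one (hg : g.IsGPL V) (z : ℂ) : g.pullback 1 V z = g.piece z := by
  rw [pullback, hg.preimage_one, piece]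

theorem IsGPL.continuousOn_iterate (hg : g.IsGPL V) (s : ℕ) :
    ContinuousOn g.toFun^[s] (g.iterDom s) := by
  induction s with
  | zero => exact continuousOn_id
  | succ s ih =>
    rw [Function.iterate_succ]
    refine ih.comp (fun z hz => ?_) (fun z hz => (mem_iterDom_succ.1 hz).2)
    exact (hg.differentiableAt (mem_iterDom_succ.1 hz).1).continuousAt.continuousWithinAt

/-- The iterates map puzzle pieces into puzzle pieces. -/
theorem IsGPL.iterate_mem_pullback (hg : g.IsGPL V) {s t : ℕ} {z w : ℂ}
    (hw : w ∈ g.pullback (s + t) V z) : g.toFun^[s] w ∈ g.pullback t V (g.toFun^[s] z) := by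
  have hz := mem_preimage_of_mem_pullback hw
  have hsub : g.pullback (s + t) V z ⊆ g.iterDom s := fun x hx =>
    (mem_preimage_add.1 (pullback_subset _ _ _ _ hx)).1
  have hpre := (isPreconnected_pullback g (s + t) V z).image _
    ((hg.continuousOn_iterate s).mono hsub)
  refine hpre.subset_connectedComponentIn ⟨z, mem_pullback_self hz, rfl⟩ ?_ ⟨w, hw, rfl⟩
  rintro _ ⟨x, hx, rfl⟩
  exact (mem_preimage_add.1 (pullback_subset _ _ _ _ hx)).2

theorem IsGPL.pullback_succ_eq (hg : g.IsGPL V) {t : ℕ} {z : ℂ} (hz : z ∈ g.preimage (t + 1) V) :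
    g.pullback (t + 1) V z =
      connectedComponentIn (g.piece z ∩ g.toFun ⁻¹' (g.pullback t V (g.toFun z))) z := by
  have hz' := mem_preimage_succ.1 hz
  apply Subset.antisymm
  · refine (isPreconnected_pullback g _ V z).subset_connectedComponentIn (mem_pullback_self hz)
      fun w hw => ⟨?_, ?_⟩
    · rw [← hg.pullback_one]
      exact hg.pullback_anti (by omega) z hw
    · rw [add_comm] at hw
      exact hg.iterate_mem_pullback (s := 1) hw
  · refine isPreconnected_connectedComponentIn.subset_connectedComponentIn
      (mem_connectedComponentIn ⟨mem_connectedComponentIn hz'.1, mem_pullback_self hz'.2⟩)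
      fun w hw => ?_
    have := connectedComponentIn_subset _ _ hw
    exact mem_preimage_succ.2
      ⟨connectedComponentIn_subset _ _ this.1, pullback_subset _ _ _ _ this.2⟩

theorem IsGPL.isProperOn_step (hg : g.IsGPL V) {t : ℕ} {z : ℂ} (hz : z ∈ g.preimage (t + 1) V) :
    IsProperOn g.toFun (g.pullback (t + 1) V z) (g.pullback t V (g.toFun z)) := by
  rw [hg.pullback_succ_eq hz]
  exact (hg.isProperOn_piece (mem_preimage_succ.1 hz).1).restrict_component
    ((pullback_subset _ _ _ _).trans (hg.preimage_subset_range t)) z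

theorem IsGPL.isProperOn_iterate (hg : g.IsGPL V) {s t : ℕ} {z : ℂ}
    (hz : z ∈ g.preimage (s + t) V) :
    IsProperOn g.toFun^[s] (g.pullback (s + t) V z) (g.pullback t V (g.toFun^[s] z)) := by
  induction s generalizing z with
  | zero =>
    rw [zero_add]
    exact ⟨continuousOn_id, mapsTo_id _, fun K hK hKc => by
      rw [Function.iterate_zero, preimage_id, inter_eq_self_of_subset_right (by exact hK)]
      exact hKc⟩
  | succ s ih =>
    rw [show s + 1 + t = (s + t) + 1 by ring] at hz ⊢
    rw [Function.iterate_succ]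
    exact (ih (mem_preimage_succ.1 hz).2).comp (hg.isProperOn_step hz)

theorem IsGPL.differentiableOn_iterate (hg : g.IsGPL V) (s : ℕ) :
    DifferentiableOn ℂ g.toFun^[s] (g.iterDom s) := by
  induction s with
  | zero => exact differentiableOn_id
  | succ s ih =>
    rw [Function.iterate_succ]
    refine ih.comp (fun z hz => ?_) (fun z hz => (mem_iterDom_succ.1 hz).2)
    exact (hg.differentiableAt (mem_iterDom_succ.1 hz).1).differentiableWithinAt

theorem IsGPL.image_iterate (hg : g.IsGPL V) {s t : ℕ} {z : ℂ} (hz : z ∈ g.preimage (s + t) V) :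
    g.toFun^[s] '' g.pullback (s + t) V z = g.pullback t V (g.toFun^[s] z) := by
  have hz' := mem_preimage_add.1 hz
  have H := hg.isProperOn_iterate hz
  refine H.image_eq (hg.isOpen_pullback _ _) (isPreconnected_pullback _ _ _ _)
    ⟨z, mem_pullback_self hz⟩ (H.isOpen_image (hg.isOpen_pullback _ _)
      (isPreconnected_pullback _ _ _ _) ((hg.differentiableOn_iterate s).mono ?_) Subset.rfl
      (hg.isOpen_pullback _ _))
  exact fun x hx => (mem_preimage_add.1 (pullback_subset _ _ _ _ hx)).1

/-- The iterates restricted to puzzle pieces are branched coverings. -/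
theorem IsGPL.isBranchedCovering_iterate (hg : g.IsGPL V) {s t : ℕ} {z : ℂ}
    (hz : z ∈ g.preimage (s + t) V) :
    IsBranchedCovering g.toFun^[s] (g.pullback (s + t) V z) (g.pullback t V (g.toFun^[s] z)) where
  isOpen_source := hg.isOpen_pullback _ _
  isConnected_source := isConnected_pullback hz
  isOpen_target := hg.isOpen_pullback _ _
  isConnected_target := isConnected_pullback (mem_preimage_add.1 hz).2
  holomorphic := (hg.differentiableOn_iterate s).mono fun _ hx =>
    (mem_preimage_add.1 (pullback_subset _ _ _ _ hx)).1
  proper := (hg.isProperOn_iterate hz).isProperMap (hg.isOpen_pullback _ _)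

/-- The components of the domain are compactly contained in the range, which is connected. -/
theorem IsGPL.not_range_subset_dom (hg : g.IsGPL V) : ¬ V ⊆ g.dom := by
  intro h
  obtain ⟨z, hz⟩ := hg.isConnected_range.nonempty
  have h1 : V ⊆ g.piece z := hg.isConnected_range.isPreconnected.subset_connectedComponentIn hz h
  have h2 := hg.compactly_contained _ ⟨z, h hz, rfl⟩
  have h3 : closure (g.piece z) = V := h2.2.antisymm (h1.trans subset_closure)
  exact not_isCompact_of_isOpen hg.disk_range.1 ⟨z, hz⟩ (h3 ▸ h2.1)

/-- On a puzzle piece of depth `s` not more than `s` iterates are defined. -/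
theorem IsGPL.not_pullback_subset_iterDom (hg : g.IsGPL V) {s t : ℕ} {z : ℂ}
    (hz : z ∈ g.preimage s V) (hst : s < t) : ¬ g.pullback s V z ⊆ g.iterDom t := by
  intro h
  apply hg.not_range_subset_dom
  have h1 := hg.image_iterate (s := s) (t := 0) hz
  rw [hg.pullback_zero hz.2] at h1
  intro y hy
  rw [← h1] at hy
  obtain ⟨x, hx, rfl⟩ := hy
  exact h hx s hst

theorem IsGPL.depth_le_of_pullback_subset (hg : g.IsGPL V) {s t : ℕ} {z w : ℂ}
    (hz : z ∈ g.preimage s V) (h : g.pullback s V z ⊆ g.pullback t V w) : t ≤ s := by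
  by_contra hlt
  push Not at hlt
  exact hg.not_pullback_subset_iterDom hz hlt
    (h.trans ((pullback_subset _ _ _ _).trans fun _ hx => hx.1))

/-- A puzzle piece determines its depth. -/
theorem IsGPL.depth_eq (hg : g.IsGPL V) {s t : ℕ} {z w : ℂ}
    (hz : z ∈ g.preimage s V) (h : g.pullback s V z = g.pullback t V w) : s = t := by
  have hw : w ∈ g.preimage t V := mem_preimage_of_mem_pullback (h ▸ mem_pullback_self hz)
  exact le_antisymm (hg.depth_le_of_pullback_subset hw h.ge)
    (hg.depth_le_of_pullback_subset hz h.le)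

/-- A component of `S` can be recognized from a partition of `S` into open connected sets. -/
theorem _root_.connectedComponentIn_eq_of_partition {S : Set ℂ} {O : ℂ → Set ℂ}
    (hO : ∀ z ∈ S, IsOpen (O z)) (hc : ∀ z ∈ S, IsPreconnected (O z)) (hm : ∀ z ∈ S, z ∈ O z)
    (hS : ∀ z ∈ S, O z ⊆ S) (he : ∀ z ∈ S, ∀ w ∈ O z, O w = O z) {z : ℂ} (hz : z ∈ S) :
    connectedComponentIn S z = O z := by
  apply Subset.antisymm
  · refine isPreconnected_connectedComponentIn.subset_of_closure_inter_subset (hO z hz)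
      ⟨z, mem_connectedComponentIn hz, hm z hz⟩ ?_
    rintro y ⟨hy1, hy2⟩
    have hyS := connectedComponentIn_subset _ _ hy2
    obtain ⟨w, hw1, hw2⟩ := mem_closure_iff.1 hy1 _ (hO y hyS) (hm y hyS)
    rw [← he z hz w hw2, he y hyS w hw1]
    exact hm y hyS
  · exact (hc z hz).subset_connectedComponentIn (hm z hz) (hS z hz)

end PlaneMap

namespace PlaneMap

variable {g : PlaneMap} {V : Set ℂ} {d : ℕ}

/-! ### Degrees and injectivity on puzzle pieces -/

theorem IsUnicriticalGPL.zero_mem_dom (hg : g.IsUnicriticalGPL V d) : (0 : ℂ) ∈ g.dom := by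
  have : (0 : ℂ) ∈ {z | z ∈ g.dom ∧ deriv g.toFun z = 0} := hg.critical ▸ mem_singleton 0
  exact this.1

theorem IsUnicriticalGPL.deriv_ne_zero (hg : g.IsUnicriticalGPL V d) {z : ℂ} (hz : z ∈ g.dom)
    (hz0 : z ≠ 0) : deriv g.toFun z ≠ 0 := fun h => hz0 (by
  have : z ∈ {z | z ∈ g.dom ∧ deriv g.toFun z = 0} := ⟨hz, h⟩
  rwa [hg.critical] at this)

theorem IsUnicriticalGPL.degree_ne_zero (hg : g.IsUnicriticalGPL V d) : d ≠ 0 := by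
  rintro rfl
  have h := hg.local_degree
  have ha : AnalyticAt ℂ (fun z => g.toFun z - g.toFun 0) 0 := by
    refine AnalyticAt.sub ?_ analyticAt_const
    exact DifferentiableOn.analyticAt (s := g.dom)
      (fun z hz => (hg.differentiableAt hz).differentiableWithinAt)
      (hg.isOpen_dom.mem_nhds hg.zero_mem_dom)
  rw [Nat.cast_zero, ha.analyticOrderAt_eq_zero] at h
  simp at h

theorem IsUnicriticalGPL.exists_root (hg : g.IsUnicriticalGPL V d) :
    ∃ ψ : ℂ → ℂ, ContinuousOn ψ (g.piece 0) ∧ InjOn ψ (g.piece 0) ∧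
      ∀ z ∈ g.piece 0, ψ z ^ d = g.toFun z - g.toFun 0 := by
  have h0 := hg.zero_mem_dom
  refine (hg.isProperOn_piece h0).exists_injOn_root (hg.disk_piece _ ⟨0, h0, rfl⟩) hg.disk_range
    (hg.branched _ ⟨0, h0, rfl⟩).holomorphic (mem_connectedComponentIn h0) (fun z hz h => ?_)
    hg.degree_ne_zero hg.local_degree
  by_contra hz0
  exact hg.deriv_ne_zero (connectedComponentIn_subset _ _ hz) hz0 h

theorem IsUnicriticalGPL.injOn_piece (hg : g.IsUnicriticalGPL V d) {z : ℂ} (hz : z ∈ g.dom)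
    (h0 : (0 : ℂ) ∉ g.piece z) : InjOn g.toFun (g.piece z) := by
  refine (hg.isProperOn_piece hz).injOn_of_deriv_ne_zero (hg.isOpen_piece z)
    isPreconnected_connectedComponentIn hg.disk_range.1 hg.disk_range.isSimplyConnected
    (hg.branched _ ⟨z, hz, rfl⟩).holomorphic fun w hw => ?_
  exact hg.deriv_ne_zero (connectedComponentIn_subset _ _ hw) fun h => h0 (h ▸ hw)

theorem IsGPL.hasNoHoles_pullback (hg : g.IsGPL V) {t : ℕ} {z : ℂ} (hz : z ∈ g.preimage t V) :
    HasNoHoles (g.pullback t V z) := by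
  induction t generalizing z with
  | zero =>
    rw [hg.pullback_zero (mem_preimage_zero.1 hz)]
    exact hg.disk_range.hasNoHoles
  | succ t ih =>
    have hz' := mem_preimage_succ.1 hz
    rw [hg.pullback_succ_eq hz]
    exact (hg.disk_piece _ ⟨z, hz'.1, rfl⟩).hasNoHoles.component (ih hz'.2)
      (hg.isProperOn_piece hz'.1) (hg.isOpen_piece z) isPreconnected_connectedComponentIn
      (hg.branched _ ⟨z, hz'.1, rfl⟩).holomorphic (hg.isOpen_pullback _ _) z

/-- A point of the central domain with the same image as the critical point is critical. -/
theorem IsUnicriticalGPL.eq_zero_of_eq (hg : g.IsUnicriticalGPL V d) {z : ℂ} (hz : z ∈ g.piece 0)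
    (h : g.toFun z = g.toFun 0) : z = 0 := by
  obtain ⟨ψ, -, hψ, hψd⟩ := hg.exists_root
  have h0 := mem_connectedComponentIn hg.zero_mem_dom
  have e1 := hψd z hz
  have e2 := hψd 0 h0
  rw [h, sub_self, pow_eq_zero_iff hg.degree_ne_zero] at e1
  rw [sub_self, pow_eq_zero_iff hg.degree_ne_zero] at e2
  exact hψ hz h0 (e1.trans e2.symm)

theorem IsUnicriticalGPL.exists_preimage_step (hg : g.IsUnicriticalGPL V d) {t : ℕ} {z y : ℂ}
    (hz : z ∈ g.preimage (t + 1) V) (hy : y ∈ g.pullback t V (g.toFun z)) :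
    ∃ x ∈ g.pullback (t + 1) V z, g.toFun x = y := by
  have := hg.image_iterate (s := 1) (t := t) (z := z) (by rwa [add_comm])
  rw [add_comm] at this
  simp only [Function.iterate_one] at this
  rw [← this] at hy
  exact hy

/-- The map is injective on the puzzle pieces of positive depth that do not contain the critical
point. -/
theorem IsUnicriticalGPL.injOn_step (hg : g.IsUnicriticalGPL V d) {t : ℕ} {z : ℂ}
    (hz : z ∈ g.preimage (t + 1) V) (h0 : (0 : ℂ) ∉ g.pullback (t + 1) V z) :
    InjOn g.toFun (g.pullback (t + 1) V z) := by
  have hz' := mem_preimage_succ.1 hz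
  have hsub : g.pullback (t + 1) V z ⊆ g.piece z := by
    rw [← hg.pullback_one]; exact hg.pullback_anti (by omega) z
  by_cases hc : (0 : ℂ) ∈ g.piece z
  · have hpc : g.piece z = g.piece 0 := connectedComponentIn_eq hc
    obtain ⟨ψ, hψc, hψ, hψd⟩ := hg.exists_root
    have hv : g.toFun 0 ∉ g.pullback t V (g.toFun z) := by
      intro hv
      obtain ⟨x, hx, hx0⟩ := hg.exists_preimage_step hz hv
      exact h0 (hg.eq_zero_of_eq (hpc ▸ hsub hx) hx0 ▸ hx)
    exact injOn_of_root hg.degree_ne_zero hψc hψ hψd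
      (hg.branched _ ⟨0, hg.zero_mem_dom, rfl⟩).holomorphic.continuousOn
      (hg.hasNoHoles_pullback hz'.2) (hg.isOpen_pullback _ _) (isConnected_pullback hz'.2) hv
      (isPreconnected_pullback _ _ _ _) (hpc ▸ hsub) (hg.isProperOn_step hz).mapsTo
  · exact (hg.injOn_piece hz'.1 hc).mono hsub

theorem IsUnicriticalGPL.encard_fibre_step (hg : g.IsUnicriticalGPL V d) {t : ℕ} {z : ℂ}
    (hz : z ∈ g.preimage (t + 1) V) (w : ℂ) :
    (g.pullback (t + 1) V z ∩ g.toFun ⁻¹' {w}).encard ≤ d := by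
  have hz' := mem_preimage_succ.1 hz
  have hsub : g.pullback (t + 1) V z ⊆ g.piece z := by
    rw [← hg.pullback_one]; exact hg.pullback_anti (by omega) z
  by_cases hc : (0 : ℂ) ∈ g.piece z
  · have hpc : g.piece z = g.piece 0 := connectedComponentIn_eq hc
    obtain ⟨ψ, hψc, hψ, hψd⟩ := hg.exists_root
    refine (encard_le_encard (inter_subset_inter_left _ (hpc ▸ hsub))).trans
      (encard_fibre_le_of_root hg.degree_ne_zero hψ hψd w)
  · refine (encard_le_one_iff.2 fun x y hx hy => ?_).trans
      (by exact_mod_cast Nat.one_le_iff_ne_zero.2 hg.degree_ne_zero)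
    exact hg.injOn_piece hz'.1 hc (hsub hx.1) (hsub hy.1)
      ((show g.toFun x = w from hx.2).trans (show g.toFun y = w from hy.2).symm)

theorem _root_.encard_le_mul_of_fibres {f : ℂ → ℂ} {S B : Set ℂ} (hm : MapsTo f S B)
    (hB : B.Finite) {c : ℕ} (h : ∀ y, (S ∩ f ⁻¹' {y}).encard ≤ c) : S.encard ≤ c * B.encard := by
  classical
  have hfin : S.Finite := by
    have : S ⊆ ⋃ y ∈ B, S ∩ f ⁻¹' {y} := fun x hx =>
      mem_biUnion (hm hx) ⟨hx, rfl⟩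
    refine (hB.biUnion fun y _ => ?_).subset this
    exact finite_of_encard_le_coe (h y)
  rw [hfin.encard_eq_coe_toFinset_card, hB.encard_eq_coe_toFinset_card]
  have := Finset.card_le_mul_card_image_of_maps_to (s := hfin.toFinset) (t := hB.toFinset) (f := f)
    (fun a ha => by simpa using hm (by simpa using ha)) c (fun b _ => by
      have hb := h b
      have e : (S ∩ f ⁻¹' {b}) = ((hfin.toFinset.filter fun a => f a = b : Finset ℂ) : Set ℂ) := by
        ext x; simp
      rw [e, encard_coe_eq_coe_finsetCard] at hb
      exact_mod_cast hb)
  exact_mod_cast this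

/-- The puzzle piece of depth `a` around `z` covers the critical point at the moment `l`. -/
def Hits (g : PlaneMap) (V : Set ℂ) (a : ℕ) (z : ℂ) (l : ℕ) : Prop :=
  (0 : ℂ) ∈ g.pullback (a - l) V (g.toFun^[l] z)

theorem hits_succ {a l : ℕ} {z : ℂ} :
    g.Hits V (a + 1) z (l + 1) ↔ g.Hits V a (g.toFun z) l := by
  simp [Hits]

theorem IsGPL.hits_anti (hg : g.IsGPL V) {a b l : ℕ} {z : ℂ} (hab : a ≤ b) (h : g.Hits V b z l) :
    g.Hits V a z l := hg.pullback_anti (by omega) _ h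

theorem hits_add {a s l : ℕ} {z : ℂ} :
    g.Hits V a (g.toFun^[s] z) l ↔ g.Hits V (a + s) z (s + l) := by
  rw [Hits, Hits, show a + s - (s + l) = a - l by omega, add_comm s l, Function.iterate_add_apply]

/-- Hits only depend on the puzzle piece of the starting point. -/
theorem IsGPL.hits_congr (hg : g.IsGPL V) {a b l : ℕ} {z w : ℂ} (hw : w ∈ g.pullback b V z)
    (hab : a ≤ b) (hl : l ≤ a) : g.Hits V a w l ↔ g.Hits V a z l := by
  have h1 : w ∈ g.pullback (l + (a - l)) V z := hg.pullback_anti (by omega) z hw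
  rw [Hits, Hits, pullback_eq_of_mem (hg.iterate_mem_pullback h1)]

open Classical in
/-- The degree of an iterate on a puzzle piece is bounded in terms of the number of critical puzzle
pieces in its orbit. -/
theorem IsUnicriticalGPL.encard_fibre_iterate (hg : g.IsUnicriticalGPL V d) {s t : ℕ} {z : ℂ}
    (hz : z ∈ g.preimage (s + t) V) (w : ℂ) :
    (g.pullback (s + t) V z ∩ g.toFun^[s] ⁻¹' {w}).encard ≤
      (d ^ ((Finset.range s).filter fun l => g.Hits V (s + t) z l).card : ℕ) := by
  induction s generalizing z with
  | zero =>
    simp only [Function.iterate_zero, preimage_id, Finset.range_zero, Finset.filter_empty,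
      Finset.card_empty, pow_zero, Nat.cast_one]
    exact (encard_le_encard inter_subset_right).trans (encard_singleton w).le
  | succ s ih =>
    have e : s + 1 + t = (s + t) + 1 := by ring
    rw [e] at hz ⊢
    have hz' := mem_preimage_succ.1 hz
    have ih' := ih hz'.2
    have hm : MapsTo g.toFun (g.pullback (s + t + 1) V z ∩ g.toFun^[s + 1] ⁻¹' {w})
        (g.pullback (s + t) V (g.toFun z) ∩ g.toFun^[s] ⁻¹' {w}) := fun x hx =>
      ⟨(hg.isProperOn_step hz).mapsTo hx.1, hx.2⟩
    have hfin := finite_of_encard_le_coe ih'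
    have hcard : ((Finset.range (s + 1)).filter fun l => g.Hits V (s + t + 1) z l).card =
        ((Finset.range s).filter fun l => g.Hits V (s + t) (g.toFun z) l).card +
          if (0 : ℂ) ∈ g.pullback (s + t + 1) V z then 1 else 0 := by
      simp only [Finset.card_filter, Finset.sum_range_succ', hits_succ]
      simp [Hits]
    rw [hcard]
    by_cases h0 : (0 : ℂ) ∈ g.pullback (s + t + 1) V z
    · have := encard_le_mul_of_fibres hm hfin (c := d) fun y =>
        (encard_le_encard (inter_subset_inter_left _ inter_subset_left)).trans
          (hg.encard_fibre_step hz y)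
      refine this.trans ?_
      rw [if_pos h0, pow_succ, Nat.cast_mul, mul_comm]
      gcongr
    · have := encard_le_mul_of_fibres hm hfin (c := 1) fun y => by
        refine encard_le_one_iff.2 fun x x' hx hx' => ?_
        exact hg.injOn_step hz h0 hx.1.1 hx'.1.1
          ((show g.toFun x = y from hx.2).trans (show g.toFun x' = y from hx'.2).symm)
      refine this.trans ?_
      rw [if_neg h0, Nat.cast_one, one_mul, add_zero]
      exact ih'

theorem IsUnicriticalGPL.injOn_iterate (hg : g.IsUnicriticalGPL V d) {s t : ℕ} {z : ℂ}
    (hz : z ∈ g.preimage (s + t) V) (h : ∀ l < s, ¬ g.Hits V (s + t) z l) :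
    InjOn g.toFun^[s] (g.pullback (s + t) V z) := by
  induction s generalizing z with
  | zero => simp [injOn_id]
  | succ s ih =>
    have e : s + 1 + t = (s + t) + 1 := by ring
    rw [e] at hz h ⊢
    rw [Function.iterate_succ]
    refine (ih (mem_preimage_succ.1 hz).2 fun l hl => ?_).comp (hg.injOn_step hz ?_)
      (hg.isProperOn_step hz).mapsTo
    · rw [← hits_succ]; exact h (l + 1) (by omega)
    · have := h 0 (by omega)
      simpa [Hits] using this

theorem IsUnicriticalGPL.deriv_iterate_ne_zero (hg : g.IsUnicriticalGPL V d) {s t : ℕ} {z : ℂ}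
    (h : ∀ l < s, ¬ g.Hits V (s + t) z l) {w : ℂ} (hw : w ∈ g.pullback (s + t) V z) :
    deriv g.toFun^[s] w ≠ 0 := by
  induction s generalizing z w with
  | zero => simp [Function.iterate_zero]
  | succ s ih =>
    have e : s + 1 + t = (s + t) + 1 := by ring
    rw [e] at h hw
    have hz := mem_preimage_of_mem_pullback hw
    have hw' := mem_preimage_succ.1 (pullback_subset _ _ _ _ hw)
    have hopen : IsOpen (g.iterDom s ∩ g.pullback (s + t) V (g.toFun z)) := by
      rw [inter_eq_self_of_subset_right fun x hx =>
        (mem_preimage_add.1 (pullback_subset _ _ _ _ hx)).1]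
      exact hg.isOpen_pullback _ _
    have hgw : g.toFun w ∈ g.pullback (s + t) V (g.toFun z) := (hg.isProperOn_step hz).mapsTo hw
    have hd2 : DifferentiableAt ℂ g.toFun^[s] (g.toFun w) :=
      ((hg.differentiableOn_iterate s).mono inter_subset_left).differentiableAt
        (hopen.mem_nhds ⟨(mem_preimage_add.1 hw'.2).1, hgw⟩)
    rw [Function.iterate_succ, deriv_comp _ hd2 (hg.differentiableAt hw'.1)]
    refine mul_ne_zero (ih (fun l hl => ?_) hgw) (hg.deriv_ne_zero hw'.1 ?_)
    · rw [← hits_succ]; exact h (l + 1) (by omega)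
    · rintro rfl
      have := h 0 (by omega)
      exact this (by simpa [Hits] using hw)

/-- Along a non-critical orbit, points of a puzzle piece that meet again stay in a common puzzle
piece. -/
theorem IsUnicriticalGPL.mem_pullback_of_iterate_mem (hg : g.IsUnicriticalGPL V d) {s t e : ℕ}
    {z w : ℂ} (hte : t ≤ e) (hw : w ∈ g.pullback (s + t) V z)
    (h : ∀ l < s, ¬ g.Hits V (s + t) z l)
    (hws : g.toFun^[s] w ∈ g.pullback e V (g.toFun^[s] z)) : w ∈ g.pullback (s + e) V z := by
  have hz := mem_preimage_of_mem_pullback hw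
  have hze : z ∈ g.preimage (s + e) V :=
    mem_preimage_add.2 ⟨(mem_preimage_add.1 hz).1, mem_preimage_of_mem_pullback hws⟩
  rw [← hg.image_iterate hze] at hws
  obtain ⟨x, hx, hxw⟩ := hws
  rwa [← hg.injOn_iterate hz h (hg.pullback_anti (by omega) z hx) hw hxw]

/-- A point of a puzzle piece around `0` that joins the critical orbit lies in a deeper puzzle piece
around `0`, provided that the piece hits the critical point only at the moment `0`. -/
theorem IsUnicriticalGPL.mem_pullback_zero_of_iterate_mem (hg : g.IsUnicriticalGPL V d)
    {p t e : ℕ} {z : ℂ} (hp : 1 ≤ p) (hte : t ≤ e) (hz : z ∈ g.pullback (p + t) V 0)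
    (h : ∀ l, 0 < l → l < p → ¬ g.Hits V (p + t) 0 l)
    (hzp : g.toFun^[p] z ∈ g.pullback e V (g.toFun^[p] 0)) : z ∈ g.pullback (p + e) V 0 := by
  obtain ⟨s, rfl⟩ : ∃ s, p = s + 1 := ⟨p - 1, by omega⟩
  have e1 : ∀ x, s + 1 + x = (s + x) + 1 := fun x => by ring
  rw [e1] at hz ⊢
  have h0 := mem_preimage_of_mem_pullback hz
  have h1 : g.toFun z ∈ g.pullback (s + e) V (g.toFun 0) := by
    refine hg.mem_pullback_of_iterate_mem hte ((hg.isProperOn_step h0).mapsTo hz)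
      (fun l hl => ?_) hzp
    rw [← hits_succ, ← e1]
    exact h (l + 1) (by omega) (by omega)
  have hzd : z ∈ g.preimage (s + e + 1) V := mem_preimage_succ.2
    ⟨(mem_preimage_succ.1 (pullback_subset _ _ _ _ hz)).1, pullback_subset _ _ _ _ h1⟩
  obtain ⟨x, hx, hx0⟩ := hg.exists_preimage_step hzd (mem_pullback_comm h1)
  have hxW : x ∈ g.piece 0 := by
    rw [← hg.pullback_one, ← pullback_eq_of_mem (hg.pullback_anti (by omega) 0 hz)]
    exact hg.pullback_anti (by omega) z hx
  rw [hg.eq_zero_of_eq hxW hx0] at hx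
  exact mem_pullback_comm hx

end PlaneMap

namespace PlaneMap

variable {g H : PlaneMap} {V : Set ℂ} {d : ℕ} {τ b : ℂ → ℕ}

/-! ### Maps that are piecewise iterates of `g` -/

/-- `H` is piecewise an iterate of `g`: on the component of its domain that contains `z` it is
`g^{τ z}`, this component is the puzzle piece of depth `τ z + b z` around `z` (so that its image is
a puzzle piece of depth `b z`), and the image of a component contains each component that it meets. -/
structure Pieced (g : PlaneMap) (V : Set ℂ) (H : PlaneMap) (τ b : ℂ → ℕ) : Prop where
  pos : ∀ z ∈ H.dom, 1 ≤ τ z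
  mem : ∀ z ∈ H.dom, z ∈ g.preimage (τ z + b z) V
  sub : ∀ z ∈ H.dom, g.pullback (τ z + b z) V z ⊆ H.dom
  time_const : ∀ z ∈ H.dom, ∀ w ∈ g.pullback (τ z + b z) V z, τ w = τ z
  depth_const : ∀ z ∈ H.dom, ∀ w ∈ g.pullback (τ z + b z) V z, b w = b z
  eq : ∀ z ∈ H.dom, H.toFun z = g.toFun^[τ z] z
  markov : ∀ z ∈ H.dom, H.toFun z ∈ H.dom → b z ≤ τ (H.toFun z) + b (H.toFun z)

/-- The critical point is not visited strictly between two consecutive moments of `H`. -/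
def NoHits (g : PlaneMap) (V : Set ℂ) (H : PlaneMap) (τ b : ℂ → ℕ) : Prop :=
  ∀ z ∈ H.dom, ∀ l, 0 < l → l < τ z → ¬ g.Hits V (τ z + b z) z l

/-- The number of iterates of `g` that make up `k` iterates of `H`. -/
def orbitTime (H : PlaneMap) (τ : ℂ → ℕ) (k : ℕ) (z : ℂ) : ℕ :=
  ∑ j ∈ Finset.range k, τ (H.toFun^[j] z)

theorem orbitTime_zero (H : PlaneMap) (τ : ℂ → ℕ) (z : ℂ) : H.orbitTime τ 0 z = 0 := by
  simp [orbitTime]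

theorem orbitTime_one (H : PlaneMap) (τ : ℂ → ℕ) (z : ℂ) : H.orbitTime τ 1 z = τ z := by
  simp [orbitTime]

theorem orbitTime_add (j k : ℕ) (z : ℂ) :
    H.orbitTime τ (j + k) z = H.orbitTime τ j z + H.orbitTime τ k (H.toFun^[j] z) := by
  simp only [orbitTime, Finset.sum_range_add, ← Function.iterate_add_apply, add_comm]

theorem orbitTime_succ (k : ℕ) (z : ℂ) :
    H.orbitTime τ (k + 1) z = τ z + H.orbitTime τ k (H.toFun z) := by
  rw [add_comm k 1, orbitTime_add, orbitTime_one, Function.iterate_one]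

theorem orbitTime_mono {j k : ℕ} (h : j ≤ k) (z : ℂ) : H.orbitTime τ j z ≤ H.orbitTime τ k z := by
  obtain ⟨r, rfl⟩ := Nat.exists_eq_add_of_le h
  rw [orbitTime_add]; omega

theorem exists_orbitTime_decomp {k l : ℕ} {z : ℂ} (h : l < H.orbitTime τ k z) :
    ∃ j < k, ∃ r < τ (H.toFun^[j] z), l = H.orbitTime τ j z + r := by
  induction k with
  | zero => simp [orbitTime_zero] at h
  | succ k ih =>
    by_cases hl : l < H.orbitTime τ k z
    · obtain ⟨j, hj, r, hr, e⟩ := ih hl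
      exact ⟨j, by omega, r, hr, e⟩
    · rw [orbitTime_add, orbitTime_one] at h
      exact ⟨k, by omega, l - H.orbitTime τ k z, by omega, by omega⟩

theorem iterDom_iterate {j k : ℕ} (hjk : j ≤ k) {z : ℂ} (hz : z ∈ H.iterDom k) :
    H.toFun^[j] z ∈ H.iterDom (k - j) := by
  obtain ⟨r, rfl⟩ := Nat.exists_eq_add_of_le hjk
  rw [add_tsub_cancel_left]
  exact (mem_iterDom_add.1 hz).2

theorem Pieced.orbitTime_pos (hH : Pieced g V H τ b) {k : ℕ} (hk : 1 ≤ k) {z : ℂ}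
    (hz : z ∈ H.iterDom k) : 1 ≤ H.orbitTime τ k z := by
  obtain ⟨k, rfl⟩ : ∃ j, k = j + 1 := ⟨k - 1, by omega⟩
  rw [orbitTime_succ]
  have := hH.pos z (mem_iterDom_succ.1 hz).1
  omega

theorem Pieced.iterate_eq (hH : Pieced g V H τ b) {k : ℕ} {z : ℂ} (hz : z ∈ H.iterDom k) :
    H.toFun^[k] z = g.toFun^[H.orbitTime τ k z] z := by
  induction k generalizing z with
  | zero => simp [orbitTime_zero]
  | succ k ih =>
    have hz' := mem_iterDom_succ.1 hz
    rw [Function.iterate_succ_apply, ih hz'.2, orbitTime_succ, add_comm,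
      Function.iterate_add_apply, hH.eq z hz'.1]

theorem Pieced.depth_le (hH : Pieced g V H τ b) {k e : ℕ} (hk : 1 ≤ k) {z : ℂ}
    (hb : ∀ x ∈ H.dom, b x ≤ e) (hz : z ∈ H.iterDom k) :
    τ z + b z ≤ H.orbitTime τ k z + e := by
  induction k generalizing z with
  | zero => omega
  | succ k ih =>
    have hz' := mem_iterDom_succ.1 hz
    rw [orbitTime_succ]
    rcases Nat.eq_zero_or_pos k with rfl | hk0
    · have := hb z hz'.1
      omega
    · obtain ⟨k, rfl⟩ : ∃ j, k = j + 1 := ⟨k - 1, by omega⟩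
      have h1 := ih (by omega) hz'.2
      have h2 := hH.markov z hz'.1 (mem_iterDom_succ.1 hz'.2).1
      omega

theorem Pieced.mem_preimage (hH : Pieced g V H τ b) {k e : ℕ} {z : ℂ} (hz : z ∈ H.iterDom k)
    (he : H.toFun^[k] z ∈ g.preimage e V) : z ∈ g.preimage (H.orbitTime τ k z + e) V := by
  induction k generalizing z with
  | zero => simpa [orbitTime_zero] using he
  | succ k ih =>
    have hz' := mem_iterDom_succ.1 hz
    rw [orbitTime_succ, add_assoc, mem_preimage_add]
    refine ⟨(mem_preimage_add.1 (hH.mem z hz'.1)).1, ?_⟩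
    rw [← hH.eq z hz'.1]
    exact ih hz'.2 he

/-- Points of a common deep puzzle piece have the same itinerary under `H`. -/
theorem Pieced.shadow (hH : Pieced g V H τ b) (hg : g.IsGPL V) {k e : ℕ} {z w : ℂ}
    (hb : ∀ x ∈ H.dom, b x ≤ e) (hz : z ∈ H.iterDom k)
    (hw : w ∈ g.pullback (H.orbitTime τ k z + e) V z) :
    w ∈ H.iterDom k ∧ ∀ j ≤ k, H.orbitTime τ j w = H.orbitTime τ j z := by
  induction k generalizing z w with
  | zero =>
    refine ⟨mem_iterDom_zero _ _, fun j hj => ?_⟩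
    obtain rfl : j = 0 := by omega
    simp [orbitTime_zero]
  | succ k ih =>
    have hz' := mem_iterDom_succ.1 hz
    have hwp : w ∈ g.pullback (τ z + b z) V z :=
      hg.pullback_anti (hH.depth_le (by omega) hb hz) z hw
    have hwd := hH.sub z hz'.1 hwp
    have hτ := hH.time_const z hz'.1 w hwp
    rw [orbitTime_succ, add_assoc] at hw
    have h1 := hg.iterate_mem_pullback hw
    rw [← hH.eq z hz'.1, ← hτ, ← hH.eq w hwd] at h1
    obtain ⟨h2, h3⟩ := ih hz'.2 h1
    refine ⟨mem_iterDom_succ.2 ⟨hwd, h2⟩, fun j hj => ?_⟩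
    rcases j with _ | j
    · simp [orbitTime_zero]
    · rw [orbitTime_succ, orbitTime_succ, hτ, h3 j (by omega)]

theorem Pieced.shadow_mem (hH : Pieced g V H τ b) (hg : g.IsGPL V) {k e j : ℕ} {z w : ℂ}
    (hb : ∀ x ∈ H.dom, b x ≤ e) (hz : z ∈ H.iterDom k)
    (hw : w ∈ g.pullback (H.orbitTime τ k z + e) V z) (hj : j ≤ k) :
    H.toFun^[j] w ∈
      g.pullback (H.orbitTime τ (k - j) (H.toFun^[j] z) + e) V (H.toFun^[j] z) := by
  obtain ⟨h1, h2⟩ := hH.shadow hg hb hz hw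
  obtain ⟨r, rfl⟩ := Nat.exists_eq_add_of_le hj
  rw [hH.iterate_eq (iterDom_anti hj h1), h2 j hj, add_tsub_cancel_left,
    hH.iterate_eq (iterDom_anti hj hz)]
  rw [orbitTime_add, add_assoc, hH.iterate_eq (iterDom_anti hj hz)] at hw
  exact hg.iterate_mem_pullback hw

theorem Pieced.piece_eq (hH : Pieced g V H τ b) (hg : g.IsGPL V) {z : ℂ} (hz : z ∈ H.dom) :
    H.piece z = g.pullback (τ z + b z) V z := by
  refine connectedComponentIn_eq_of_partition (S := H.dom)
    (O := fun z => g.pullback (τ z + b z) V z) (fun z _ => hg.isOpen_pullback _ _)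
    (fun z _ => isPreconnected_pullback _ _ _ _) (fun z hz => mem_pullback_self (hH.mem z hz))
    hH.sub (fun z hz w hw => ?_) hz
  simp only [hH.time_const z hz w hw, hH.depth_const z hz w hw]
  exact pullback_eq_of_mem hw

/-- Pullbacks under `H` are puzzle pieces of `g`. -/
theorem Pieced.pullback_eq (hH : Pieced g V H τ b) (hg : g.IsGPL V) {k e : ℕ} {x z : ℂ}
    (hb : ∀ x ∈ H.dom, b x ≤ e) (hz : z ∈ H.preimage k (g.pullback e V x)) :
    H.pullback k (g.pullback e V x) z = g.pullback (H.orbitTime τ k z + e) V z := by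
  refine connectedComponentIn_eq_of_partition (S := H.preimage k (g.pullback e V x))
    (O := fun z => g.pullback (H.orbitTime τ k z + e) V z) (fun z _ => hg.isOpen_pullback _ _)
    (fun z _ => isPreconnected_pullback _ _ _ _)
    (fun z hz => mem_pullback_self (hH.mem_preimage hz.1 (pullback_subset _ _ _ _ hz.2)))
    (fun z hz w hw => ?_) (fun z hz w hw => ?_) hz
  · refine ⟨(hH.shadow hg hb hz.1 hw).1, ?_⟩
    have := hH.shadow_mem hg hb hz.1 hw le_rfl
    simp only [tsub_self, orbitTime_zero, zero_add] at this
    rwa [pullback_eq_of_mem hz.2] at this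
  · rw [(hH.shadow hg hb hz.1 hw).2 k le_rfl]
    exact pullback_eq_of_mem hw

theorem firstReturn_spec {A : Set ℂ} {z : ℂ} (hz : z ∈ (H.firstReturn A).dom) :
    1 ≤ H.returnTime A z ∧ z ∈ H.preimage (H.returnTime A z) A :=
  Nat.sInf_mem (s := {k | 1 ≤ k ∧ z ∈ H.preimage k A}) hz.2

theorem not_mem_of_lt_returnTime {A : Set ℂ} {z : ℂ} {k : ℕ} (hk : 1 ≤ k)
    (hz : z ∈ H.iterDom k) (h : k < H.returnTime A z) : H.toFun^[k] z ∉ A := fun h' =>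
  Nat.notMem_of_lt_sInf h ⟨hk, hz, h'⟩

theorem returnTime_eq {A : Set ℂ} {z : ℂ} {k : ℕ} (hk : 1 ≤ k) (hz : z ∈ H.preimage k A)
    (h : ∀ j, 1 ≤ j → j < k → H.toFun^[j] z ∉ A) : H.returnTime A z = k := by
  refine le_antisymm (Nat.sInf_le ⟨hk, hz⟩) ?_
  have hne : {k | 1 ≤ k ∧ z ∈ H.preimage k A}.Nonempty := ⟨k, hk, hz⟩
  have := Nat.sInf_mem hne
  by_contra hlt
  push Not at hlt
  exact h _ this.1 hlt this.2.2

/-- The number of iterates of `g` that make up the first return of `H` to `A`. -/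
noncomputable def retTime (H : PlaneMap) (τ : ℂ → ℕ) (A : Set ℂ) (z : ℂ) : ℕ :=
  H.orbitTime τ (H.returnTime A z) z

/-- A first return map to a puzzle piece around `0` is piecewise an iterate of `g`. -/
theorem Pieced.firstReturn (hH : Pieced g V H τ b) (hg : g.IsGPL V) {e : ℕ}
    (hb : ∀ x ∈ H.dom, b x ≤ e) :
    Pieced g V (H.firstReturn (g.pullback e V 0)) (H.retTime τ (g.pullback e V 0))
      (fun _ => e) := by
  set Q := g.pullback e V 0 with hQ
  have key : ∀ z ∈ (H.firstReturn Q).dom, ∀ w ∈ g.pullback (H.retTime τ Q z + e) V z,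
      w ∈ (H.firstReturn Q).dom ∧ H.returnTime Q w = H.returnTime Q z ∧
        H.retTime τ Q w = H.retTime τ Q z := by
    intro z hz w hw
    obtain ⟨hr, hzr⟩ := firstReturn_spec hz
    set r := H.returnTime Q z with hrdef
    obtain ⟨h1, h2⟩ := hH.shadow hg hb hzr.1 hw
    have hsh : ∀ j ≤ r, H.toFun^[j] w ∈ g.pullback e V (H.toFun^[j] z) := fun j hj =>
      hg.pullback_anti (by omega) _ (hH.shadow_mem hg hb hzr.1 hw hj)
    have hQ' : ∀ j ≤ r, H.toFun^[j] w ∈ Q → H.toFun^[j] z ∈ Q := fun j hj h => by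
      have := mem_pullback_comm (hsh j hj)
      rwa [pullback_eq_of_mem h] at this
    have hwr : w ∈ H.preimage r Q := ⟨h1, by
      have := hsh r le_rfl
      rwa [pullback_eq_of_mem hzr.2] at this⟩
    have hwQ : w ∈ Q := by
      have := hg.pullback_anti (show e ≤ H.retTime τ Q z + e by omega) z hw
      rwa [pullback_eq_of_mem hz.1] at this
    have hrt : H.returnTime Q w = r := returnTime_eq hr hwr fun j hj hjr h =>
      not_mem_of_lt_returnTime hj (iterDom_anti hjr.le hzr.1) hjr (hQ' j hjr.le h)
    refine ⟨⟨hwQ, r, hr, hwr⟩, hrt, ?_⟩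
    rw [retTime, retTime, hrt, ← hrdef, h2 r le_rfl]
  refine ⟨fun z hz => ?_, fun z hz => ?_, fun z hz w hw => (key z hz w hw).1,
    fun z hz w hw => (key z hz w hw).2.2, fun _ _ _ _ => rfl, fun z hz => ?_,
    fun z hz _ => by omega⟩
  · obtain ⟨hr, hzr⟩ := firstReturn_spec hz
    exact hH.orbitTime_pos hr hzr.1
  · obtain ⟨hr, hzr⟩ := firstReturn_spec hz
    exact hH.mem_preimage hzr.1 (pullback_subset _ _ _ _ hzr.2)
  · obtain ⟨hr, hzr⟩ := firstReturn_spec hz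
    exact hH.iterate_eq hzr.1

theorem Pieced.restrictMeeting (hH : Pieced g V H τ b) (hg : g.IsGPL V) (S : Set ℂ) :
    Pieced g V (H.restrictMeeting S) τ b where
  pos z hz := hH.pos z hz.1
  mem z hz := hH.mem z hz.1
  sub z hz w hw := by
    refine ⟨hH.sub z hz.1 hw, ?_⟩
    rw [show H.piece w = H.piece z from (connectedComponentIn_eq (by
      rw [← hH.piece_eq hg hz.1] at hw; exact hw)).symm]
    exact hz.2
  time_const z hz w hw := hH.time_const z hz.1 w hw
  depth_const z hz w hw := hH.depth_const z hz.1 w hw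
  eq z hz := hH.eq z hz.1
  markov z hz hz' := hH.markov z hz.1 hz'.1

/-- If the critical point is not visited between the moments of `H`, it can only be visited at the
moments of `H`. -/
theorem Pieced.exists_of_hits (hH : Pieced g V H τ b) (hg : g.IsGPL V) (hno : NoHits g V H τ b)
    {k e l : ℕ} {z : ℂ} (hb : ∀ x ∈ H.dom, b x ≤ e) (hz : z ∈ H.iterDom k)
    (hl : l < H.orbitTime τ k z) (hit : g.Hits V (H.orbitTime τ k z + e) z l) :
    ∃ j < k, l = H.orbitTime τ j z ∧
      (0 : ℂ) ∈ g.pullback (H.orbitTime τ (k - j) (H.toFun^[j] z) + e) V (H.toFun^[j] z) := by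
  obtain ⟨j, hj, r, hr, rfl⟩ := exists_orbitTime_decomp hl
  have hzj := iterDom_anti hj.le hz
  have h1 : H.orbitTime τ k z = H.orbitTime τ j z + H.orbitTime τ (k - j) (H.toFun^[j] z) := by
    rw [← orbitTime_add]; congr 1; omega
  have hit' : g.Hits V (H.orbitTime τ (k - j) (H.toFun^[j] z) + e) (H.toFun^[j] z) r := by
    rw [hH.iterate_eq hzj, hits_add, ← hH.iterate_eq hzj]
    convert hit using 1
    omega
  rcases Nat.eq_zero_or_pos r with rfl | hr0
  · exact ⟨j, hj, rfl, by simpa [Hits] using hit'⟩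
  · exfalso
    refine hno _ (hz j hj) r hr0 hr (hg.hits_anti ?_ hit')
    exact hH.depth_le (by omega) hb (iterDom_iterate hj.le hz)

end PlaneMap

namespace PlaneMap

variable {g h : PlaneMap} {V : Set ℂ} {d t : ℕ} {τ : ℂ → ℕ}

/-! ### The central cascade of a renormalization level -/

/-- `h` is a renormalization level of `g` with range the puzzle piece of depth `t` around `0`: each
component of its domain is mapped onto the range by an iterate `g^{τ z}`, which does not visit the
critical point at intermediate moments. -/
structure IsLevel (g : PlaneMap) (V : Set ℂ) (h : PlaneMap) (t : ℕ) (τ : ℂ → ℕ) : Prop where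
  pieced : Pieced g V h τ (fun _ => t)
  noHits : NoHits g V h τ (fun _ => t)
  subset : h.dom ⊆ g.pullback t V 0
  maps : ∀ z ∈ h.dom, h.toFun z ∈ g.pullback t V 0
  zero_mem : (0 : ℂ) ∈ h.dom

theorem IsUnicriticalGPL.isLevel_zero (hg : g.IsUnicriticalGPL V d) :
    IsLevel g V g 0 (fun _ => 1) := by
  have h0 := hg.zero_mem_dom
  have hV : g.pullback 0 V 0 = V := hg.pullback_zero (hg.dom_subset h0)
  refine ⟨⟨fun _ _ => le_rfl, fun z hz => ?_, fun z hz w hw => ?_, fun _ _ _ _ => rfl,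
    fun _ _ _ _ => rfl, fun _ _ => rfl, fun _ _ _ => by omega⟩, fun z _ l h1 h2 => by omega,
    ?_, fun z hz => ?_, h0⟩
  · rwa [add_zero, hg.preimage_one]
  · rw [add_zero, hg.pullback_one] at hw
    exact connectedComponentIn_subset _ _ hw
  · rw [hV]; exact hg.dom_subset
  · rw [hV]; exact hg.mapsTo hz

theorem IsLevel.central_eq (L : IsLevel g V h t τ) (hg : g.IsGPL V) :
    h.central = g.pullback (τ 0 + t) V 0 := L.pieced.piece_eq hg L.zero_mem

theorem IsLevel.central_subset_dom (L : IsLevel g V h t τ) (hg : g.IsGPL V) :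
    h.central ⊆ h.dom := by
  rw [L.central_eq hg]; exact L.pieced.sub 0 L.zero_mem

theorem IsLevel.zero_mem_central (L : IsLevel g V h t τ) : (0 : ℂ) ∈ h.central :=
  mem_connectedComponentIn L.zero_mem

theorem IsLevel.time_eq (L : IsLevel g V h t τ) (hg : g.IsGPL V) {z : ℂ} (hz : z ∈ h.central) :
    τ z = τ 0 := by
  rw [L.central_eq hg] at hz
  exact L.pieced.time_const 0 L.zero_mem z hz

theorem IsLevel.one_le_time_zero (L : IsLevel g V h t τ) : 1 ≤ τ 0 := L.pieced.pos 0 L.zero_mem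

theorem cascadeLength_spec (hfin : h.HasFiniteCascade) :
    h.toFun^[h.cascadeLength] 0 ∉ h.central := Nat.sInf_mem hfin

theorem iterate_mem_central {k : ℕ} (hk : k < h.cascadeLength) : h.toFun^[k] 0 ∈ h.central := by
  by_contra hn
  exact Nat.notMem_of_lt_sInf hk hn

theorem IsLevel.one_le_cascadeLength (L : IsLevel g V h t τ) (hfin : h.HasFiniteCascade) :
    1 ≤ h.cascadeLength := by
  by_contra hlt
  have h1 := cascadeLength_spec hfin
  rw [show h.cascadeLength = 0 by omega] at h1
  exact h1 L.zero_mem_central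

/-- The time of an orbit segment in the central domain. -/
theorem IsLevel.orbitTime_of_central (L : IsLevel g V h t τ) (hg : g.IsGPL V) {k : ℕ} {z : ℂ}
    (hz : ∀ i < k, h.toFun^[i] z ∈ h.central) : h.orbitTime τ k z = k * τ 0 := by
  rw [orbitTime, Finset.sum_congr rfl fun i hi => L.time_eq hg (hz i (Finset.mem_range.1 hi))]
  simp

theorem IsLevel.iterDom_of_central (L : IsLevel g V h t τ) (hg : g.IsGPL V) {k : ℕ} {z : ℂ}
    (hz : ∀ i < k, h.toFun^[i] z ∈ h.central) : z ∈ h.iterDom k := fun i hi =>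
  L.central_subset_dom hg (hz i hi)

theorem IsLevel.iterate_mem_range (L : IsLevel g V h t τ) {k : ℕ} {z : ℂ}
    (hz : z ∈ g.pullback t V 0) (hzk : z ∈ h.iterDom k) : h.toFun^[k] z ∈ g.pullback t V 0 := by
  rcases k with _ | k
  · exact hz
  · rw [Function.iterate_succ_apply']
    exact L.maps _ (hzk k (by omega))

theorem IsLevel.zero_mem_range (L : IsLevel g V h t τ) : (0 : ℂ) ∈ g.pullback t V 0 :=
  L.subset L.zero_mem

/-- The disks of the central cascade consist of the points that stay in the central domain for the
prescribed number of iterates. -/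
theorem IsLevel.mem_cascade_iff (L : IsLevel g V h t τ) (hg : g.IsUnicriticalGPL V d) {k : ℕ}
    (hk : k ≤ h.cascadeLength) {z : ℂ} :
    z ∈ g.pullback (k * τ 0 + t) V 0 ↔
      z ∈ g.pullback t V 0 ∧ ∀ i < k, h.toFun^[i] z ∈ h.central := by
  have hg' := hg.toIsGPL
  have hb : ∀ x ∈ h.dom, (fun _ : ℂ => t) x ≤ t := fun _ _ => le_rfl
  constructor
  · intro hz
    refine ⟨hg'.pullback_anti (by omega) 0 hz, fun i hi => ?_⟩
    have h0 : ∀ i < k, h.toFun^[i] 0 ∈ h.central := fun i hi => iterate_mem_central (by omega)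
    rw [← L.orbitTime_of_central hg' h0] at hz
    have h1 := L.pieced.shadow_mem hg' hb (L.iterDom_of_central hg' h0) hz hi.le
    have h2 : τ (h.toFun^[i] 0) + t ≤ h.orbitTime τ (k - i) (h.toFun^[i] 0) + t :=
      L.pieced.depth_le (by omega) hb (iterDom_iterate hi.le (L.iterDom_of_central hg' h0))
    have h3 := hg'.pullback_anti h2 _ h1
    rw [L.time_eq hg' (h0 i hi)] at h3
    have h4 := h0 i hi
    rw [L.central_eq hg'] at h4 ⊢
    rwa [pullback_eq_of_mem h4] at h3
  · rintro ⟨hz0, hz⟩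
    induction k generalizing z with
    | zero => simpa using hz0
    | succ k ih =>
      have e : (k + 1) * τ 0 + t = τ 0 + (k * τ 0 + t) := by ring
      have hzW := hz 0 (by omega)
      have hzd := L.central_subset_dom hg' hzW
      simp only [Function.iterate_zero, id] at hzW hzd
      have h1 := ih (by omega) (L.maps z hzd) fun i hi => by
        have := hz (i + 1) (by omega)
        simpa using this
      have h2 := ih (by omega) (L.maps 0 L.zero_mem) fun i hi => by
        have := iterate_mem_central (h := h) (k := i + 1) (by omega)
        simpa using this
      rw [e]
      refine hg.mem_pullback_zero_of_iterate_mem (t := t) L.one_le_time_zero (by omega) ?_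
        (fun l hl hl' => L.noHits 0 L.zero_mem l hl hl') ?_
      · rw [← L.central_eq hg']; exact hzW
      · rw [← L.pieced.eq 0 L.zero_mem]
        have h3 := L.pieced.eq z hzd
        rw [L.time_eq hg' hzW] at h3
        rw [← h3, pullback_eq_of_mem h2]
        exact h1

theorem IsLevel.cascade_eq (L : IsLevel g V h t τ) (hg : g.IsUnicriticalGPL V d) {k : ℕ}
    (hk : k ≤ h.cascadeLength) :
    h.cascade (g.pullback t V 0) k = g.pullback (k * τ 0 + t) V 0 := by
  have hg' := hg.toIsGPL
  have h0 : ∀ i < k, h.toFun^[i] 0 ∈ h.central := fun i hi => iterate_mem_central (by omega)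
  have hd := L.iterDom_of_central hg' h0
  rw [cascade, L.pieced.pullback_eq hg' (fun _ _ => le_rfl)
    ⟨hd, L.iterate_mem_range L.zero_mem_range hd⟩, L.orbitTime_of_central hg' h0]

/-- The first return map to the central domain is piecewise an iterate of `g`. -/
theorem IsLevel.pieced_return (L : IsLevel g V h t τ) (hg : g.IsGPL V) :
    Pieced g V (h.firstReturn h.central) (h.retTime τ h.central) (fun _ => τ 0 + t) := by
  rw [L.central_eq hg]
  exact L.pieced.firstReturn hg fun _ _ => by omega

/-- If the cascade has length at least `2`, then a point of the central domain that is mapped into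
the central domain lies in the central domain of the first return map. -/
theorem IsLevel.zero_mem_return_piece (L : IsLevel g V h t τ) (hg : g.IsUnicriticalGPL V d)
    (hN : 2 ≤ h.cascadeLength) {x : ℂ} (hx : x ∈ h.central) (hx1 : h.toFun x ∈ h.central) :
    (0 : ℂ) ∈ (h.firstReturn h.central).piece x := by
  have hg' := hg.toIsGPL
  have h01 : h.toFun^[1] 0 ∈ h.central := iterate_mem_central (by omega)
  have h0r : (0 : ℂ) ∈ h.preimage 1 h.central :=
    ⟨L.iterDom_of_central hg' fun i hi => iterate_mem_central (by omega), h01⟩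
  have h0 : (0 : ℂ) ∈ (h.firstReturn h.central).dom := ⟨L.zero_mem_central, 1, le_rfl, h0r⟩
  have hrt : h.returnTime h.central 0 = 1 :=
    returnTime_eq le_rfl h0r fun j hj hj' => by omega
  have hpiece := (L.pieced_return hg').piece_eq hg' h0
  rw [retTime, hrt, orbitTime_one] at hpiece
  have hx2 : x ∈ (h.firstReturn h.central).piece 0 := by
    rw [hpiece]
    have := (L.mem_cascade_iff hg (k := 2) hN (z := x)).2 ⟨L.subset (L.central_subset_dom hg' hx),
      fun i hi => by interval_cases i <;> assumption⟩
    convert this using 2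
    ring
  rw [show (h.firstReturn h.central).piece x = (h.firstReturn h.central).piece 0 from
    (connectedComponentIn_eq hx2).symm]
  exact mem_connectedComponentIn h0

/-! ### The king and the apartment -/

/-- The last point of the critical orbit in the central cascade. -/
noncomputable def exitPoint (h : PlaneMap) : ℂ := h.toFun^[h.cascadeLength - 1] 0

/-- The number of iterates of `g` that map the king onto the central domain. -/
noncomputable def kingTime (h : PlaneMap) (τ : ℂ → ℕ) : ℕ :=
  (h.cascadeLength - 1) * τ 0 + h.retTime τ h.central h.exitPoint

theorem exitPoint_mem_dom_return (hking : (0 : ℂ) ∈ h.king) :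
    h.exitPoint ∈ (h.firstReturn h.central).dom :=
  connectedComponentIn_subset _ _ (connectedComponentIn_subset _ _ hking).2

theorem IsLevel.toFun_exitPoint (L : IsLevel g V h t τ) (hfin : h.HasFiniteCascade) :
    h.toFun h.exitPoint = h.toFun^[h.cascadeLength] 0 := by
  have := L.one_le_cascadeLength hfin
  rw [exitPoint, ← Function.iterate_succ_apply' h.toFun]
  congr 2
  omega

theorem IsLevel.two_le_returnTime (L : IsLevel g V h t τ) (hfin : h.HasFiniteCascade)
    (hking : (0 : ℂ) ∈ h.king) : 2 ≤ h.returnTime h.central h.exitPoint := by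
  obtain ⟨h1, h2⟩ := firstReturn_spec (exitPoint_mem_dom_return hking)
  by_contra hlt
  have h3 : h.returnTime h.central h.exitPoint = 1 := by omega
  rw [h3] at h2
  have := h2.2
  rw [Function.iterate_one, L.toFun_exitPoint hfin] at this
  exact cascadeLength_spec hfin this

theorem IsLevel.iterDom_cascade (L : IsLevel g V h t τ) (hg : g.IsGPL V) :
    (0 : ℂ) ∈ h.iterDom h.cascadeLength :=
  L.iterDom_of_central hg fun _ hi => iterate_mem_central hi

theorem IsLevel.iterDom_king (L : IsLevel g V h t τ) (hg : g.IsGPL V)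
    (hking : (0 : ℂ) ∈ h.king) :
    (0 : ℂ) ∈ h.iterDom (h.cascadeLength - 1 + h.returnTime h.central h.exitPoint) :=
  mem_iterDom_add.2 ⟨iterDom_anti (by omega) (L.iterDom_cascade hg),
    (firstReturn_spec (exitPoint_mem_dom_return hking)).2.1⟩

theorem IsLevel.orbitTime_king (L : IsLevel g V h t τ) (hg : g.IsGPL V) :
    h.orbitTime τ (h.cascadeLength - 1 + h.returnTime h.central h.exitPoint) 0 = h.kingTime τ := by
  rw [orbitTime_add, L.orbitTime_of_central hg fun i hi => iterate_mem_central (by omega)]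
  rfl

theorem IsLevel.exit_mem_dom (L : IsLevel g V h t τ) (hfin : h.HasFiniteCascade)
    (hking : (0 : ℂ) ∈ h.king) : h.toFun^[h.cascadeLength] 0 ∈ h.dom := by
  rw [← L.toFun_exitPoint hfin]
  have := (firstReturn_spec (exitPoint_mem_dom_return hking)).2.1
  exact this 1 (L.two_le_returnTime hfin hking)

theorem IsLevel.kingTime_ge (L : IsLevel g V h t τ) (hg : g.IsGPL V) (hfin : h.HasFiniteCascade)
    (hking : (0 : ℂ) ∈ h.king) :
    h.cascadeLength * τ 0 + τ (h.toFun^[h.cascadeLength] 0) ≤ h.kingTime τ := by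
  have hN := L.one_le_cascadeLength hfin
  have h2 := L.two_le_returnTime hfin hking
  rw [← L.orbitTime_king hg]
  refine le_trans ?_ (orbitTime_mono (show h.cascadeLength + 1 ≤ _ by omega) 0)
  rw [orbitTime_add, orbitTime_one,
    L.orbitTime_of_central hg fun i hi => iterate_mem_central hi]

theorem IsLevel.king_eq (L : IsLevel g V h t τ) (hg : g.IsGPL V) (hking : (0 : ℂ) ∈ h.king) :
    h.king = g.pullback (h.kingTime τ + (τ 0 + t)) V 0 := by
  have h1 := exitPoint_mem_dom_return hking
  have h2 := (L.pieced_return hg).piece_eq hg h1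
  have h3 : (0 : ℂ) ∈ h.preimage (h.cascadeLength - 1)
      ((h.firstReturn h.central).piece h.exitPoint) :=
    ⟨iterDom_anti (by omega) (L.iterDom_cascade hg), mem_connectedComponentIn h1⟩
  rw [king, ← exitPoint]
  rw [h2] at h3 ⊢
  rw [L.pieced.pullback_eq hg (fun _ _ => by omega) h3,
    L.orbitTime_of_central hg fun i hi => iterate_mem_central (by omega), kingTime]
  congr 1
  ring

theorem IsLevel.apartment_eq (L : IsLevel g V h t τ) (hg : g.IsGPL V) (hfin : h.HasFiniteCascade)
    (hking : (0 : ℂ) ∈ h.king) :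
    h.apartment =
      g.pullback (h.cascadeLength * τ 0 + (τ (h.toFun^[h.cascadeLength] 0) + t)) V 0 := by
  have h1 := L.exit_mem_dom hfin hking
  rw [apartment]
  have h2 : (0 : ℂ) ∈ h.preimage h.cascadeLength (h.piece (h.toFun^[h.cascadeLength] 0)) :=
    ⟨L.iterDom_cascade hg, mem_connectedComponentIn h1⟩
  rw [L.pieced.piece_eq hg h1] at h2 ⊢
  rw [L.pieced.pullback_eq hg (fun _ _ => by omega) h2,
    L.orbitTime_of_central hg fun i hi => iterate_mem_central hi]

/-- The pullback of the range of a level along the orbit that maps the king onto the central domain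
covers the critical point only at the initial moment. -/
theorem IsLevel.king_noHits (L : IsLevel g V h t τ) (hg : g.IsGPL V) (hfin : h.HasFiniteCascade)
    (hking : (0 : ℂ) ∈ h.king) {l : ℕ} (hl : 0 < l) (hl' : l < h.kingTime τ) :
    ¬ g.Hits V (h.kingTime τ + t) 0 l := by
  intro hit
  have hN := L.one_le_cascadeLength hfin
  have hr := L.two_le_returnTime hfin hking
  have hd := L.iterDom_king hg hking
  rw [← L.orbitTime_king hg] at hl' hit
  set n := h.cascadeLength - 1 + h.returnTime h.central h.exitPoint with hn
  have hb : ∀ x ∈ h.dom, (fun _ : ℂ => t) x ≤ t := fun _ _ => le_rfl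
  obtain ⟨j, hj, rfl, h0⟩ := L.pieced.exists_of_hits hg L.noHits hb hd hl' hit
  have hj0 : j ≠ 0 := by rintro rfl; simp [orbitTime_zero] at hl
  -- the moment `i ≥ j` at which the orbit has to leave the central domain
  have key : ∀ i, j ≤ i → i < n → h.toFun^[i] 0 ∉ h.central →
      h.toFun^[i - j] 0 ∉ h.central := by
    intro i hji hin hi hi'
    have h1 : (0 : ℂ) ∈ h.iterDom (n - j) ∧ _ :=
      L.pieced.shadow hg hb (iterDom_iterate hj.le hd) h0
    have h2 := L.pieced.shadow_mem hg hb (iterDom_iterate hj.le hd) h0 (show i - j ≤ n - j by omega)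
    have hij : h.toFun^[i - j] (h.toFun^[j] 0) = h.toFun^[i] 0 := by
      rw [← Function.iterate_add_apply]; congr 2; omega
    rw [hij] at h2
    have hdi : h.toFun^[i] 0 ∈ h.iterDom (n - j - (i - j)) := by
      have := iterDom_iterate (show i ≤ n by omega) hd
      rwa [show n - j - (i - j) = n - i by omega]
    have h3 := hg.pullback_anti (L.pieced.depth_le (by omega) hb hdi) _ h2
    have h4 : h.toFun^[i] 0 ∈ h.dom := hd i hin
    rw [← L.pieced.piece_eq hg h4] at h3
    apply hi
    have h5 : h.piece (h.toFun^[i] 0) = h.piece (h.toFun^[i - j] 0) := connectedComponentIn_eq h3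
    have h6 : h.piece 0 = h.piece (h.toFun^[i - j] 0) := connectedComponentIn_eq hi'
    rw [central, h6, ← h5]
    exact mem_connectedComponentIn h4
  by_cases hjN : j < h.cascadeLength
  · exact key h.cascadeLength hjN.le (by omega) (cascadeLength_spec hfin)
      (iterate_mem_central (by omega))
  · refine key j le_rfl hj (fun hjc => ?_) (by simpa using L.zero_mem_central)
    have h1 := (firstReturn_spec (exitPoint_mem_dom_return hking)).2.1
    refine not_mem_of_lt_returnTime (H := h) (A := h.central) (z := h.exitPoint)
      (k := j - (h.cascadeLength - 1)) (by omega) (iterDom_anti (by omega) h1) (by omega) ?_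
    rw [exitPoint, ← Function.iterate_add_apply]
    convert hjc using 2
    omega

end PlaneMap

namespace PlaneMap

variable {g h : PlaneMap} {V : Set ℂ} {d t : ℕ} {τ : ℂ → ℕ}

/-! ### The kingdom as a piecewise iterate -/

/-- The time after which a point of a subject of level `k` is mapped into the central domain. -/
noncomputable def subjectTime (h : PlaneMap) (τ : ℂ → ℕ) (k : ℕ) (z : ℂ) : ℕ :=
  (k - 1) * τ 0 + h.retTime τ h.central (h.toFun^[k - 1] z)

theorem IsLevel.castle_eq (L : IsLevel g V h t τ) (hg : g.IsUnicriticalGPL V d) :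
    h.castle (g.pullback t V 0) = g.pullback (h.cascadeLength * τ 0 + t) V 0 :=
  L.cascade_eq hg le_rfl

/-- The subjects are puzzle pieces: the time is that of `k - 1` iterates in the central domain,
followed by the first return to it. -/
theorem IsLevel.subject_spec (L : IsLevel g V h t τ) (hg : g.IsUnicriticalGPL V d) {k : ℕ}
    {D : Set ℂ} (hD : D ∈ h.subjects (g.pullback t V 0) k) {z : ℂ} (hz : z ∈ D) :
    1 ≤ k ∧ k ≤ h.cascadeLength ∧ (∀ i < k, h.toFun^[i] z ∈ h.central) ∧
      h.toFun^[k - 1] z ∈ (h.firstReturn h.central).dom ∧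
      (0 : ℂ) ∉ (h.firstReturn h.central).piece (h.toFun^[k - 1] z) ∧
      D = g.pullback (h.subjectTime τ k z + (τ 0 + t)) V z ∧
      z ∈ g.preimage (h.subjectTime τ k z + (τ 0 + t)) V := by
  have hg' := hg.toIsGPL
  obtain ⟨hk1, hkN, ⟨X, ⟨x₀, hx₀, rfl⟩, h0X, z₀, hz₀, hDe⟩, h0D, -⟩ := hD
  have hzS := (hDe ▸ connectedComponentIn_subset _ _ :
    D ⊆ h.cascade (g.pullback t V 0) k ∩ h.preimage (k - 1) _) hz
  have hDz : D = connectedComponentIn (h.cascade (g.pullback t V 0) k ∩ h.preimage (k - 1)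
      ((h.firstReturn h.central).piece x₀)) z := by
    rw [hDe]
    refine connectedComponentIn_eq ?_
    rwa [← hDe]
  have hxX := hzS.2.2
  have hx : h.toFun^[k - 1] z ∈ (h.firstReturn h.central).dom := connectedComponentIn_subset _ _ hxX
  have hXe : (h.firstReturn h.central).piece x₀ =
      (h.firstReturn h.central).piece (h.toFun^[k - 1] z) := connectedComponentIn_eq hxX
  rw [hXe] at h0X hDz hzS
  have hU := hzS.1
  rw [L.cascade_eq hg hkN] at hU
  have hW := ((L.mem_cascade_iff hg hkN).1 hU).2
  have hXp := (L.pieced_return hg').piece_eq hg' hx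
  have hpre := hzS.2
  rw [hXp] at hpre
  have hpb := L.pieced.pullback_eq hg' (fun _ _ => by omega) hpre
  rw [L.orbitTime_of_central hg' fun i hi => hW i (by omega), ← add_assoc ((k - 1) * τ 0)] at hpb
  have hmem : z ∈ g.preimage (h.subjectTime τ k z + (τ 0 + t)) V := by
    have := mem_pullback_self hpre
    rw [hpb] at this
    exact pullback_subset _ _ _ _ this
  refine ⟨hk1, hkN, hW, hx, h0X, ?_, hmem⟩
  rw [hDz, hXp, L.cascade_eq hg hkN]
  refine Subset.antisymm ?_ ?_
  · rw [subjectTime, ← hpb]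
    exact connectedComponentIn_mono _ inter_subset_right
  · refine (isPreconnected_pullback _ _ _ _).subset_connectedComponentIn (mem_pullback_self hmem)
      (subset_inter ?_ ?_)
    · rw [← pullback_eq_of_mem hU]
      refine hg'.pullback_anti ?_ z
      rw [subjectTime]
      have : k * τ 0 = (k - 1) * τ 0 + τ 0 := by
        obtain ⟨k, rfl⟩ : ∃ j, k = j + 1 := ⟨k - 1, by omega⟩
        rw [add_tsub_cancel_right]; ring
      omega
    · rw [subjectTime, ← hpb]
      exact pullback_subset _ _ _ _

theorem IsLevel.subjectTime_const (L : IsLevel g V h t τ) (hg : g.IsUnicriticalGPL V d) {k : ℕ}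
    {D : Set ℂ} (hD : D ∈ h.subjects (g.pullback t V 0) k) {z w : ℂ} (hz : z ∈ D) (hw : w ∈ D) :
    h.subjectTime τ k w = h.subjectTime τ k z := by
  obtain ⟨hk1, hkN, hW, hx, h0X, hDe, hmem⟩ := L.subject_spec hg hD hz
  have hg' := hg.toIsGPL
  have hd := L.iterDom_of_central hg' fun i (hi : i < k - 1) => hW i (by omega)
  rw [hDe, subjectTime, add_assoc,
    ← L.orbitTime_of_central hg' fun i (hi : i < k - 1) => hW i (by omega)] at hw
  have h1 := hg'.iterate_mem_pullback hw
  rw [← L.pieced.iterate_eq hd] at h1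
  have h2 := (L.pieced.shadow hg' (e := h.retTime τ h.central (h.toFun^[k - 1] z) + (τ 0 + t))
    (fun _ _ => by omega) hd hw)
  rw [← h2.2 _ le_rfl, ← L.pieced.iterate_eq h2.1] at h1
  rw [subjectTime, subjectTime, (L.pieced_return hg').time_const _ hx _ h1]

/-- A point of a subject of level `k` leaves the central domain after exactly `k` iterates, unless
the cascade has length `1`. -/
theorem IsLevel.subject_escape (L : IsLevel g V h t τ) (hg : g.IsUnicriticalGPL V d)
    {k : ℕ} {D : Set ℂ} (hD : D ∈ h.subjects (g.pullback t V 0) k) {z : ℂ} (hz : z ∈ D)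
    (hN : 2 ≤ h.cascadeLength) : h.toFun^[k] z ∉ h.central := by
  obtain ⟨hk1, hkN, hW, hx, h0X, -⟩ := L.subject_spec hg hD hz
  intro hk
  refine h0X (L.zero_mem_return_piece hg hN (hW (k - 1) (by omega)) ?_)
  rw [← Function.iterate_succ_apply' h.toFun]
  rwa [show (k - 1).succ = k by omega]

theorem IsLevel.subject_level_unique (L : IsLevel g V h t τ) (hg : g.IsUnicriticalGPL V d)
    {k k' : ℕ} {D D' : Set ℂ} (hD : D ∈ h.subjects (g.pullback t V 0) k)
    (hD' : D' ∈ h.subjects (g.pullback t V 0) k') {z : ℂ} (hz : z ∈ D) (hz' : z ∈ D') :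
    k = k' := by
  wlog hlt : k < k' generalizing k k' D D'
  · rcases (not_lt.1 hlt).eq_or_lt with e | e
    · exact e.symm
    · exact (this hD' hD hz' hz e).symm
  obtain ⟨hk1, hkN, -⟩ := L.subject_spec hg hD hz
  obtain ⟨-, hkN', hW', -⟩ := L.subject_spec hg hD' hz'
  exact absurd (hW' k hlt) (L.subject_escape hg hD hz (by omega))

/-- The men are puzzle pieces, and their points stay in the central domain for `N` iterates. -/
theorem IsLevel.men_spec (L : IsLevel g V h t τ) (hg : g.IsUnicriticalGPL V d)
    (hfin : h.HasFiniteCascade) {M : Set ℂ} (hM : M ∈ h.men (g.pullback t V 0)) {z : ℂ}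
    (hz : z ∈ M) :
    (∀ i ≤ h.cascadeLength, h.toFun^[i] z ∈ h.central) ∧
      h.toFun z ∈ g.pullback (h.cascadeLength * τ 0 + t) V 0 ∧
      M = g.pullback (τ 0 + (h.cascadeLength * τ 0 + t)) V z ∧
      z ∈ g.preimage (τ 0 + (h.cascadeLength * τ 0 + t)) V := by
  have hg' := hg.toIsGPL
  have hN := L.one_le_cascadeLength hfin
  obtain ⟨⟨z₀, hz₀, hMe⟩, -⟩ := hM
  have hzS := (hMe ▸ connectedComponentIn_subset _ _ :
    M ⊆ h.castle (g.pullback t V 0) ∩ h.preimage 1 _) hz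
  have hMz : M = connectedComponentIn (h.castle (g.pullback t V 0) ∩ h.preimage 1
      (h.castle (g.pullback t V 0))) z := by
    rw [hMe]
    refine connectedComponentIn_eq ?_
    rwa [← hMe]
  rw [L.castle_eq hg] at hzS hMz
  have hW := ((L.mem_cascade_iff hg le_rfl).1 hzS.1).2
  have hzW := hW 0 (by omega)
  have hW1 := ((L.mem_cascade_iff hg le_rfl).1 hzS.2.2).2
  have hpb := L.pieced.pullback_eq hg' (fun _ _ => by omega) hzS.2
  have hτ := L.time_eq hg' hzW
  simp only [Function.iterate_zero, id] at hτ
  rw [orbitTime_one, hτ] at hpb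
  have hmem : z ∈ g.preimage (τ 0 + (h.cascadeLength * τ 0 + t)) V := by
    have := mem_pullback_self hzS.2
    rw [hpb] at this
    exact pullback_subset _ _ _ _ this
  refine ⟨fun i hi => ?_, by simpa using hzS.2.2, ?_, hmem⟩
  · rcases i with _ | i
    · exact hzW
    · have := hW1 i (by omega)
      rwa [Function.iterate_one, ← Function.iterate_succ_apply] at this
  · rw [hMz]
    refine Subset.antisymm ?_ ?_
    · rw [← hpb]
      exact connectedComponentIn_mono _ inter_subset_right
    · refine (isPreconnected_pullback _ _ _ _).subset_connectedComponentIn (mem_pullback_self hmem)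
        (subset_inter ?_ ?_)
      · rw [← pullback_eq_of_mem hzS.1]
        exact hg'.pullback_anti (by omega) z
      · rw [← hpb]
        exact pullback_subset _ _ _ _

/-- The critical orbit leaves the central domain after `N` iterates, that of a man later. -/
theorem IsLevel.zero_notMem_men (L : IsLevel g V h t τ) (hg : g.IsUnicriticalGPL V d)
    (hfin : h.HasFiniteCascade) {M : Set ℂ} (hM : M ∈ h.men (g.pullback t V 0)) : (0 : ℂ) ∉ M :=
  fun h0 => cascadeLength_spec hfin ((L.men_spec hg hfin hM h0).1 _ le_rfl)

/-- A man can meet a subject only if the cascade has length `1`, and then they coincide. -/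
theorem IsLevel.men_eq_subject (L : IsLevel g V h t τ) (hg : g.IsUnicriticalGPL V d)
    (hfin : h.HasFiniteCascade) {M D : Set ℂ} {k : ℕ} (hM : M ∈ h.men (g.pullback t V 0))
    (hD : D ∈ h.subjects (g.pullback t V 0) k) {z : ℂ} (hz : z ∈ M) (hz' : z ∈ D) : M = D := by
  have hN := L.one_le_cascadeLength hfin
  obtain ⟨hk1, hkN, hWD, -, -, hDe, -⟩ := L.subject_spec hg hD hz'
  obtain ⟨hW, -, hMe, -⟩ := L.men_spec hg hfin hM hz
  have hN1 : h.cascadeLength = 1 := by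
    by_contra hne
    exact L.subject_escape hg hD hz' (by omega) (hW k hkN)
  have hk : k = 1 := by omega
  subst hk
  have hzW : z ∈ h.central := hW 0 (by omega)
  have hr : h.returnTime h.central z = 1 :=
    returnTime_eq le_rfl ⟨fun i hi => by
      obtain rfl : i = 0 := by omega
      exact L.central_subset_dom hg.toIsGPL hzW, hW 1 hkN⟩ fun j _ _ => by omega
  rw [hMe, hDe, hN1]
  simp only [subjectTime, retTime, tsub_self, Function.iterate_zero, id, hr, orbitTime_one,
    L.time_eq hg.toIsGPL hzW]
  congr 1; ring

theorem IsLevel.king_subset_castle (L : IsLevel g V h t τ) (hg : g.IsGPL V)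
    (hfin : h.HasFiniteCascade) (hking : (0 : ℂ) ∈ h.king) :
    h.king ⊆ g.pullback (h.cascadeLength * τ 0 + t) V 0 := by
  rw [L.king_eq hg hking]
  have := L.kingTime_ge hg hfin hking
  exact hg.pullback_anti (by omega) 0

/-- On the king, the return time to the central domain is that of the critical orbit. -/
theorem IsLevel.subjectTime_king (L : IsLevel g V h t τ) (hg : g.IsUnicriticalGPL V d)
    (hfin : h.HasFiniteCascade) (hking : (0 : ℂ) ∈ h.king) {z : ℂ} (hz : z ∈ h.king) :
    (∀ i < h.cascadeLength, h.toFun^[i] z ∈ h.central) ∧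
      h.toFun^[h.cascadeLength - 1] z ∈ (h.firstReturn h.central).dom ∧
      h.subjectTime τ h.cascadeLength z = h.kingTime τ := by
  have hg' := hg.toIsGPL
  have hW := ((L.mem_cascade_iff hg le_rfl).1 (L.king_subset_castle hg' hfin hking hz)).2
  have hx := exitPoint_mem_dom_return hking
  have h1 : h.toFun^[h.cascadeLength - 1] z ∈ (h.firstReturn h.central).piece h.exitPoint :=
    (pullback_subset _ _ _ _ hz).2
  refine ⟨hW, connectedComponentIn_subset _ _ h1, ?_⟩
  rw [(L.pieced_return hg').piece_eq hg' hx] at h1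
  rw [subjectTime, kingTime, (L.pieced_return hg').time_const _ hx _ h1]

/-- A subject of level `N` that met the king would be the pullback of the same return domain, hence
contain the critical point. -/
theorem IsLevel.disjoint_king_subject (L : IsLevel g V h t τ) (hg : g.IsUnicriticalGPL V d)
    (hfin : h.HasFiniteCascade) (hking : (0 : ℂ) ∈ h.king) {D : Set ℂ} {k : ℕ}
    (hD : D ∈ h.subjects (g.pullback t V 0) k) {z : ℂ} (hz : z ∈ h.king) : z ∉ D := by
  intro hzD
  obtain ⟨hk1, hkN, hWD, -, -, hDe, -⟩ := L.subject_spec hg hD hzD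
  obtain ⟨hW, -, hT⟩ := L.subjectTime_king hg hfin hking hz
  by_cases hkN' : k = h.cascadeLength
  · subst hkN'
    have h0D := hD.2.2.2.1
    rw [L.king_eq hg.toIsGPL hking] at hz
    rw [hDe, hT, pullback_eq_of_mem hz] at h0D
    have h0 := hking
    rw [L.king_eq hg.toIsGPL hking] at h0
    exact h0D h0
  · exact L.subject_escape hg hD hzD (by omega) (hW k (by omega))

theorem IsLevel.disjoint_king_men (L : IsLevel g V h t τ) (hg : g.IsUnicriticalGPL V d)
    (hfin : h.HasFiniteCascade) (hking : (0 : ℂ) ∈ h.king) {M : Set ℂ}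
    (hM : M ∈ h.men (g.pullback t V 0)) {z : ℂ} (hz : z ∈ h.king) : z ∉ M := by
  intro hzM
  have hg' := hg.toIsGPL
  obtain ⟨-, -, hMe, -⟩ := L.men_spec hg hfin hM hzM
  refine L.zero_notMem_men hg hfin hM ?_
  have h0 := hking
  rw [L.king_eq hg' hking] at h0 hz
  have hge := L.kingTime_ge hg' hfin hking
  have h1 := L.pieced.pos _ (L.exit_mem_dom hfin hking)
  rw [← pullback_eq_of_mem hz] at h0
  rw [hMe]
  exact hg'.pullback_anti (by omega) z h0

open Classical in
/-- The number of iterates of `g` that make up the kingdom map. -/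
noncomputable def kingdomTime (h : PlaneMap) (V : Set ℂ) (τ : ℂ → ℕ) (z : ℂ) : ℕ :=
  if z ∈ h.king then h.kingTime τ
  else if ∃ k, z ∈ ⋃₀ h.subjects V k then h.subjectTime τ (sInf {k | z ∈ ⋃₀ h.subjects V k}) z
  else τ 0

open Classical in
/-- The depth of the images of the pieces of the kingdom map: the king and the subjects are mapped
onto the central domain, the men onto the castle. -/
noncomputable def kingdomDepth (h : PlaneMap) (V : Set ℂ) (t : ℕ) (τ : ℂ → ℕ) (z : ℂ) : ℕ :=
  if z ∈ h.king then τ 0 + t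
  else if ∃ k, z ∈ ⋃₀ h.subjects V k then τ 0 + t
  else h.cascadeLength * τ 0 + t

theorem IsLevel.kingdom_king (L : IsLevel g V h t τ) (hg : g.IsUnicriticalGPL V d)
    (hfin : h.HasFiniteCascade) (hking : (0 : ℂ) ∈ h.king) {z : ℂ} (hz : z ∈ h.king) :
    h.kingdomTime (g.pullback t V 0) τ z = h.kingTime τ ∧
      h.kingdomDepth (g.pullback t V 0) t τ z = τ 0 + t ∧
      (h.kingdom (g.pullback t V 0)).toFun z = g.toFun^[h.kingTime τ] z := by
  have hg' := hg.toIsGPL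
  refine ⟨by simp [kingdomTime, hz], by simp [kingdomDepth, hz], ?_⟩
  obtain ⟨hW, hx, hT⟩ := L.subjectTime_king hg hfin hking hz
  have hW' : ∀ i < h.cascadeLength - 1, h.toFun^[i] z ∈ h.central := fun i hi => hW i (by omega)
  simp only [kingdom, hz, if_true]
  rw [(L.pieced_return hg').eq _ hx, L.pieced.iterate_eq (L.iterDom_of_central hg' hW'),
    ← Function.iterate_add_apply, ← L.pieced.iterate_eq (L.iterDom_of_central hg' hW'),
    L.orbitTime_of_central hg' hW', add_comm, ← hT, subjectTime]

theorem IsLevel.kingdom_subject (L : IsLevel g V h t τ) (hg : g.IsUnicriticalGPL V d)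
    (hfin : h.HasFiniteCascade) (hking : (0 : ℂ) ∈ h.king) {D : Set ℂ} {k : ℕ}
    (hD : D ∈ h.subjects (g.pullback t V 0) k) {z : ℂ} (hz : z ∈ D) :
    h.kingdomTime (g.pullback t V 0) τ z = h.subjectTime τ k z ∧
      h.kingdomDepth (g.pullback t V 0) t τ z = τ 0 + t ∧
      (h.kingdom (g.pullback t V 0)).toFun z = g.toFun^[h.subjectTime τ k z] z := by
  have hg' := hg.toIsGPL
  have hzk : z ∉ h.king := fun h' => L.disjoint_king_subject hg hfin hking hD h' hz
  have hex : ∃ k, z ∈ ⋃₀ h.subjects (g.pullback t V 0) k := ⟨k, D, hD, hz⟩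
  have hinf : sInf {k | z ∈ ⋃₀ h.subjects (g.pullback t V 0) k} = k := by
    obtain ⟨D', hD', hz'⟩ := Nat.sInf_mem hex
    exact L.subject_level_unique hg hD' hD hz' hz
  obtain ⟨hk1, hkN, hW, hx, -⟩ := L.subject_spec hg hD hz
  have hW' : ∀ i < k - 1, h.toFun^[i] z ∈ h.central := fun i hi => hW i (by omega)
  refine ⟨?_, ?_, ?_⟩
  · rw [kingdomTime, if_neg hzk, if_pos hex, hinf]
  · rw [kingdomDepth, if_neg hzk, if_pos hex]
  · simp only [kingdom]
    rw [if_neg hzk, if_pos hex, hinf, (L.pieced_return hg').eq _ hx,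
      L.pieced.iterate_eq (L.iterDom_of_central hg' hW'), ← Function.iterate_add_apply,
      ← L.pieced.iterate_eq (L.iterDom_of_central hg' hW'), L.orbitTime_of_central hg' hW',
      add_comm, subjectTime]

theorem IsLevel.kingdom_men (L : IsLevel g V h t τ) (hg : g.IsUnicriticalGPL V d)
    (hfin : h.HasFiniteCascade) (hking : (0 : ℂ) ∈ h.king) {M : Set ℂ}
    (hM : M ∈ h.men (g.pullback t V 0)) {z : ℂ} (hz : z ∈ M)
    (hs : ¬ ∃ k, z ∈ ⋃₀ h.subjects (g.pullback t V 0) k) :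
    h.kingdomTime (g.pullback t V 0) τ z = τ 0 ∧
      h.kingdomDepth (g.pullback t V 0) t τ z = h.cascadeLength * τ 0 + t ∧
      (h.kingdom (g.pullback t V 0)).toFun z = h.toFun z ∧ h.toFun z = g.toFun^[τ 0] z := by
  have hzk : z ∉ h.king := fun h' => L.disjoint_king_men hg hfin hking hM h' hz
  refine ⟨?_, ?_, ?_, ?_⟩
  · rw [kingdomTime, if_neg hzk, if_neg hs]
  · rw [kingdomDepth, if_neg hzk, if_neg hs]
  · simp only [kingdom]
    rw [if_neg hzk, if_neg hs]
  · have hzW : z ∈ h.central := (L.men_spec hg hfin hM hz).1 0 (by omega)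
    rw [L.pieced.eq z (L.central_subset_dom hg.toIsGPL hzW), L.time_eq hg.toIsGPL hzW]

/-- The cases in the definition of the kingdom map. The subjects have precedence over the men, since
a subject may at the same time be one of the men when the cascade has length `1`. -/
theorem mem_kingdom_dom {U : Set ℂ} {z : ℂ} (hz : z ∈ (h.kingdom U).dom) :
    z ∈ h.king ∨ (∃ k, ∃ D ∈ h.subjects U k, z ∈ D) ∨
      ((¬ ∃ k, z ∈ ⋃₀ h.subjects U k) ∧ ∃ M ∈ h.men U, z ∈ M) := by
  by_cases hs : ∃ k, z ∈ ⋃₀ h.subjects U k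
  · obtain ⟨k, D, hD, hzD⟩ := hs
    exact Or.inr (Or.inl ⟨k, D, hD, hzD⟩)
  · rcases hz with (hz | hz) | hz
    · exact Or.inl hz
    · exact absurd (mem_iUnion.1 hz) hs
    · exact Or.inr (Or.inr ⟨hs, hz⟩)

theorem IsLevel.kingdomDepth_bounds (L : IsLevel g V h t τ) (hfin : h.HasFiniteCascade)
    (U : Set ℂ) (z : ℂ) :
    τ 0 + t ≤ h.kingdomDepth U t τ z ∧ h.kingdomDepth U t τ z ≤ h.cascadeLength * τ 0 + t := by
  have := Nat.le_mul_of_pos_left (τ 0) (L.one_le_cascadeLength hfin)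
  unfold kingdomDepth
  split_ifs <;> omega

/-- The kingdom map is piecewise an iterate of `g`. -/
theorem IsLevel.pieced_kingdom (L : IsLevel g V h t τ) (hg : g.IsUnicriticalGPL V d)
    (hfin : h.HasFiniteCascade) (hking : (0 : ℂ) ∈ h.king) :
    Pieced g V (h.kingdom (g.pullback t V 0)) (h.kingdomTime (g.pullback t V 0) τ)
      (h.kingdomDepth (g.pullback t V 0) t τ) := by
  have hg' := hg.toIsGPL
  have hp := L.one_le_time_zero
  have hge := L.kingTime_ge hg' hfin hking
  have hpos := L.pieced.pos _ (L.exit_mem_dom hfin hking)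
  set U := g.pullback t V 0 with hU
  have hkd : h.king ⊆ (h.kingdom U).dom := fun w hw => Or.inl (Or.inl hw)
  have hsd : ∀ k, ∀ D ∈ h.subjects U k, D ⊆ (h.kingdom U).dom := fun k D hD w hw =>
    Or.inl (Or.inr (mem_iUnion.2 ⟨k, D, hD, hw⟩))
  have hmd : ∀ M ∈ h.men U, M ⊆ (h.kingdom U).dom := fun M hM w hw => Or.inr ⟨M, hM, hw⟩
  have hms : ∀ M ∈ h.men U, ∀ z ∈ M, ∀ w ∈ M, (¬ ∃ k, z ∈ ⋃₀ h.subjects U k) →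
      ¬ ∃ k, w ∈ ⋃₀ h.subjects U k := by
    rintro M hM z hz w hw hns ⟨k, D, hD, hwD⟩
    have := L.men_eq_subject hg hfin hM hD hw hwD
    exact hns ⟨k, D, hD, this ▸ hz⟩
  constructor
  · intro z hz
    rcases mem_kingdom_dom hz with hz | ⟨k, D, hD, hz⟩ | ⟨hs, M, hM, hz⟩
    · rw [(L.kingdom_king hg hfin hking hz).1]
      omega
    · rw [(L.kingdom_subject hg hfin hking hD hz).1, subjectTime]
      obtain ⟨-, -, -, hx, -⟩ := L.subject_spec hg hD hz
      have := (L.pieced_return hg').pos _ hx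
      omega
    · rw [(L.kingdom_men hg hfin hking hM hz hs).1]
      exact hp
  · intro z hz
    rcases mem_kingdom_dom hz with hz | ⟨k, D, hD, hz⟩ | ⟨hs, M, hM, hz⟩
    · rw [(L.kingdom_king hg hfin hking hz).1, (L.kingdom_king hg hfin hking hz).2.1]
      rw [L.king_eq hg' hking] at hz
      exact pullback_subset _ _ _ _ hz
    · rw [(L.kingdom_subject hg hfin hking hD hz).1, (L.kingdom_subject hg hfin hking hD hz).2.1]
      exact (L.subject_spec hg hD hz).2.2.2.2.2.2
    · rw [(L.kingdom_men hg hfin hking hM hz hs).1, (L.kingdom_men hg hfin hking hM hz hs).2.1]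
      exact (L.men_spec hg hfin hM hz).2.2.2
  · intro z hz
    rcases mem_kingdom_dom hz with hz | ⟨k, D, hD, hz⟩ | ⟨hs, M, hM, hz⟩
    · rw [(L.kingdom_king hg hfin hking hz).1, (L.kingdom_king hg hfin hking hz).2.1]
      have hz' := hz
      rw [L.king_eq hg' hking] at hz'
      rw [pullback_eq_of_mem hz', ← L.king_eq hg' hking]
      exact hkd
    · rw [(L.kingdom_subject hg hfin hking hD hz).1, (L.kingdom_subject hg hfin hking hD hz).2.1,
        ← (L.subject_spec hg hD hz).2.2.2.2.2.1]
      exact hsd k D hD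
    · rw [(L.kingdom_men hg hfin hking hM hz hs).1, (L.kingdom_men hg hfin hking hM hz hs).2.1,
        ← (L.men_spec hg hfin hM hz).2.2.1]
      exact hmd M hM
  · intro z hz w hw
    rcases mem_kingdom_dom hz with hz | ⟨k, D, hD, hz⟩ | ⟨hs, M, hM, hz⟩
    · rw [(L.kingdom_king hg hfin hking hz).1, (L.kingdom_king hg hfin hking hz).2.1] at hw
      rw [(L.kingdom_king hg hfin hking hz).1]
      have hz' := hz
      rw [L.king_eq hg' hking] at hz'
      rw [pullback_eq_of_mem hz', ← L.king_eq hg' hking] at hw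
      rw [(L.kingdom_king hg hfin hking hw).1]
    · rw [(L.kingdom_subject hg hfin hking hD hz).1, (L.kingdom_subject hg hfin hking hD hz).2.1,
        ← (L.subject_spec hg hD hz).2.2.2.2.2.1] at hw
      rw [(L.kingdom_subject hg hfin hking hD hz).1, (L.kingdom_subject hg hfin hking hD hw).1,
        L.subjectTime_const hg hD hz hw]
    · rw [(L.kingdom_men hg hfin hking hM hz hs).1, (L.kingdom_men hg hfin hking hM hz hs).2.1,
        ← (L.men_spec hg hfin hM hz).2.2.1] at hw
      rw [(L.kingdom_men hg hfin hking hM hz hs).1,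
        (L.kingdom_men hg hfin hking hM hw (hms M hM z hz w hw hs)).1]
  · intro z hz w hw
    rcases mem_kingdom_dom hz with hz | ⟨k, D, hD, hz⟩ | ⟨hs, M, hM, hz⟩
    · rw [(L.kingdom_king hg hfin hking hz).1, (L.kingdom_king hg hfin hking hz).2.1] at hw
      rw [(L.kingdom_king hg hfin hking hz).2.1]
      have hz' := hz
      rw [L.king_eq hg' hking] at hz'
      rw [pullback_eq_of_mem hz', ← L.king_eq hg' hking] at hw
      rw [(L.kingdom_king hg hfin hking hw).2.1]
    · rw [(L.kingdom_subject hg hfin hking hD hz).1, (L.kingdom_subject hg hfin hking hD hz).2.1,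
        ← (L.subject_spec hg hD hz).2.2.2.2.2.1] at hw
      rw [(L.kingdom_subject hg hfin hking hD hz).2.1, (L.kingdom_subject hg hfin hking hD hw).2.1]
    · rw [(L.kingdom_men hg hfin hking hM hz hs).1, (L.kingdom_men hg hfin hking hM hz hs).2.1,
        ← (L.men_spec hg hfin hM hz).2.2.1] at hw
      rw [(L.kingdom_men hg hfin hking hM hz hs).2.1,
        (L.kingdom_men hg hfin hking hM hw (hms M hM z hz w hw hs)).2.1]
  · intro z hz
    rcases mem_kingdom_dom hz with hz | ⟨k, D, hD, hz⟩ | ⟨hs, M, hM, hz⟩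
    · rw [(L.kingdom_king hg hfin hking hz).1, (L.kingdom_king hg hfin hking hz).2.2]
    · rw [(L.kingdom_subject hg hfin hking hD hz).1, (L.kingdom_subject hg hfin hking hD hz).2.2]
    · obtain ⟨h1, -, h2, h3⟩ := L.kingdom_men hg hfin hking hM hz hs
      rw [h1, h2, h3]
  · intro z hz hz1
    have hb1 := (L.kingdomDepth_bounds hfin U ((h.kingdom U).toFun z)).1
    rcases mem_kingdom_dom hz with hz | ⟨k, D, hD, hz⟩ | ⟨hs, M, hM, hz⟩
    · rw [(L.kingdom_king hg hfin hking hz).2.1]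
      omega
    · rw [(L.kingdom_subject hg hfin hking hD hz).2.1]
      omega
    · obtain ⟨-, h1, h2, -⟩ := L.kingdom_men hg hfin hking hM hz hs
      have hzU := (L.men_spec hg hfin hM hz).2.1
      rw [h1]
      rw [h2] at hz1 hb1 ⊢
      rcases mem_kingdom_dom hz1 with hz1 | ⟨k, D, hD, hz1⟩ | ⟨hs1, M, hM, hz1⟩
      · rw [(L.kingdom_king hg hfin hking hz1).1]
        omega
      · rw [(L.kingdom_subject hg hfin hking hD hz1).1, subjectTime]
        obtain ⟨hk1, hkN, -⟩ := L.subject_spec hg hD hz1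
        -- the image lies in the castle, so it takes `N` iterates to leave the central domain
        have hk : k = h.cascadeLength := by
          by_contra hne
          exact L.subject_escape hg hD hz1 (by omega)
            (((L.mem_cascade_iff hg le_rfl).1 hzU).2 k (by omega))
        have : h.cascadeLength * τ 0 = (k - 1) * τ 0 + τ 0 := by
          obtain ⟨j, rfl⟩ : ∃ j, k = j + 1 := ⟨k - 1, by omega⟩
          rw [← hk, add_tsub_cancel_right]; ring
        omega
      · rw [(L.kingdom_men hg hfin hking hM hz1 hs1).2.1]
        omega

/-- The kingdom map does not skip visits of the critical point. -/
theorem IsLevel.noHits_kingdom (L : IsLevel g V h t τ) (hg : g.IsUnicriticalGPL V d)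
    (hfin : h.HasFiniteCascade) (hking : (0 : ℂ) ∈ h.king) :
    NoHits g V (h.kingdom (g.pullback t V 0)) (h.kingdomTime (g.pullback t V 0) τ)
      (h.kingdomDepth (g.pullback t V 0) t τ) := by
  have hg' := hg.toIsGPL
  intro z hz l hl hl' hit
  rcases mem_kingdom_dom hz with hz | ⟨k, D, hD, hz⟩ | ⟨hs, M, hM, hz⟩
  · obtain ⟨h1, h2, -⟩ := L.kingdom_king hg hfin hking hz
    rw [h1] at hl' hit
    rw [h2] at hit
    rw [L.king_eq hg' hking] at hz
    rw [hg'.hits_congr hz le_rfl (by omega)] at hit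
    exact L.king_noHits hg' hfin hking hl hl' (hg'.hits_anti (by omega) hit)
  · obtain ⟨h1, h2, -⟩ := L.kingdom_subject hg hfin hking hD hz
    obtain ⟨hk1, hkN, hW, hx, h0X, -, -⟩ := L.subject_spec hg hD hz
    have hfr := firstReturn_spec hx
    set x := h.toFun^[k - 1] z with hxdef
    set r := h.returnTime h.central x with hr
    have hW' : ∀ i < k - 1, h.toFun^[i] z ∈ h.central := fun i hi => hW i (by omega)
    have hd : z ∈ h.iterDom (k - 1 + r) :=
      mem_iterDom_add.2 ⟨L.iterDom_of_central hg' hW', hfr.2.1⟩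
    have hT : h.subjectTime τ k z = h.orbitTime τ (k - 1 + r) z := by
      rw [orbitTime_add, L.orbitTime_of_central hg' hW', subjectTime, retTime, ← hxdef]
    rw [h1, hT] at hl' hit
    rw [h2] at hit
    have hb : ∀ x ∈ h.dom, (fun _ : ℂ => t) x ≤ τ 0 + t := fun _ _ => Nat.le_add_left _ _
    obtain ⟨j, hj, rfl, h0⟩ := L.pieced.exists_of_hits hg' L.noHits hb hd hl' hit
    have hj0 : j ≠ 0 := by rintro rfl; simp [orbitTime_zero] at hl
    by_cases hjk : k ≤ j
    · have h3 : h.toFun^[j] z ∈ h.central := by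
        rw [L.central_eq hg']
        exact hg'.pullback_anti (by omega) 0 (mem_pullback_comm h0)
      refine not_mem_of_lt_returnTime (H := h) (A := h.central) (z := x) (k := j - (k - 1))
        (by omega) (iterDom_anti (by omega) hfr.2.1) (by omega) ?_
      rw [hxdef, ← Function.iterate_add_apply]
      convert h3 using 2
      omega
    · -- the critical point shadows `h^j z`, hence also enters `X`; but `X` is not central
      have h4 := L.pieced.shadow_mem hg' hb (iterDom_iterate hj.le hd) h0
        (show k - 1 - j ≤ k - 1 + r - j by omega)
      have h5 : h.toFun^[k - 1 - j] (h.toFun^[j] z) = x := by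
        rw [hxdef, ← Function.iterate_add_apply]; congr 2; omega
      rw [h5, show k - 1 + r - j - (k - 1 - j) = r by omega] at h4
      have h6 : h.toFun^[k - 1 - j] 0 ∈ (h.firstReturn h.central).piece x := by
        rw [(L.pieced_return hg').piece_eq hg' hx]
        exact h4
      have h7 := L.zero_mem_return_piece hg (by omega)
        (iterate_mem_central (h := h) (k := k - 1 - j) (by omega))
        (by rw [← Function.iterate_succ_apply' h.toFun]; exact iterate_mem_central (by omega))
      refine h0X ?_
      rwa [show (h.firstReturn h.central).piece x = _ from connectedComponentIn_eq h6]
  · obtain ⟨h1, h2, -, -⟩ := L.kingdom_men hg hfin hking hM hz hs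
    have hzW : z ∈ h.central := (L.men_spec hg hfin hM hz).1 0 (by omega)
    have hzτ := L.time_eq hg' hzW
    rw [h1, ← hzτ] at hl'
    rw [h1, h2, ← hzτ] at hit
    exact L.noHits z (L.central_subset_dom hg' hzW) l hl hl'
      (hg'.hits_anti (Nat.add_le_add_left (Nat.le_add_left _ _) _) hit)

theorem IsLevel.zero_notMem_piece_kingdom (L : IsLevel g V h t τ) (hg : g.IsUnicriticalGPL V d)
    (hfin : h.HasFiniteCascade) (hking : (0 : ℂ) ∈ h.king) {z : ℂ}
    (hz : z ∈ (h.kingdom (g.pullback t V 0)).dom) (hzk : z ∉ h.king) :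
    (0 : ℂ) ∉ g.pullback (h.kingdomTime (g.pullback t V 0) τ z +
      h.kingdomDepth (g.pullback t V 0) t τ z) V z := by
  rcases mem_kingdom_dom hz with hz | ⟨k, D, hD, hz⟩ | ⟨hs, M, hM, hz⟩
  · exact absurd hz hzk
  · obtain ⟨h1, h2, -⟩ := L.kingdom_subject hg hfin hking hD hz
    rw [h1, h2, ← (L.subject_spec hg hD hz).2.2.2.2.2.1]
    exact hD.2.2.2.1
  · obtain ⟨h1, h2, -⟩ := L.kingdom_men hg hfin hking hM hz hs
    rw [h1, h2, ← (L.men_spec hg hfin hM hz).2.2.1]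
    exact L.zero_notMem_men hg hfin hM

/-! ### The next level of the dynasty -/

/-- The times of the level that follows `h` in the dynasty. -/
noncomputable def nextTime (h : PlaneMap) (V : Set ℂ) (τ : ℂ → ℕ) : ℂ → ℕ :=
  (h.kingdom V).retTime (h.kingdomTime V τ) h.king

/-- The renormalization of the kingdom on the king is again a level. -/
theorem IsLevel.next (L : IsLevel g V h t τ) (hg : g.IsUnicriticalGPL V d)
    (hfin : h.HasFiniteCascade) (hking : (0 : ℂ) ∈ h.king)
    (h0 : (0 : ℂ) ∈ ((h.kingdom (g.pullback t V 0)).renorm h.king).dom) :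
    IsLevel g V ((h.kingdom (g.pullback t V 0)).renorm h.king) (h.kingTime τ + (τ 0 + t))
      (h.nextTime (g.pullback t V 0) τ) := by
  have hg' := hg.toIsGPL
  have hK := L.pieced_kingdom hg hfin hking
  have hno := L.noHits_kingdom hg hfin hking
  have hA := L.king_eq hg' hking
  have hb : ∀ x ∈ (h.kingdom (g.pullback t V 0)).dom,
      h.kingdomDepth (g.pullback t V 0) t τ x ≤ h.kingTime τ + (τ 0 + t) := fun x _ => by
    have := (L.kingdomDepth_bounds hfin (g.pullback t V 0) x).2
    have := L.kingTime_ge hg' hfin hking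
    omega
  have hP := (hK.firstReturn hg' hb).restrictMeeting hg'
    (h.kingdom (g.pullback t V 0)).postcritical
  rw [← hA] at hP
  refine ⟨hP, fun z hz l hl hl' hit => ?_, fun z hz => ?_, fun z hz => ?_, h0⟩
  · obtain ⟨hr, hzr⟩ := firstReturn_spec hz.1
    obtain ⟨j, hj, rfl, hj0⟩ := hK.exists_of_hits hg' hno hb hzr.1 hl' hit
    have hj1 : j ≠ 0 := by rintro rfl; simp [orbitTime_zero] at hl
    refine not_mem_of_lt_returnTime (by omega) (iterDom_anti hj.le hzr.1) hj ?_
    rw [hA]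
    exact hg'.pullback_anti (by omega) 0 (mem_pullback_comm hj0)
  · rw [← hA]; exact hz.1.1
  · rw [← hA]; exact (firstReturn_spec hz.1).2.2

theorem IsLevel.kingTime_le_nextTime (L : IsLevel g V h t τ) (hg : g.IsUnicriticalGPL V d)
    (hfin : h.HasFiniteCascade) (hking : (0 : ℂ) ∈ h.king) {z : ℂ}
    (hz : z ∈ ((h.kingdom (g.pullback t V 0)).renorm h.king).dom) :
    h.kingTime τ ≤ h.nextTime (g.pullback t V 0) τ z := by
  obtain ⟨hr, -⟩ := firstReturn_spec hz.1
  refine le_trans ?_ (orbitTime_mono hr z)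
  rw [orbitTime_one, (L.kingdom_king hg hfin hking hz.1.1).1]

/-- Along the first return of the critical point to the king, the pullback of a piece inside the
castle, such as the apartment, covers the critical point only at the initial moment: the other
pieces of the kingdom do not contain the critical point. -/
theorem IsLevel.nextTime_noHits (L : IsLevel g V h t τ) (hg : g.IsUnicriticalGPL V d)
    (hfin : h.HasFiniteCascade) (hking : (0 : ℂ) ∈ h.king)
    (h0 : (0 : ℂ) ∈ ((h.kingdom (g.pullback t V 0)).renorm h.king).dom) {e l : ℕ}
    (he : h.cascadeLength * τ 0 + t ≤ e) (hl : 0 < l)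
    (hl' : l < h.nextTime (g.pullback t V 0) τ 0) :
    ¬ g.Hits V (h.nextTime (g.pullback t V 0) τ 0 + e) 0 l := by
  intro hit
  have hg' := hg.toIsGPL
  have hK := L.pieced_kingdom hg hfin hking
  have hno := L.noHits_kingdom hg hfin hking
  have hb : ∀ x ∈ (h.kingdom (g.pullback t V 0)).dom,
      h.kingdomDepth (g.pullback t V 0) t τ x ≤ e := fun x _ => by
    have := (L.kingdomDepth_bounds hfin (g.pullback t V 0) x).2
    omega
  obtain ⟨hr, hzr⟩ := firstReturn_spec h0.1
  obtain ⟨j, hj, rfl, hj0⟩ := hK.exists_of_hits hg' hno hb hzr.1 hl' hit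
  have hj1 : j ≠ 0 := by rintro rfl; simp [orbitTime_zero] at hl
  have hnk := not_mem_of_lt_returnTime (by omega) (iterDom_anti hj.le hzr.1) hj
  refine L.zero_notMem_piece_kingdom hg hfin hking (hzr.1 j hj) hnk ?_
  exact hg'.pullback_anti (hK.depth_le (by omega) hb (iterDom_iterate hj.le hzr.1)) _ hj0

end PlaneMap

namespace PlaneMap

variable {g : PlaneMap} {V : Set ℂ} {d n : ℕ}

/-! ### The modified principal nest -/

/-- The depth `t` of the puzzle piece `V^j` together with the times of the map `g_j` as a piecewise
iterate of `g`. -/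
noncomputable def levelData (g : PlaneMap) (V : Set ℂ) : ℕ → ℕ × (ℂ → ℕ)
  | 0 => (0, fun _ => 1)
  | j + 1 =>
    ((g.level V j).kingTime (levelData g V j).2 + ((levelData g V j).2 0 + (levelData g V j).1),
      (g.level V j).nextTime (g.pullback (levelData g V j).1 V 0) (levelData g V j).2)

theorem level_succ (g : PlaneMap) (V : Set ℂ) (j : ℕ) :
    g.level V (j + 1) = ((g.level V j).kingdom (g.nestV V j)).renorm (g.level V j).king := rfl

theorem nestV_succ (g : PlaneMap) (V : Set ℂ) (j : ℕ) :
    g.nestV V (j + 1) = (g.level V j).king := rfl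

theorem DynastyReaches.zero_mem_king (hd : g.DynastyReaches V n) {j : ℕ} (hj : j < n) :
    (0 : ℂ) ∈ (g.level V j).king := (hd j hj).2.1.1

theorem DynastyReaches.isLevel (hd : g.DynastyReaches V n) (hg : g.IsUnicriticalGPL V d) {j : ℕ}
    (hj : j ≤ n) :
    IsLevel g V (g.level V j) (g.levelData V j).1 (g.levelData V j).2 ∧
      g.nestV V j = g.pullback (g.levelData V j).1 V 0 := by
  induction j with
  | zero =>
    exact ⟨hg.isLevel_zero, (hg.toIsGPL.pullback_zero (hg.toIsGPL.dom_subset hg.zero_mem_dom)).symm⟩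
  | succ j ih =>
    obtain ⟨L, hV⟩ := ih (by omega)
    have hking := hd.zero_mem_king hj
    have h0 := (hd j hj).2
    rw [level_succ, hV] at h0
    rw [level_succ, nestV_succ, hV]
    exact ⟨L.next hg (hd j hj).1 hking h0, L.king_eq hg.toIsGPL hking⟩

/-- Numerical data of the nest up to level `n`: `t j` and `p j + t j` are the depths of `V^j` and
`W^j`, `p j` and `q j` are the times from `W^j` to `V^j` and from `V^{j+1}` to `W^j`, and `δ j` is
the depth of the apartment `Δ^j`. -/
structure NestTimes (g : PlaneMap) (V : Set ℂ) (n : ℕ) (t p q δ : ℕ → ℕ) : Prop where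
  t_zero : t 0 = 0
  p_zero : p 0 = 1
  p_pos : ∀ j ≤ n, 1 ≤ p j
  q_pos : ∀ j < n, 1 ≤ q j
  nestV : ∀ j ≤ n, g.nestV V j = g.pullback (t j) V 0
  nestW : ∀ j ≤ n, g.nestW V j = g.pullback (p j + t j) V 0
  apartment : ∀ j < n, (g.level V j).apartment = g.pullback (δ j) V 0
  zero_mem : ∀ j ≤ n, (0 : ℂ) ∈ g.preimage (p j + t j) V
  t_succ : ∀ j < n, t (j + 1) = q j + (p j + t j)
  mem_p : ∀ j ≤ n, g.toFun^[p j] 0 ∈ g.pullback (t j) V 0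
  mem_q : ∀ j < n, g.toFun^[q j] 0 ∈ g.pullback (p j + t j) V 0
  le_δ : ∀ j < n, p j + t j ≤ δ j
  δ_le : ∀ j < n, δ j ≤ q j + t j
  q_le_p : ∀ j < n, q j ≤ p (j + 1)
  le_q : ∀ j, j + 1 < n → p (j + 1) + q j ≤ q (j + 1)
  noHits_p : ∀ j ≤ n, ∀ l, 0 < l → l < p j → ¬ g.Hits V (p j + t j) 0 l
  noHits_q : ∀ j < n, ∀ l, 0 < l → l < q j → ¬ g.Hits V (q j + t j) 0 l
  noHits_δ : ∀ j < n, ∀ l, 0 < l → l < p (j + 1) → ¬ g.Hits V (p (j + 1) + δ j) 0 l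

theorem DynastyReaches.exists_nestTimes (hd : g.DynastyReaches V n)
    (hg : g.IsUnicriticalGPL V d) : ∃ t p q δ : ℕ → ℕ, NestTimes g V n t p q δ := by
  have hg' := hg.toIsGPL
  set t : ℕ → ℕ := fun j => (g.levelData V j).1 with ht
  set τ : ℕ → ℂ → ℕ := fun j => (g.levelData V j).2 with hτ
  have hL : ∀ j ≤ n, IsLevel g V (g.level V j) (t j) (τ j) := fun j hj => (hd.isLevel hg hj).1
  have hV : ∀ j ≤ n, g.nestV V j = g.pullback (t j) V 0 := fun j hj => (hd.isLevel hg hj).2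
  have hk : ∀ j < n, (0 : ℂ) ∈ (g.level V j).king := fun j hj => hd.zero_mem_king hj
  have hf : ∀ j < n, (g.level V j).HasFiniteCascade := fun j hj => (hd j hj).1
  have h0 : ∀ j < n, (0 : ℂ) ∈
      (((g.level V j).kingdom (g.pullback (t j) V 0)).renorm (g.level V j).king).dom :=
    fun j hj => by rw [← hV j hj.le]; exact (hd j hj).2
  have hlv : ∀ j < n, g.level V (j + 1) =
      ((g.level V j).kingdom (g.pullback (t j) V 0)).renorm (g.level V j).king :=
    fun j hj => by rw [← hV j hj.le]; rfl
  have hge : ∀ j (hj : j < n), _ := fun j hj =>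
    (hL j hj.le).kingTime_ge hg' (hf j hj) (hk j hj)
  have hN : ∀ j < n, τ j 0 ≤ (g.level V j).cascadeLength * τ j 0 := fun j hj =>
    Nat.le_mul_of_pos_left _ ((hL j hj.le).one_le_cascadeLength (hf j hj))
  have hp : ∀ j ≤ n, 1 ≤ τ j 0 := fun j hj => (hL j hj).one_le_time_zero
  refine ⟨t, fun j => τ j 0, fun j => (g.level V j).kingTime (τ j),
    fun j => (g.level V j).cascadeLength * τ j 0 +
      (τ j ((g.level V j).toFun^[(g.level V j).cascadeLength] 0) + t j), ?_⟩
  constructor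
  · rfl
  · rfl
  · exact hp
  · intro j hj
    have := hge j hj
    have := hN j hj
    have := hp j hj.le
    show 1 ≤ (g.level V j).kingTime (τ j)
    omega
  · exact hV
  · exact fun j hj => (hL j hj).central_eq hg'
  · exact fun j hj => (hL j hj.le).apartment_eq hg' (hf j hj) (hk j hj)
  · intro j hj
    have := (hL j hj).zero_mem_central
    rw [(hL j hj).central_eq hg'] at this
    exact pullback_subset _ _ _ _ this
  · exact fun j hj => rfl
  · intro j hj
    rw [← (hL j hj).pieced.eq 0 (hL j hj).zero_mem]
    exact (hL j hj).maps 0 (hL j hj).zero_mem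
  · intro j hj
    have h1 := (firstReturn_spec (exitPoint_mem_dom_return (hk j hj))).2.2
    rw [exitPoint, ← Function.iterate_add_apply, ← exitPoint, add_comm,
      (hL j hj.le).pieced.iterate_eq ((hL j hj.le).iterDom_king hg' (hk j hj)),
      (hL j hj.le).orbitTime_king hg', (hL j hj.le).central_eq hg'] at h1
    exact h1
  · intro j hj
    have := hN j hj
    show τ j 0 + t j ≤ (g.level V j).cascadeLength * τ j 0 + (_ + t j)
    omega
  · intro j hj
    have := hge j hj
    show (g.level V j).cascadeLength * τ j 0 + (_ + t j) ≤ (g.level V j).kingTime (τ j) + t j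
    omega
  · intro j hj
    exact (hL j hj.le).kingTime_le_nextTime hg (hf j hj) (hk j hj) (h0 j hj)
  · intro j hj
    have h1 := (hL (j + 1) hj.le).exit_mem_dom (hf _ hj) (hk _ hj)
    have h2 := hlv j (by omega)
    have h3 := (hL j (by omega)).kingTime_le_nextTime hg (hf j (by omega)) (hk j (by omega))
      (z := (g.level V (j + 1)).toFun^[(g.level V (j + 1)).cascadeLength] 0)
      (by rw [← h2]; exact h1)
    have h4 := hge (j + 1) hj
    have h5 := hN (j + 1) hj
    exact le_trans (add_le_add h5 h3) h4
  · exact fun j hj l hl hl' => (hL j hj).noHits 0 (hL j hj).zero_mem l hl hl'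
  · exact fun j hj l hl hl' => (hL j hj.le).king_noHits hg' (hf j hj) (hk j hj) hl hl'
  · intro j hj l hl hl'
    exact (hL j hj.le).nextTime_noHits hg (hf j hj) (hk j hj) (h0 j hj) (by omega) hl hl'

namespace NestTimes

variable {t p q δ : ℕ → ℕ}

/-- The depth of the domain `E^i` of the nest in uniform numbering. -/
def depth (t p : ℕ → ℕ) (i : ℕ) : ℕ := if i % 2 = 0 then t (i / 2) else p (i / 2) + t (i / 2)

/-- The depth of the enlargement of `E^i`, for `i ≥ 1`. -/
def hatDepth (t δ : ℕ → ℕ) (i : ℕ) : ℕ := if i % 2 = 0 then δ (i / 2 - 1) else t (i / 2)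

theorem depth_even (t p : ℕ → ℕ) (j : ℕ) : depth t p (2 * j) = t j := by simp [depth]

theorem depth_odd (t p : ℕ → ℕ) (j : ℕ) : depth t p (2 * j + 1) = p j + t j := by
  rw [depth, if_neg (by omega), show (2 * j + 1) / 2 = j by omega]

theorem hatDepth_even (t δ : ℕ → ℕ) (j : ℕ) : hatDepth t δ (2 * j + 2) = δ j := by
  rw [hatDepth, if_pos (by omega), show (2 * j + 2) / 2 - 1 = j by omega]

theorem hatDepth_odd (t δ : ℕ → ℕ) (j : ℕ) : hatDepth t δ (2 * j + 1) = t j := by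
  rw [hatDepth, if_neg (by omega), show (2 * j + 1) / 2 = j by omega]

theorem depth_zero (T : NestTimes g V n t p q δ) : depth t p 0 = 0 := T.t_zero

theorem depth_step (T : NestTimes g V n t p q δ) {i : ℕ} (hi : i ≤ 2 * n) :
    (∃ j ≤ n, i = 2 * j ∧ depth t p (i + 1) = p j + depth t p i) ∨
      ∃ j < n, i = 2 * j + 1 ∧ depth t p (i + 1) = q j + depth t p i := by
  rcases Nat.even_or_odd' i with ⟨j, rfl | rfl⟩
  · exact Or.inl ⟨j, by omega, rfl, by rw [depth_odd, depth_even]⟩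
  · refine Or.inr ⟨j, by omega, rfl, ?_⟩
    rw [depth_odd, show 2 * j + 1 + 1 = 2 * (j + 1) by ring, depth_even, T.t_succ j (by omega)]

theorem depth_lt (T : NestTimes g V n t p q δ) {i : ℕ} (hi : i ≤ 2 * n) :
    depth t p i < depth t p (i + 1) := by
  rcases T.depth_step hi with ⟨j, hj, -, e⟩ | ⟨j, hj, -, e⟩
  · have := T.p_pos j hj; omega
  · have := T.q_pos j hj; omega

theorem depth_mono (T : NestTimes g V n t p q δ) {a b : ℕ} (hab : a ≤ b) (hb : b ≤ 2 * n + 1) :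
    depth t p a ≤ depth t p b := by
  induction b, hab using Nat.le_induction with
  | base => exact le_rfl
  | succ b hab ih => exact (ih (by omega)).trans (T.depth_lt (by omega)).le

theorem mem_step (T : NestTimes g V n t p q δ) {i : ℕ} (hi : i ≤ 2 * n) :
    g.toFun^[depth t p (i + 1) - depth t p i] 0 ∈ g.pullback (depth t p i) V 0 := by
  rcases T.depth_step hi with ⟨j, hj, rfl, e⟩ | ⟨j, hj, rfl, e⟩
  · rw [e, add_tsub_cancel_right, depth_even]; exact T.mem_p j hj
  · rw [e, add_tsub_cancel_right, depth_odd]; exact T.mem_q j hj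

/-- The critical orbit of `E^b` reaches `E^a`. -/
theorem iterate_mem (T : NestTimes g V n t p q δ) (hg : g.IsGPL V) {a b : ℕ} (hab : a ≤ b)
    (hb : b ≤ 2 * n + 1) :
    g.toFun^[depth t p b - depth t p a] 0 ∈ g.pullback (depth t p a) V 0 := by
  induction b, hab using Nat.le_induction with
  | base =>
    rw [tsub_self]
    refine mem_pullback_self (hg.preimage_anti ?_ (T.zero_mem n le_rfl))
    rw [← depth_odd]; exact T.depth_mono hb (by omega)
  | succ b hab ih =>
    have h1 := T.depth_mono hab (by omega)
    have h2 := T.depth_lt (i := b) (by omega)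
    have h3 := T.mem_step (i := b) (by omega)
    rw [show depth t p b = depth t p b - depth t p a + depth t p a by omega] at h3
    have h4 := hg.iterate_mem_pullback h3
    rw [pullback_eq_of_mem (ih (by omega)), ← Function.iterate_add_apply] at h4
    convert h4 using 2
    omega

theorem zero_mem_depth (T : NestTimes g V n t p q δ) (hg : g.IsGPL V) {i : ℕ}
    (hi : i ≤ 2 * n + 1) : (0 : ℂ) ∈ g.preimage (depth t p i) V := by
  refine hg.preimage_anti ?_ (T.zero_mem n le_rfl)
  rw [← depth_odd]; exact T.depth_mono hi le_rfl

theorem nestE_eq (T : NestTimes g V n t p q δ) {i : ℕ} (hi : i ≤ 2 * n + 1) :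
    g.nestE V i = g.pullback (depth t p i) V 0 := by
  rcases Nat.even_or_odd' i with ⟨j, rfl | rfl⟩
  · rw [depth_even, nestE, if_pos (by omega), show 2 * j / 2 = j by omega, T.nestV j (by omega)]
  · rw [depth_odd, nestE, if_neg (by omega), show (2 * j + 1) / 2 = j by omega,
      T.nestW j (by omega)]

theorem hatE_eq (T : NestTimes g V n t p q δ) {i : ℕ} (h1 : 1 ≤ i) (hi : i ≤ 2 * n + 1) :
    g.hatE V i = g.pullback (hatDepth t δ i) V 0 := by
  rcases Nat.even_or_odd' i with ⟨j, rfl | rfl⟩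
  · obtain ⟨j, rfl⟩ : ∃ r, j = r + 1 := ⟨j - 1, by omega⟩
    rw [show 2 * (j + 1) = 2 * j + 2 by ring, hatDepth_even, hatE, if_pos (by omega),
      show (2 * j + 2) / 2 - 1 = j by omega, T.apartment j (by omega)]
  · rw [hatDepth_odd, hatE, if_neg (by omega), show (2 * j + 1) / 2 = j by omega,
      T.nestV j (by omega)]

theorem hatDepth_le (T : NestTimes g V n t p q δ) {i : ℕ} (h1 : 1 ≤ i) (hi : i ≤ 2 * n + 1) :
    hatDepth t δ i ≤ depth t p i := by
  rcases Nat.even_or_odd' i with ⟨j, rfl | rfl⟩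
  · obtain ⟨j, rfl⟩ : ∃ r, j = r + 1 := ⟨j - 1, by omega⟩
    rw [depth_even, show 2 * (j + 1) = 2 * j + 2 by ring, hatDepth_even, T.t_succ j (by omega)]
    have := T.δ_le j (by omega)
    omega
  · rw [hatDepth_odd, depth_odd]; omega

theorem le_hatDepth (T : NestTimes g V n t p q δ) {i j : ℕ} (hj : 2 * j + 2 ≤ i)
    (hi : i ≤ 2 * n + 1) : t j ≤ hatDepth t δ i := by
  rcases Nat.even_or_odd' i with ⟨r, rfl | rfl⟩
  · obtain ⟨r, rfl⟩ : ∃ r', r = r' + 1 := ⟨r - 1, by omega⟩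
    have h1 := T.depth_mono (a := 2 * j) (b := 2 * r) (by omega) (by omega)
    have h2 := T.le_δ r (by omega)
    rw [depth_even, depth_even] at h1
    rw [show 2 * (r + 1) = 2 * r + 2 by ring, hatDepth_even]
    omega
  · have h1 := T.depth_mono (a := 2 * j) (b := 2 * r) (by omega) (by omega)
    rw [depth_even, depth_even] at h1
    rwa [hatDepth_odd]

/-- The pullback of the enlargement of `E^a` along `E^b → E^a` is contained in the enlargement of
`E^b`. -/
theorem hatDepth_le_add (T : NestTimes g V n t p q δ) {a b : ℕ} (ha : 1 ≤ a) (hab : a ≤ b)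
    (hb : b ≤ 2 * n + 1) :
    hatDepth t δ b ≤ depth t p b - depth t p a + hatDepth t δ a := by
  induction b, hab using Nat.le_induction with
  | base => omega
  | succ b hab ih =>
    have h1 := T.depth_mono hab (by omega)
    have h2 := T.depth_lt (i := b) (by omega)
    refine le_trans ?_ (show depth t p (b + 1) - depth t p b + hatDepth t δ b ≤ _ by
      have := ih (by omega); omega)
    rcases T.depth_step (i := b) (by omega) with ⟨j, hj, rfl, e⟩ | ⟨j, hj, rfl, e⟩
    · obtain ⟨j, rfl⟩ : ∃ r, j = r + 1 := ⟨j - 1, by omega⟩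
      rw [e, add_tsub_cancel_right, hatDepth_odd, show 2 * (j + 1) = 2 * j + 2 by ring,
        hatDepth_even, T.t_succ j (by omega)]
      exact add_le_add (T.q_le_p j (by omega)) (T.le_δ j (by omega))
    · rw [e, add_tsub_cancel_right, hatDepth_odd, show 2 * j + 1 + 1 = 2 * j + 2 by ring,
        hatDepth_even]
      exact T.δ_le j hj

theorem noHits_step (T : NestTimes g V n t p q δ) (hg : g.IsGPL V) {i l : ℕ} (hi : i ≤ 2 * n)
    (hl : 0 < l) (hl' : l < depth t p (i + 1) - depth t p i) :
    ¬ g.Hits V (depth t p (i + 1)) 0 l := by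
  rcases T.depth_step hi with ⟨j, hj, rfl, e⟩ | ⟨j, hj, rfl, e⟩
  · rw [e, add_tsub_cancel_right] at hl'
    rw [e, depth_even]
    exact T.noHits_p j hj l hl hl'
  · rw [e, add_tsub_cancel_right] at hl'
    rw [e, depth_odd]
    exact fun h => T.noHits_q j hj l hl hl' (hg.hits_anti (by omega) h)

theorem noHits_hat_step (T : NestTimes g V n t p q δ) {i l : ℕ} (h1 : 1 ≤ i)
    (hi : i ≤ 2 * n) (hl : 0 < l) (hl' : l < depth t p (i + 1) - depth t p i) :
    ¬ g.Hits V (depth t p (i + 1) - depth t p i + hatDepth t δ i) 0 l := by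
  rcases T.depth_step hi with ⟨j, hj, rfl, e⟩ | ⟨j, hj, rfl, e⟩
  · rw [e, add_tsub_cancel_right] at hl' ⊢
    obtain ⟨j, rfl⟩ : ∃ r, j = r + 1 := ⟨j - 1, by omega⟩
    rw [show 2 * (j + 1) = 2 * j + 2 by ring, hatDepth_even]
    exact T.noHits_δ j (by omega) l hl hl'
  · rw [e, add_tsub_cancel_right] at hl' ⊢
    rw [hatDepth_odd]
    exact T.noHits_q j hj l hl hl'

/-- Every moment of the orbit `E^b → E^a` lies in one of the steps `E^{i+1} → E^i`. -/
theorem exists_step {a b l : ℕ} (hab : a ≤ b) (hl : l < depth t p b - depth t p a) :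
    ∃ i, a ≤ i ∧ i < b ∧ depth t p b - depth t p (i + 1) ≤ l ∧
      l < depth t p b - depth t p i := by
  induction hab using Nat.decreasingInduction with
  | self => omega
  | of_succ a hab ih =>
    by_cases h : l < depth t p b - depth t p (a + 1)
    · obtain ⟨i, h1, h2⟩ := ih h
      exact ⟨i, by omega, h2⟩
    · exact ⟨a, le_rfl, by omega, by omega, hl⟩

/-- The pullback of `V` along `E^b → V` covers the critical point only at the moments when the orbit
passes through the domains `E^i`. -/
theorem eq_of_hits (T : NestTimes g V n t p q δ) (hg : g.IsGPL V) {b l : ℕ} (hb : b ≤ 2 * n + 1)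
    (hl : l < depth t p b) (hit : g.Hits V (depth t p b) 0 l) :
    ∃ i, 1 ≤ i ∧ i ≤ b ∧ l = depth t p b - depth t p i := by
  obtain ⟨i, hi0, hib, h1, h2⟩ := exists_step (t := t) (p := p) (a := 0) (b := b) (l := l)
    (by omega) (by rw [T.depth_zero]; omega)
  refine ⟨i + 1, by omega, hib, ?_⟩
  by_contra hne
  have hm := T.depth_mono (show i + 1 ≤ b by omega) hb
  have hm' := T.depth_lt (i := i) (by omega)
  have hc := T.iterate_mem hg (show i + 1 ≤ b by omega) hb
  refine T.noHits_step hg (i := i) (l := l - (depth t p b - depth t p (i + 1))) (by omega)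
    (by omega) (by omega) ?_
  rw [← hg.hits_congr hc le_rfl (by omega), hits_add]
  convert hit using 1 <;> omega

/-- The pullback of the enlargement of `E^a` along `E^b → E^a` covers the critical point only at the
moments when the orbit passes through the domains `E^i`. -/
theorem eq_of_hits_hat (T : NestTimes g V n t p q δ) (hg : g.IsGPL V) {a b l : ℕ} (ha : 1 ≤ a)
    (hab : a ≤ b) (hb : b ≤ 2 * n + 1) (hl : l < depth t p b - depth t p a)
    (hit : g.Hits V (depth t p b - depth t p a + hatDepth t δ a) 0 l) :
    ∃ i, a < i ∧ i ≤ b ∧ l = depth t p b - depth t p i := by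
  obtain ⟨i, hi0, hib, h1, h2⟩ := exists_step hab hl
  refine ⟨i + 1, by omega, hib, ?_⟩
  by_contra hne
  have hm := T.depth_mono (show i + 1 ≤ b by omega) hb
  have hm' := T.depth_lt (i := i) (by omega)
  have hm'' := T.depth_mono hi0 (by omega)
  have hc := T.iterate_mem hg (show i + 1 ≤ b by omega) hb
  have hh := T.hatDepth_le_add ha hi0 (by omega)
  have hh' := T.hatDepth_le ha (show a ≤ 2 * n + 1 by omega)
  refine T.noHits_hat_step (i := i) (l := l - (depth t p b - depth t p (i + 1))) (by omega)
    (by omega) (by omega) (by omega) ?_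
  refine hg.hits_anti (b := depth t p (i + 1) - depth t p a + hatDepth t δ a) (by omega) ?_
  rw [← hg.hits_congr hc (by omega) (by omega), hits_add]
  convert hit using 1 <;> omega

end NestTimes

/-- The time between two puzzle pieces around the critical point. -/
theorem IsGPL.time_pullback (hg : g.IsGPL V) {a b : ℕ} (hba : b ≤ a)
    (h0 : (0 : ℂ) ∈ g.preimage a V) (hc : g.toFun^[a - b] 0 ∈ g.pullback b V 0) :
    g.time (g.pullback a V 0) (g.pullback b V 0) = a - b := by
  have hmem : a - b ∈ {l | g.pullback a V 0 ⊆ g.iterDom l ∧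
      g.toFun^[l] '' g.pullback a V 0 = g.pullback b V 0} := by
    have e : a = a - b + b := by omega
    have h0' := h0
    rw [e] at h0'
    constructor
    · conv_lhs => rw [e]
      exact fun w hw => (mem_preimage_add.1 (pullback_subset _ _ _ _ hw)).1
    · conv_lhs => rw [show g.pullback a V 0 = g.pullback (a - b + b) V 0 by rw [← e]]
      rw [hg.image_iterate h0', pullback_eq_of_mem hc]
  refine le_antisymm (Nat.sInf_le hmem) (le_csInf ⟨_, hmem⟩ fun l hl => ?_)
  have hla : l ≤ a := by
    by_contra hlt
    exact hg.not_pullback_subset_iterDom h0 (not_le.1 hlt) hl.1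
  obtain ⟨s, rfl⟩ := Nat.exists_eq_add_of_le hla
  have h1 := hl.2
  rw [hg.image_iterate h0] at h1
  have := hg.depth_eq (mem_preimage_add.1 h0).2 h1
  omega

end PlaneMap

/-! ### Conformal invariance of the modulus -/

theorem connectedComponentIn_image_of_leftInvOn {f ψ : ℂ → ℂ} {S S' : Set ℂ} {a : ℂ}
    (hf : ContinuousOn f S) (hψ : ContinuousOn ψ S') (hfS : MapsTo f S S') (hψS : MapsTo ψ S' S)
    (h1 : LeftInvOn ψ f S) (h2 : LeftInvOn f ψ S') (ha : a ∈ S) :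
    connectedComponentIn S' (f a) = f '' connectedComponentIn S a := by
  refine Subset.antisymm (fun y hy => ?_) ?_
  · have hyS := connectedComponentIn_subset _ _ hy
    refine ⟨ψ y, ?_, h2 hyS⟩
    have hc : IsPreconnected (ψ '' connectedComponentIn S' (f a)) :=
      isPreconnected_connectedComponentIn.image _ (hψ.mono (connectedComponentIn_subset _ _))
    refine hc.subset_connectedComponentIn ⟨f a, mem_connectedComponentIn (hfS ha), h1 ha⟩ ?_
      (mem_image_of_mem _ hy)
    rintro _ ⟨z, hz, rfl⟩
    exact hψS (connectedComponentIn_subset _ _ hz)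
  · refine (isPreconnected_connectedComponentIn.image _
      (hf.mono (connectedComponentIn_subset _ _))).subset_connectedComponentIn
      ⟨a, mem_connectedComponentIn ha, rfl⟩ ?_
    rintro _ ⟨z, hz, rfl⟩
    exact hfS (connectedComponentIn_subset _ _ hz)

theorem annulusModulus_le_of_conformal {f ψ : ℂ → ℂ} {U U' K K' : Set ℂ}
    (hf : DifferentiableOn ℂ f U) (hψ : ContinuousOn ψ U') (hfU : MapsTo f U U')
    (hψU : MapsTo ψ U' U) (h1 : LeftInvOn ψ f U) (h2 : LeftInvOn f ψ U') (hK : K ⊆ U)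
    (hK' : f '' K = K') : annulusModulus U K ≤ annulusModulus U' K' := by
  refine iSup_le fun r => iSup_le fun φ => iSup_le fun hr => iSup_le fun hd => iSup_le fun hi =>
    iSup_le fun hm => iSup_le fun hc => ?_
  have hφU : MapsTo φ (roundAnnulus r) U := fun z hz => (hm hz).1
  have hinj : InjOn f U := h1.injOn
  refine le_iSup_of_le r (le_iSup_of_le (f ∘ φ) (le_iSup_of_le hr (le_iSup_of_le
    (hf.comp hd hφU) (le_iSup_of_le (hinj.comp hi hφU) (le_iSup_of_le (fun z hz =>
      ⟨hfU (hφU hz), ?_⟩) (le_iSup_of_le (fun b hb => ?_) le_rfl))))))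
  · rw [← hK']
    rintro ⟨w, hw, e⟩
    exact (hm hz).2 (hinj (hK hw) (hφU hz) e ▸ hw)
  · obtain ⟨a, ha, rfl⟩ := hK'.symm ▸ hb
    have haS : a ∈ U \ φ '' roundAnnulus r := ⟨hK ha, by
      rintro ⟨z, hz, rfl⟩
      exact (hm hz).2 ha⟩
    have hcc := connectedComponentIn_image_of_leftInvOn (f := f) (ψ := ψ)
      (S := U \ φ '' roundAnnulus r) (S' := U' \ (f ∘ φ) '' roundAnnulus r)
      (hf.continuousOn.mono sdiff_subset) (hψ.mono sdiff_subset) ?_ ?_ (h1.mono sdiff_subset)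
      (h2.mono sdiff_subset) haS
    · rw [hcc]
      exact (hc a ha).image_of_continuousOn (hf.continuousOn.mono
        ((connectedComponentIn_subset _ _).trans sdiff_subset))
    · rintro z ⟨hz, hzφ⟩
      refine ⟨hfU hz, ?_⟩
      rintro ⟨w, hw, e⟩
      exact hzφ ⟨w, hw, hinj (hφU hw) hz e⟩
    · rintro z ⟨hz, hzφ⟩
      refine ⟨hψU hz, ?_⟩
      rintro ⟨w, hw, e⟩
      refine hzφ ⟨w, hw, ?_⟩
      rw [Function.comp_apply, e, h2 hz]

/-- The modulus is invariant under conformal isomorphisms. -/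
theorem annulusModulus_eq_of_conformal {f : ℂ → ℂ} {U U' K K' : Set ℂ} (hU : IsOpen U)
    (hf : DifferentiableOn ℂ f U) (hinj : InjOn f U) (hd : ∀ z ∈ U, deriv f z ≠ 0)
    (hU' : f '' U = U') (hK : K ⊆ U) (hK' : f '' K = K') :
    annulusModulus U K = annulusModulus U' K' := by
  subst hU' hK'
  set ψ := Function.invFunOn f U with hψdef
  have h1 : LeftInvOn ψ f U := hinj.leftInvOn_invFunOn
  have h2 : LeftInvOn f ψ (f '' U) := by
    rintro _ ⟨z, hz, rfl⟩
    rw [h1 hz]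
  have hψU : MapsTo ψ (f '' U) U := by
    rintro _ ⟨z, hz, rfl⟩
    rwa [h1 hz]
  have hψd : DifferentiableOn ℂ ψ (f '' U) := by
    rintro _ ⟨z, hz, rfl⟩
    have hdz : HasStrictDerivAt f (deriv f z) z :=
      ((hf.contDiffOn hU).contDiffAt (hU.mem_nhds hz) (n := 1)).hasStrictDerivAt one_ne_zero
    have hmap := hdz.map_nhds_eq (hd z hz)
    have hev : ∀ᶠ y in 𝓝 (f z), y ∈ f '' U := by
      rw [← hmap]
      exact eventually_map.2 (mem_of_superset (hU.mem_nhds hz) fun w hw => mem_image_of_mem f hw)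
    have hcont : ContinuousAt ψ (f z) := by
      rw [ContinuousAt, ← hmap, tendsto_map'_iff, h1 hz]
      refine tendsto_id.congr' ?_
      filter_upwards [hU.mem_nhds hz] with w hw
      exact (h1 hw).symm
    have hdz' : HasDerivAt f (deriv f z) (ψ (f z)) := by rw [h1 hz]; exact hdz.hasDerivAt
    exact (hdz'.of_local_left_inverse hcont (hd z hz)
      (hev.mono fun y hy => h2 hy)).differentiableAt.differentiableWithinAt
  refine le_antisymm (annulusModulus_le_of_conformal hf hψd.continuousOn (mapsTo_image f U) hψU h1
    h2 hK rfl) (annulusModulus_le_of_conformal hψd hf.continuousOn hψU (mapsTo_image f U) h2 h1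
      (image_mono hK) ?_)
  rw [← image_comp]
  refine (image_congr fun z hz => ?_).trans (image_id K)
  exact h1 (hK hz)

namespace PlaneMap

variable {g : PlaneMap} {V : Set ℂ} {d n : ℕ}

/-! ### Visits of the critical orbit to the central domain -/

open Classical in
/-- The number of moments `l`, `0 < l ≤ T`, at which the critical orbit is in the central domain. -/
noncomputable def visits (g : PlaneMap) (T : ℕ) : ℕ :=
  ((Finset.Ioc 0 T).filter fun l => g.toFun^[l] 0 ∈ g.piece 0).card

open Classical in
theorem visits_eq_count (g : PlaneMap) (T : ℕ) :
    g.visits T = Nat.count (fun l => g.toFun^[l + 1] 0 ∈ g.piece 0) T := by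
  rw [Nat.count_eq_card_filter_range, visits]
  refine (Finset.card_bij (fun l _ => l + 1) ?_ ?_ ?_).symm
  · intro l hl
    simp only [Finset.mem_filter, Finset.mem_range, Finset.mem_Ioc] at hl ⊢
    exact ⟨by omega, hl.2⟩
  · intro a _ b _ e
    exact Nat.succ_injective e
  · intro l hl
    simp only [Finset.mem_filter, Finset.mem_range, Finset.mem_Ioc] at hl ⊢
    refine ⟨l - 1, ⟨by omega, ?_⟩, by omega⟩
    rw [Nat.sub_add_cancel hl.1.1]; exact hl.2

theorem visits_mono (g : PlaneMap) {S T : ℕ} (h : S ≤ T) : g.visits S ≤ g.visits T := by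
  classical
  rw [visits_eq_count, visits_eq_count]
  exact Nat.count_monotone _ h

theorem visits_le (g : PlaneMap) (T : ℕ) : g.visits T ≤ T := by
  classical
  rw [visits_eq_count]; exact Nat.count_le _

theorem IsGPL.mem_piece_iff (hg : g.IsGPL V) {a l : ℕ} {z w : ℂ} (hw : w ∈ g.pullback a V z)
    (hl : l < a) : g.toFun^[l] w ∈ g.piece 0 ↔ g.toFun^[l] z ∈ g.piece 0 := by
  rw [show a = l + (a - l) by omega] at hw
  have h1 := hg.pullback_anti (show 1 ≤ a - l by omega) _ (hg.iterate_mem_pullback hw)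
  have h2 := mem_pullback_comm h1
  simp only [← hg.pullback_one] at *
  constructor <;> intro h
  · rwa [pullback_eq_of_mem h] at h2
  · rwa [pullback_eq_of_mem h] at h1

/-- After the critical orbit has come back to the puzzle piece of depth `a`, it repeats its initial
itinerary up to the moment `a - 1`. -/
theorem IsGPL.visits_add (hg : g.IsGPL V) {a s L : ℕ} (hs : g.toFun^[s] 0 ∈ g.pullback a V 0)
    (hL : L < a) : g.visits (s + L) = g.visits s + g.visits L := by
  classical
  rw [visits_eq_count, visits_eq_count, visits_eq_count, Nat.count_add]
  congr 1
  rw [Nat.count_eq_card_filter_range, Nat.count_eq_card_filter_range]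
  congr 1
  refine Finset.filter_congr fun l hl => ?_
  rw [← hg.mem_piece_iff hs (show l + 1 < a by have := Finset.mem_range.1 hl; omega),
    ← Function.iterate_add_apply, show l + 1 + s = s + l + 1 by ring]

/-- A strictly positive moment at which the orbit is in the central domain counts as a visit. -/
theorem one_le_visits {T : ℕ} (hT : 1 ≤ T) (h : g.toFun^[T] 0 ∈ g.piece 0) : 1 ≤ g.visits T := by
  classical
  exact Finset.card_pos.2 ⟨T, by simpa using ⟨hT, h⟩⟩

namespace NestTimes

variable {t p q δ : ℕ → ℕ}

theorem visits_q_succ (T : NestTimes g V n t p q δ) (hg : g.IsGPL V) {j : ℕ} (hj : j + 1 < n) :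
    g.visits (p (j + 1)) + g.visits (q j) ≤ g.visits (q (j + 1)) := by
  have h1 := T.mem_p (j + 1) hj.le
  have h2 := T.t_succ j (by omega)
  have h3 := T.p_pos j (by omega)
  rw [← hg.visits_add h1 (by omega)]
  exact visits_mono g (T.le_q j hj)

/-- The number of visits to the central domain grows exponentially with the level. -/
theorem two_pow_le_visits (T : NestTimes g V n t p q δ) (hg : g.IsGPL V) {j : ℕ} (hj : j < n) :
    2 ^ j ≤ g.visits (q j) := by
  induction j with
  | zero =>
    have h1 := T.mem_q 0 hj
    rw [T.t_zero, T.p_zero, add_zero, hg.pullback_one] at h1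
    exact one_le_visits (T.q_pos 0 hj) h1
  | succ j ih =>
    have h1 := ih (by omega)
    have h2 := T.visits_q_succ hg hj
    have h3 := visits_mono g (T.q_le_p j (by omega))
    rw [pow_succ]
    omega

/-- On the way from `V^{j+1}` to `V` there are at most `3 x` visits, where `x` of them occur before
`W^j` is reached. -/
theorem visits_depth_le (T : NestTimes g V n t p q δ) (hg : g.IsGPL V) {j : ℕ} (hj : j < n) :
    g.visits (t (j + 1) - 1) ≤ 3 * g.visits (q j) := by
  have key : ∀ j < n, g.visits (t (j + 1) - 1) =
      g.visits (q j) + g.visits (p j + t j - 1) := fun j hj => by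
    have h1 := T.t_succ j hj
    have h2 := T.p_pos j hj.le
    rw [show t (j + 1) - 1 = q j + (p j + t j - 1) by omega]
    exact hg.visits_add (T.mem_q j hj) (by omega)
  induction j with
  | zero =>
    have h1 := key 0 hj
    have h2 := T.two_pow_le_visits hg hj
    have h3 := visits_le g (p 0 + t 0 - 1)
    rw [T.t_zero, T.p_zero] at h3
    rw [T.t_zero, T.p_zero] at h1
    simp only [pow_zero] at h2
    omega
  | succ j ih =>
    have h1 := key (j + 1) hj
    have h2 := ih (by omega)
    have h3 := T.visits_q_succ hg hj
    have h4 := visits_mono g (T.q_le_p j (by omega))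
    have h5 := T.t_succ j (by omega)
    have h6 := T.p_pos j (by omega)
    have h7 := T.p_pos (j + 1) (by omega)
    have h8 := hg.visits_add (T.mem_p (j + 1) (by omega)) (show t (j + 1) - 1 < t (j + 1) by omega)
    rw [show p (j + 1) + t (j + 1) - 1 = p (j + 1) + (t (j + 1) - 1) by omega] at h1
    omega

/-- The number of visits during each of the steps `E^{i+1} → E^i`. -/
theorem two_pow_le_visits_step (T : NestTimes g V n t p q δ) (hg : g.IsGPL V) {i j : ℕ}
    (hj : 2 * j + 1 ≤ i) (hi : i ≤ 2 * n) :
    2 ^ j ≤ g.visits (depth t p (i + 1) - depth t p i) := by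
  have mono : ∀ r, j ≤ r → r < n → 2 ^ j ≤ g.visits (q r) := fun r h1 h2 =>
    (Nat.pow_le_pow_right two_pos h1).trans (T.two_pow_le_visits hg h2)
  rcases T.depth_step hi with ⟨r, hr, rfl, e⟩ | ⟨r, hr, rfl, e⟩
  · rw [e, add_tsub_cancel_right]
    obtain ⟨r, rfl⟩ : ∃ r', r = r' + 1 := ⟨r - 1, by omega⟩
    exact (mono r (by omega) (by omega)).trans (visits_mono g (T.q_le_p r (by omega)))
  · rw [e, add_tsub_cancel_right]
    exact mono r (by omega) hr

end NestTimes

end PlaneMap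

namespace PlaneMap

variable {g : PlaneMap} {V : Set ℂ} {d n m : ℕ}

/-! ### The return moments -/

theorem visits_succ (g : PlaneMap) (T : ℕ) [Decidable (g.toFun^[T + 1] 0 ∈ g.piece 0)] :
    g.visits (T + 1) = g.visits T + if g.toFun^[T + 1] 0 ∈ g.piece 0 then 1 else 0 := by
  classical
  rw [visits_eq_count, visits_eq_count, Nat.count_succ]
  congr

theorem IsGPL.preimage_iterate {l a : ℕ} (h0 : (0 : ℂ) ∈ g.preimage a V) (hla : l ≤ a) :
    g.toFun^[l] 0 ∈ g.preimage (a - l) V := by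
  rw [show a = l + (a - l) by omega] at h0
  exact (mem_preimage_add.1 h0).2

theorem IsUnicriticalGPL.pullback_zero_zero (hg : g.IsUnicriticalGPL V d) :
    g.pullback 0 V 0 = V := hg.toIsGPL.pullback_zero (hg.toIsGPL.dom_subset hg.zero_mem_dom)

namespace NestTimes

variable {t p q δ : ℕ → ℕ}

theorem time_nestV (T : NestTimes g V n t p q δ) (hg : g.IsUnicriticalGPL V d) :
    g.time (g.nestV V n) V = t n := by
  have h1 := T.iterate_mem hg.toIsGPL (a := 0) (b := 2 * n) (by omega) (by omega)
  have h2 := T.zero_mem_depth hg.toIsGPL (i := 2 * n) (by omega)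
  rw [T.depth_zero, depth_even] at h1
  rw [depth_even] at h2
  have h3 := hg.toIsGPL.time_pullback (Nat.zero_le _) h2 h1
  rwa [hg.pullback_zero_zero, ← T.nestV n le_rfl] at h3

theorem nestW_eq (T : NestTimes g V n t p q δ) :
    g.nestW V n = g.pullback (depth t p (2 * n + 1)) V 0 := by
  rw [depth_odd, T.nestW n le_rfl]

theorem time_nestW (T : NestTimes g V n t p q δ) (hg : g.IsGPL V) {i : ℕ} (hi : i ≤ 2 * n + 1) :
    g.time (g.nestW V n) (g.nestE V i) = depth t p (2 * n + 1) - depth t p i := by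
  rw [T.nestW_eq, T.nestE_eq hi]
  exact hg.time_pullback (T.depth_mono hi le_rfl) (T.zero_mem_depth hg le_rfl)
    (T.iterate_mem hg hi le_rfl)

theorem nestW_zero (T : NestTimes g V n t p q δ) (hg : g.IsGPL V) : g.nestW V 0 = g.piece 0 := by
  rw [T.nestW 0 (Nat.zero_le _), T.p_zero, T.t_zero, hg.pullback_one]

theorem isReturnMoment_iff (T : NestTimes g V n t p q δ) (hg : g.IsUnicriticalGPL V d) {l : ℕ} :
    g.IsReturnMoment V n l ↔
      t n ≤ l ∧ l < depth t p (2 * n + 1) ∧ g.toFun^[l] 0 ∈ g.piece 0 := by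
  have hg' := hg.toIsGPL
  have h0 := T.zero_mem_depth hg' (i := 2 * n + 1) le_rfl
  rw [IsReturnMoment, T.time_nestV hg, T.nestW_zero hg', T.nestW_eq]
  refine and_congr_right fun _ => ⟨?_, ?_⟩
  · rintro ⟨h1, h2⟩
    have hle : l ≤ depth t p (2 * n + 1) := by
      by_contra hlt
      exact hg'.not_pullback_subset_iterDom h0 (not_le.1 hlt) h1
    have hpre := IsGPL.preimage_iterate h0 hle
    have hmem : g.toFun^[l] 0 ∈ g.toFun^[l] '' g.pullback (depth t p (2 * n + 1)) V 0 :=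
      mem_image_of_mem _ (mem_pullback_self h0)
    have e : depth t p (2 * n + 1) = l + (depth t p (2 * n + 1) - l) := by omega
    rw [e] at h0 h2
    rw [hg'.image_iterate h0, ← hg'.pullback_one] at h2
    refine ⟨?_, h2 (mem_pullback_self hpre) |> (hg'.pullback_one 0 ▸ ·)⟩
    have := hg'.depth_le_of_pullback_subset hpre h2
    omega
  · rintro ⟨hlt, hc⟩
    have e : depth t p (2 * n + 1) = l + (depth t p (2 * n + 1) - l) := by omega
    rw [e] at h0 ⊢
    refine ⟨fun w hw => (mem_preimage_add.1 (pullback_subset _ _ _ _ hw)).1, ?_⟩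
    rw [hg'.image_iterate h0]
    rw [← hg'.pullback_one] at hc ⊢
    rw [← pullback_eq_of_mem hc]
    exact hg'.pullback_anti (by omega) _

open Classical in
/-- Counting return moments amounts to counting visits after the moment when `V^n` reaches `V`. -/
theorem count_isReturnMoment (T : NestTimes g V n t p q δ) (hg : g.IsUnicriticalGPL V d)
    (ht : 1 ≤ t n) {b : ℕ} (h1 : t n - 1 ≤ b) (h2 : b < depth t p (2 * n + 1)) :
    Nat.count (g.IsReturnMoment V n) (b + 1) + g.visits (t n - 1) = g.visits b := by
  induction b, h1 using Nat.le_induction with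
  | base =>
    rw [Nat.sub_add_cancel ht, Nat.count_eq_card_filter_range, Finset.filter_eq_empty_iff.2]
    · simp
    · intro l hl hP
      exact absurd ((T.isReturnMoment_iff hg).1 hP).1 (by simpa using hl)
  | succ b hb ih =>
    rw [Nat.count_succ, visits_succ, ← ih (by omega)]
    have : g.IsReturnMoment V n (b + 1) ↔ g.toFun^[b + 1] 0 ∈ g.piece 0 := by
      rw [T.isReturnMoment_iff hg]
      exact ⟨fun h => h.2.2, fun h => ⟨by omega, h2, h⟩⟩
    simp only [this]
    ring

/-- The visits up to the moment when `W^n` reaches `E^i`, in terms of the two ways to split the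
orbit `W^n → V`: at `E^i` and at `V^n`. -/
theorem visits_range (T : NestTimes g V n t p q δ) (hg : g.IsGPL V) (ht : 1 ≤ t n) {i : ℕ}
    (hi : i ≤ 2 * n + 1) (h1 : 1 ≤ depth t p i) :
    g.visits (depth t p (2 * n + 1) - depth t p i) + g.visits (depth t p i - 1) =
      g.visits (p n) + g.visits (t n - 1) := by
  have h2 := T.depth_mono hi le_rfl
  rw [← hg.visits_add (T.iterate_mem hg hi le_rfl) (show depth t p i - 1 < depth t p i by omega),
    ← hg.visits_add (T.mem_p n le_rfl) (show t n - 1 < t n by omega)]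
  rw [depth_odd] at *
  congr 1
  omega

open Classical in
/-- There are more than `m` return moments by the moment when the orbit reaches `V^{n-2}`. -/
theorem lt_count_isReturnMoment (T : NestTimes g V n t p q δ)
    (hg : g.IsUnicriticalGPL V d) (hn : 3 ≤ n) (hm : m < 2 ^ (n - 3)) :
    m < Nat.count (g.IsReturnMoment V n)
      (depth t p (2 * n + 1) - depth t p (2 * (n - 2)) + 1) := by
  have hg' := hg.toIsGPL
  obtain ⟨k, rfl⟩ : ∃ k, n = k + 3 := ⟨n - 3, by omega⟩
  simp only [Nat.add_sub_cancel, show k + 3 - 2 = k + 1 by omega] at hm ⊢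
  have ht : ∀ j ≤ k + 3, 1 ≤ j → 1 ≤ t j := fun j hj h1 => by
    obtain ⟨j, rfl⟩ : ∃ r, j = r + 1 := ⟨j - 1, by omega⟩
    have := T.t_succ j (by omega)
    have := T.q_pos j (by omega)
    omega
  have h1 := T.visits_range hg' (ht _ le_rfl (by omega)) (i := 2 * (k + 1)) (by omega)
    (by rw [depth_even]; exact ht _ (by omega) (by omega))
  have h2 := T.visits_depth_le hg' (j := k) (by omega)
  have h3 := T.two_pow_le_visits hg' (j := k) (by omega)
  have h4 := T.visits_q_succ hg' (j := k) (by omega)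
  have h5 := T.visits_q_succ hg' (j := k + 1) (by omega)
  have h6 := visits_mono g (T.q_le_p k (by omega))
  have h7 := visits_mono g (T.q_le_p (k + 1) (by omega))
  have h8 : g.visits (q (k + 1 + 1)) ≤ g.visits (p (k + 3)) :=
    visits_mono g (T.q_le_p (k + 2) (by omega))
  have h9 := ht _ (show k + 1 ≤ k + 3 by omega) (by omega)
  have h10 := T.depth_mono (show 2 * (k + 1) ≤ 2 * (k + 3) + 1 by omega) le_rfl
  rw [depth_even] at h1 h10 ⊢
  have h11 : t (k + 3) - 1 ≤ depth t p (2 * (k + 3) + 1) - t (k + 1) := by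
    by_contra hlt
    have := visits_mono g (not_le.1 hlt).le
    omega
  have h12 := T.count_isReturnMoment hg (ht _ le_rfl (by omega)) h11 (by omega)
  omega

/-- The first `m + 1` return moments: they exist, the critical orbit has not yet gone past
`V^{n-2}`, and they exhaust the visits of the critical orbit to the central domain since it has reached `V`. -/
theorem moment_spec (T : NestTimes g V n t p q δ) (hg : g.IsUnicriticalGPL V d)
    (hn : 3 ≤ n) (hm : m < 2 ^ (n - 3)) {k : ℕ} (hk : k ≤ m) :
    g.IsReturnMoment V n (g.moment V n k) ∧
      g.moment V n k ≤ depth t p (2 * n + 1) - depth t p (2 * (n - 2)) ∧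
      g.visits (g.moment V n k) = g.visits (t n - 1) + (k + 1) ∧
      (∀ k' < k, g.moment V n k' < g.moment V n k) ∧
      ∀ S : Finset ℕ, (∀ l ∈ S, g.IsReturnMoment V n l ∧ l < g.moment V n k) → S.card ≤ k := by
  classical
  have hc := T.lt_count_isReturnMoment hg hn hm
  have hcard : ∀ hf : (Set.ofPred (g.IsReturnMoment V n)).Finite, k < hf.toFinset.card :=
    fun hf => (hk.trans_lt hc).trans_le (Nat.count_le_card hf _)
  have h1 : g.IsReturnMoment V n (g.moment V n k) := Nat.nth_mem k hcard
  have h2 := Nat.nth_lt_of_lt_count (hk.trans_lt hc)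
  have h3 := (T.isReturnMoment_iff hg).1 h1
  have ht : 1 ≤ t n := by
    obtain ⟨j, rfl⟩ : ∃ r, n = r + 1 := ⟨n - 1, by omega⟩
    have := T.t_succ j (by omega)
    have := T.q_pos j (by omega)
    omega
  refine ⟨h1, Nat.lt_succ_iff.1 h2, ?_, fun k' hk' => Nat.nth_lt_nth' hk' hcard,
    fun S hS => ?_⟩
  · have h4 := T.count_isReturnMoment hg ht (b := g.moment V n k) (by omega) h3.2.1
    rw [moment, Nat.count_nth_succ hcard] at h4
    rw [← moment] at h4
    omega
  · have h5 := Nat.count_nth hcard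
    rw [Nat.count_eq_card_filter_range] at h5
    refine le_trans (Finset.card_le_card fun l hl => ?_) h5.le
    simpa [moment] using (hS l hl).symm

theorem mem_orbitPiece (T : NestTimes g V n t p q δ) (hg : g.IsGPL V) {i k : ℕ}
    (hi : i ≤ 2 * n + 1) :
    k ∈ g.orbitPiece V m n i ↔ k ≤ m ∧
      depth t p (2 * n + 1) - depth t p i < g.moment V n k ∧
      g.moment V n k ≤ depth t p (2 * n + 1) - depth t p (i - 1) := by
  rw [orbitPiece, Finset.mem_filter, T.time_nestW hg hi, T.time_nestW hg (by omega),
    Finset.mem_range, Nat.lt_succ_iff]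

/-- Each step `E^i → E^{i-1}` in question contains more than `m` visits, so the return moments meet
at most two of them. -/
theorem exists_large_orbitPiece (T : NestTimes g V n t p q δ) (hg : g.IsUnicriticalGPL V d)
    (hn : 3 ≤ n) (hm : m < 2 ^ (n - 3)) :
    ∃ i ∈ Finset.Icc (2 * n - 3) (2 * n + 1),
      (m : ℝ) / 2 ≤ ((g.orbitPiece V m n i).card : ℝ) := by
  have hg' := hg.toIsGPL
  set D := depth t p (2 * n + 1) with hD
  have hpos : ∀ k ≤ m, 1 ≤ g.moment V n k := fun k hk => by
    have h1 := ((T.isReturnMoment_iff hg).1 (T.moment_spec hg hn hm hk).1).1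
    obtain ⟨j, rfl⟩ : ∃ r, n = r + 1 := ⟨n - 1, by omega⟩
    have := T.t_succ j (by omega)
    have := T.q_pos j (by omega)
    omega
  have hle := fun k (hk : k ≤ m) => (T.moment_spec hg hn hm hk).2.1
  have hmono : ∀ k ≤ m, ∀ k' ≤ k, g.moment V n k' ≤ g.moment V n k := fun k hk k' hk' => by
    rcases hk'.eq_or_lt with rfl | h
    · exact le_rfl
    · exact ((T.moment_spec hg hn hm hk).2.2.2.1 k' h).le
  obtain ⟨a, ha1, ha2, ha3, ha4⟩ := exists_step (t := t) (p := p) (a := 2 * (n - 2))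
    (b := 2 * n + 1) (l := g.moment V n 0 - 1) (by omega) (by
      have := hpos 0 (by omega)
      have := hle 0 (by omega)
      omega)
  have h0 := hpos 0 (by omega)
  by_cases ha : a = 2 * (n - 2)
  · refine ⟨a + 1, Finset.mem_Icc.2 ⟨by omega, by omega⟩, ?_⟩
    have hsub : Finset.range (m + 1) ⊆ g.orbitPiece V m n (a + 1) := fun k hk => by
      have hk' : k ≤ m := by simpa [Nat.lt_succ_iff] using hk
      rw [T.mem_orbitPiece hg' (by omega), add_tsub_cancel_right]
      have := hmono k hk' 0 (by omega)
      refine ⟨hk', by omega, ?_⟩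
      rw [ha]; exact hle k hk'
    have := Finset.card_le_card hsub
    rw [Finset.card_range] at this
    have h' : (m : ℝ) + 1 ≤ ((g.orbitPiece V m n (a + 1)).card : ℝ) := by exact_mod_cast this
    have : (0 : ℝ) ≤ m := Nat.cast_nonneg m
    linarith
  · have hlast : g.moment V n m ≤ D - depth t p (a - 1) := by
      by_contra hlt
      have e1 := (T.moment_spec hg hn hm (k := 0) (by omega)).2.2.1
      have e2 := (T.moment_spec hg hn hm (k := m) le_rfl).2.2.1
      have e3 := visits_mono g (not_le.1 hlt).le
      have e4 := visits_mono g (show g.moment V n 0 ≤ D - depth t p a by omega)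
      have e5 := T.two_pow_le_visits_step hg' (i := a - 1) (j := n - 3) (by omega) (by omega)
      rw [show a - 1 + 1 = a by omega] at e5
      have e6 := T.depth_lt (i := a - 1) (by omega)
      rw [show a - 1 + 1 = a by omega] at e6
      have e7 := T.depth_mono (show a ≤ 2 * n + 1 by omega) le_rfl
      have e8 : 1 ≤ depth t p (a - 1) := by
        have := T.depth_mono (show 1 ≤ a - 1 by omega) (by omega)
        have := T.depth_lt (i := 0) (by omega)
        simp only [zero_add] at this
        omega
      have e9 := hg'.visits_add (T.iterate_mem hg' (show a ≤ 2 * n + 1 by omega) le_rfl)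
        (show depth t p a - depth t p (a - 1) < depth t p a by omega)
      rw [show depth t p (2 * n + 1) - depth t p a + (depth t p a - depth t p (a - 1)) =
        D - depth t p (a - 1) by omega, ← hD] at e9
      omega
    have hsub : Finset.range (m + 1) ⊆ g.orbitPiece V m n (a + 1) ∪ g.orbitPiece V m n a :=
      fun k hk => by
        have hk' : k ≤ m := by simpa [Nat.lt_succ_iff] using hk
        rw [Finset.mem_union, T.mem_orbitPiece hg' (by omega), T.mem_orbitPiece hg' (by omega),
          add_tsub_cancel_right]
        have := hmono k hk' 0 (by omega)
        have := hmono m le_rfl k hk'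
        by_cases hka : g.moment V n k ≤ D - depth t p a
        · exact Or.inl ⟨hk', by omega, hka⟩
        · exact Or.inr ⟨hk', by omega, by omega⟩
    have hcard := (Finset.card_le_card hsub).trans (Finset.card_union_le _ _)
    rw [Finset.card_range] at hcard
    have hcard' : (m : ℝ) + 1 ≤ ((g.orbitPiece V m n (a + 1)).card : ℝ) +
        ((g.orbitPiece V m n a).card : ℝ) := by exact_mod_cast hcard
    rcases le_total ((g.orbitPiece V m n (a + 1)).card : ℝ) ((g.orbitPiece V m n a).card : ℝ) with
      h | h
    · exact ⟨a, Finset.mem_Icc.2 ⟨by omega, by omega⟩, by linarith⟩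
    · exact ⟨a + 1, Finset.mem_Icc.2 ⟨by omega, by omega⟩, by linarith⟩

/-! ### The buffers -/

theorem bufferF_eq (T : NestTimes g V n t p q δ) (hg : g.IsUnicriticalGPL V d) {i : ℕ}
    (h1 : 2 ≤ i) (hi : i ≤ 2 * n + 1) :
    g.bufferF V n i =
      g.pullback (depth t p (2 * n + 1) - depth t p (i - 1) + hatDepth t δ (i - 1)) V 0 := by
  have hg' := hg.toIsGPL
  rw [bufferF, T.time_nestW hg' (by omega), T.hatE_eq (by omega) (by omega)]
  set s := depth t p (2 * n + 1) - depth t p (i - 1) with hs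
  have hot : g.orbitTime (fun _ => 1) s 0 = s := by simp [orbitTime]
  have hmem := hg'.pullback_anti (T.hatDepth_le (show 1 ≤ i - 1 by omega) (by omega)) 0
    (T.iterate_mem hg' (show i - 1 ≤ 2 * n + 1 by omega) le_rfl)
  have hdom : (0 : ℂ) ∈ g.iterDom s :=
    iterDom_anti (Nat.sub_le _ _) (T.zero_mem_depth hg' le_rfl).1
  have := hg.isLevel_zero.pieced.pullback_eq hg' (k := s) (e := hatDepth t δ (i - 1)) (x := 0)
    (z := 0) (fun _ _ => Nat.zero_le _) ⟨hdom, hmem⟩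
  rwa [hot] at this

theorem lam_eq (T : NestTimes g V n t p q δ) (hg : g.IsGPL V) {k : ℕ}
    (hk : g.moment V n k ≤ depth t p (2 * n + 1)) :
    g.lam V n k = g.pullback (depth t p (2 * n + 1) - g.moment V n k) V
      (g.toFun^[g.moment V n k] 0) := by
  have h0 := T.zero_mem_depth hg (i := 2 * n + 1) le_rfl
  rw [lam, psi, T.nestW_eq]
  obtain ⟨r, hr⟩ := Nat.exists_eq_add_of_le hk
  rw [hr] at h0 ⊢
  rw [hg.image_iterate h0, add_tsub_cancel_left]

theorem lamBuffer_eq (T : NestTimes g V n t p q δ) (hg : g.IsUnicriticalGPL V d) {i k : ℕ}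
    (h1 : 2 ≤ i) (hi : i ≤ 2 * n + 1)
    (hk : g.moment V n k ≤ depth t p (2 * n + 1) - depth t p (i - 1)) :
    g.lamBuffer V n i k = g.pullback (depth t p (2 * n + 1) - depth t p (i - 1) - g.moment V n k +
      hatDepth t δ (i - 1)) V (g.toFun^[g.moment V n k] 0) := by
  have hg' := hg.toIsGPL
  have h2 := T.hatDepth_le (show 1 ≤ i - 1 by omega) (by omega)
  have h3 := T.depth_mono (show i - 1 ≤ 2 * n + 1 by omega) le_rfl
  have h0 := hg'.preimage_anti (show depth t p (2 * n + 1) - depth t p (i - 1) +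
    hatDepth t δ (i - 1) ≤ _ by omega) (T.zero_mem_depth hg' (i := 2 * n + 1) le_rfl)
  rw [lamBuffer, psi, T.bufferF_eq hg h1 hi]
  obtain ⟨r, hr⟩ := Nat.exists_eq_add_of_le hk
  rw [hr, add_assoc] at h0
  rw [hr, add_assoc, hg'.image_iterate h0, add_tsub_cancel_left]

theorem coveringDegree_iterate_le (hg : g.IsUnicriticalGPL V d) {s r N : ℕ} {z : ℂ}
    (hz : z ∈ g.preimage (s + r) V) (B : Set ℂ) (S : Finset ℕ) (hS : S.card ≤ N)
    (h : ∀ l < s, g.Hits V (s + r) z l → l ∈ S) :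
    coveringDegree g.toFun^[s] (g.pullback (s + r) V z) B ≤ (d : ℕ∞) ^ N := by
  classical
  refine iSup₂_le fun w _ => (hg.encard_fibre_iterate hz w).trans ?_
  have hsub : ((Finset.range s).filter fun l => g.Hits V (s + r) z l) ⊆ S := fun l hl => by
    simp only [Finset.mem_filter, Finset.mem_range] at hl
    exact h l hl.1 hl.2
  have hle : d ^ ((Finset.range s).filter fun l => g.Hits V (s + r) z l).card ≤ d ^ N :=
    Nat.pow_le_pow_right (Nat.pos_of_ne_zero hg.degree_ne_zero)
      ((Finset.card_le_card hsub).trans hS)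
  rw [← Nat.cast_pow]
  exact Nat.cast_le.2 hle

/-- The critical point is covered by the orbit of `Υ` when it passes through the domains `E^i` on
the way from `V^n` to `V`, and at return moments. -/
theorem coveringDegree_upsilon_le (T : NestTimes g V n t p q δ) (hg : g.IsUnicriticalGPL V d)
    (hn : 3 ≤ n) (hm : m < 2 ^ (n - 3)) {k : ℕ} (hk : k ≤ m) :
    coveringDegree (g.psi V n k) (g.upsilon V n k) V ≤ (d : ℕ∞) ^ (2 * n + m) := by
  classical
  have hg' := hg.toIsGPL
  obtain ⟨h1, -, -, -, h5⟩ := T.moment_spec hg hn hm hk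
  obtain ⟨hl1, hl2, -⟩ := (T.isReturnMoment_iff hg).1 h1
  have h0 := hg'.preimage_anti hl2.le (T.zero_mem_depth hg' (i := 2 * n + 1) le_rfl)
  set S₁ := (Finset.Icc 1 (2 * n)).image fun i => t n - depth t p i with hS₁
  set S₂ := (Finset.range (g.moment V n k)).filter fun l => g.IsReturnMoment V n l with hS₂
  have hc2 : S₂.card ≤ k := h5 S₂ fun l hl => by
    simp only [hS₂, Finset.mem_filter, Finset.mem_range] at hl
    exact hl.symm
  have hc1 : S₁.card ≤ 2 * n := by
    refine Finset.card_image_le.trans ?_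
    simp
  refine coveringDegree_iterate_le (s := g.moment V n k) (r := 0) hg h0 V (S₁ ∪ S₂)
    ((Finset.card_union_le _ _).trans (by omega)) fun l hl hit => ?_
  rw [add_zero] at hit
  rw [Finset.mem_union]
  by_cases hlt : l < t n
  · left
    rw [← depth_even t p n] at hlt hl1
    obtain ⟨i, hi1, hi2, e⟩ := T.eq_of_hits hg' (b := 2 * n) (by omega) hlt (hg'.hits_anti hl1 hit)
    rw [depth_even] at e
    exact Finset.mem_image.2 ⟨i, Finset.mem_Icc.2 ⟨hi1, hi2⟩, e.symm⟩
  · right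
    refine Finset.mem_filter.2 ⟨Finset.mem_range.2 hl, (T.isReturnMoment_iff hg).2
      ⟨by omega, by omega, ?_⟩⟩
    rw [← hg'.pullback_one]
    exact hg'.pullback_anti (by omega) 0 (mem_pullback_comm hit)

/-- The critical point is covered by the orbit of `F` only when it passes through the domains
`E^{2n+1}, …, E^i`. -/
theorem coveringDegree_bufferF_le (T : NestTimes g V n t p q δ) (hg : g.IsUnicriticalGPL V d)
    {i k : ℕ} (h1 : 2 ≤ i) (h2 : 2 * n - 3 ≤ i) (hi : i ≤ 2 * n + 1)
    (hk : g.moment V n k ≤ depth t p (2 * n + 1) - depth t p (i - 1)) (B : Set ℂ) :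
    coveringDegree (g.psi V n k) (g.bufferF V n i) B ≤ (d : ℕ∞) ^ 5 := by
  classical
  have hg' := hg.toIsGPL
  have h3 := T.hatDepth_le (show 1 ≤ i - 1 by omega) (by omega)
  have h4 := T.depth_mono (show i - 1 ≤ 2 * n + 1 by omega) le_rfl
  have h0 := hg'.preimage_anti (show depth t p (2 * n + 1) - depth t p (i - 1) +
    hatDepth t δ (i - 1) ≤ _ by omega) (T.zero_mem_depth hg' (i := 2 * n + 1) le_rfl)
  rw [T.bufferF_eq hg h1 hi, psi]
  have key : ∀ l < g.moment V n k,
      g.Hits V (depth t p (2 * n + 1) - depth t p (i - 1) + hatDepth t δ (i - 1)) 0 l →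
      l ∈ (Finset.Icc i (2 * n + 1)).image fun i' => depth t p (2 * n + 1) - depth t p i' := by
    intro l hl hit
    obtain ⟨i', hi1, hi2, e⟩ := T.eq_of_hits_hat hg' (show 1 ≤ i - 1 by omega) (by omega) le_rfl
      (by omega) hit
    exact Finset.mem_image.2 ⟨i', Finset.mem_Icc.2 ⟨by omega, hi2⟩, e.symm⟩
  obtain ⟨r, hr⟩ := Nat.exists_eq_add_of_le hk
  rw [hr, add_assoc] at key h0 ⊢
  refine coveringDegree_iterate_le hg h0 B _ (Finset.card_image_le.trans ?_) key
  rw [Nat.card_Icc]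
  omega

/-- The buffer `Λ'_k` is mapped univalently onto the enlargement of `E^{i-1}`. -/
theorem annulusModulus_buffer (T : NestTimes g V n t p q δ) (hg : g.IsUnicriticalGPL V d)
    {i k : ℕ} (h1 : 2 ≤ i) (hi : i ≤ 2 * n + 1)
    (hk : depth t p (2 * n + 1) - depth t p i < g.moment V n k)
    (hk' : g.moment V n k ≤ depth t p (2 * n + 1) - depth t p (i - 1)) :
    annulusModulus (g.lamBuffer V n i k) (g.lam V n k) =
      annulusModulus (g.hatE V (i - 1)) (g.nestE V (i - 1)) := by
  have hg' := hg.toIsGPL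
  have h3 := T.hatDepth_le (show 1 ≤ i - 1 by omega) (by omega)
  have h4 := T.depth_mono (show i - 1 ≤ 2 * n + 1 by omega) le_rfl
  have h0 := T.zero_mem_depth hg' (i := 2 * n + 1) le_rfl
  have hc := T.iterate_mem hg' (show i - 1 ≤ 2 * n + 1 by omega) le_rfl
  rw [T.lamBuffer_eq hg h1 hi hk', T.lam_eq hg' (by omega), T.hatE_eq (by omega) (by omega),
    T.nestE_eq (by omega)]
  have key : ∀ l' < depth t p (2 * n + 1) - depth t p (i - 1) - g.moment V n k,
      ¬ g.Hits V (depth t p (2 * n + 1) - depth t p (i - 1) - g.moment V n k +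
        hatDepth t δ (i - 1)) (g.toFun^[g.moment V n k] 0) l' := by
    intro l' hl' hit
    rw [hits_add] at hit
    obtain ⟨i', hi1, hi2, e⟩ := T.eq_of_hits_hat hg' (l := g.moment V n k + l')
      (show 1 ≤ i - 1 by omega) (by omega) le_rfl (by omega) (by convert hit using 1; omega)
    have := T.depth_mono (show i ≤ i' by omega) hi2
    omega
  set l := g.moment V n k with hl
  obtain ⟨r, hr⟩ := Nat.exists_eq_add_of_le hk'
  have hr' : depth t p (2 * n + 1) - depth t p (i - 1) - l = r := by omega
  have hD : depth t p (2 * n + 1) - l = r + depth t p (i - 1) := by omega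
  have h5 := IsGPL.preimage_iterate h0 (show l ≤ depth t p (2 * n + 1) by omega)
  rw [hr'] at key ⊢
  rw [hD] at h5 ⊢
  have h6 := hg'.preimage_anti (Nat.add_le_add_left h3 r) h5
  have hcr : g.toFun^[r] (g.toFun^[l] 0) =
      g.toFun^[depth t p (2 * n + 1) - depth t p (i - 1)] 0 := by
    rw [← Function.iterate_add_apply]; congr 2; omega
  refine annulusModulus_eq_of_conformal (f := g.toFun^[r]) (hg'.isOpen_pullback _ _)
    ((hg'.differentiableOn_iterate r).mono fun x hx =>
      (mem_preimage_add.1 (pullback_subset _ _ _ _ hx)).1)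
    (hg.injOn_iterate h6 key) (fun z hz => hg.deriv_iterate_ne_zero key hz) ?_
    (hg'.pullback_anti (Nat.add_le_add_left h3 r) _) ?_
  · rw [hg'.image_iterate h6, hcr, pullback_eq_of_mem (hg'.pullback_anti h3 0 hc)]
  · rw [hg'.image_iterate h5, hcr, pullback_eq_of_mem hc]

/-- The critical point does not return to `V^{j+1}` in less than `q j` iterates. -/
theorem le_of_return (T : NestTimes g V n t p q δ) (hg : g.IsGPL V) {j Δ : ℕ} (hj : j < n)
    {y : ℂ} (hy : y ∈ g.pullback (t (j + 1)) V 0) (hΔ : 0 < Δ)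
    (hyΔ : g.toFun^[Δ] y ∈ g.pullback (t (j + 1)) V 0) : q j ≤ Δ := by
  by_contra hlt
  have h1 := T.t_succ j hj
  refine T.noHits_q j hj Δ hΔ (not_le.1 hlt) (hg.hits_anti (b := t (j + 1)) (by omega) ?_)
  rw [← hg.hits_congr hy le_rfl (by omega)]
  exact hg.pullback_anti (Nat.sub_le _ _) _ (mem_pullback_comm hyΔ)

/-- If two buffers intersected, then they would be nested, and the critical orbit would repeat its
itinerary with period `Δ = l_{k'} - l_k` up to the moment when it enters `E^{i-1}`.  A period
contains at most `m` visits to the central domain; but the enlargement of `E^{i-1}` lies in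
`V^{n-3}`, and an orbit that returns there makes more visits than that in between. -/
theorem disjoint_lamBuffer (T : NestTimes g V n t p q δ) (hg : g.IsUnicriticalGPL V d)
    (hn : 4 ≤ n) (hm : m < 2 ^ (n - 4)) {i k k' : ℕ} (hi1 : 2 * n - 3 ≤ i) (hi : i ≤ 2 * n + 1)
    (hkk : k < k') (hkm : k' ≤ m)
    (hk' : g.moment V n k' ≤ depth t p (2 * n + 1) - depth t p (i - 1)) :
    Disjoint (g.lamBuffer V n i k) (g.lamBuffer V n i k') := by
  have hg' := hg.toIsGPL
  have hm3 : m < 2 ^ (n - 3) := hm.trans_le (Nat.pow_le_pow_right two_pos (by omega))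
  obtain ⟨-, -, v1, -, -⟩ := T.moment_spec hg (by omega) hm3 (k := k) (by omega)
  obtain ⟨-, -, v2, hlt, -⟩ := T.moment_spec hg (by omega) hm3 hkm
  have hlt := hlt k hkk
  rw [T.lamBuffer_eq hg (by omega) hi (by omega), T.lamBuffer_eq hg (by omega) hi hk']
  set l := g.moment V n k
  set l' := g.moment V n k'
  set s := depth t p (2 * n + 1) - depth t p (i - 1) with hs
  set e := hatDepth t δ (i - 1) with he
  obtain ⟨j, rfl⟩ : ∃ j, n = j + 4 := ⟨n - 4, by omega⟩
  simp only [Nat.add_sub_cancel] at hm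
  have hte : t (j + 1) ≤ e := T.le_hatDepth (by omega) (by omega)
  have ht1 := T.t_succ j (by omega)
  have hq1 := T.q_pos j (by omega)
  rw [Set.disjoint_left]
  intro z hz hz'
  -- the initial segments of the orbits of the two buffers are the same
  have hc : g.toFun^[l] 0 ∈ g.pullback (s - l' + e) V (g.toFun^[l'] 0) := by
    have h1 := hg'.pullback_anti (show s - l' + e ≤ s - l + e by omega) _ hz
    rw [← pullback_eq_of_mem hz']
    exact mem_pullback_comm h1
  have hper : ∀ r ≤ s - l', g.visits (l' + r) + g.visits l = g.visits (l + r) + g.visits l' := by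
    classical
    intro r hr
    induction r with
    | zero => simp [add_comm]
    | succ r ih =>
      have h1 := hg'.mem_piece_iff hc (show r + 1 < s - l' + e by omega)
      rw [← Function.iterate_add_apply, ← Function.iterate_add_apply,
        show r + 1 + l = l + r + 1 by ring, show r + 1 + l' = l' + r + 1 by ring] at h1
      have h2 := ih (by omega)
      rw [← add_assoc, ← add_assoc, visits_succ, visits_succ]
      simp only [h1]
      omega
  have hvis := hper (s - l') le_rfl
  rw [show l' + (s - l') = s by omega] at hvis
  -- the orbit returns to the enlargement of `E^{i-1}` after the time `l' - l`
  have hsl : g.toFun^[l + (s - l')] 0 ∈ g.pullback (t (j + 1)) V 0 := by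
    have h1 := hg'.iterate_mem_pullback hc
    rw [← Function.iterate_add_apply, ← Function.iterate_add_apply,
      show s - l' + l' = s by omega] at h1
    have h2 := hg'.pullback_anti (T.hatDepth_le (show 1 ≤ i - 1 by omega) (by omega)) 0
      (T.iterate_mem hg' (show i - 1 ≤ 2 * (j + 4) + 1 by omega) le_rfl)
    rw [← he, ← hs] at h2
    rw [pullback_eq_of_mem h2, show s - l' + l = l + (s - l') by ring] at h1
    exact hg'.pullback_anti hte 0 h1
  have hss : g.toFun^[l' - l] (g.toFun^[l + (s - l')] 0) ∈ g.pullback (t (j + 1)) V 0 := by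
    rw [← Function.iterate_add_apply, show l' - l + (l + (s - l')) = s by omega]
    exact hg'.pullback_anti (hte.trans (T.hatDepth_le (show 1 ≤ i - 1 by omega) (by omega))) 0
      (T.iterate_mem hg' (show i - 1 ≤ 2 * (j + 4) + 1 by omega) le_rfl)
  have hΔ := T.le_of_return hg' (show j < j + 4 by omega) hsl (by omega) hss
  have h1 := hg'.visits_add hsl (show q j < t (j + 1) by have := T.p_pos j (by omega); omega)
  have h2 := visits_mono g (show l + (s - l') + q j ≤ s by omega)
  have h3 := T.two_pow_le_visits hg' (show j < j + 4 by omega)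
  omega

end NestTimes

end PlaneMap

theorem mainTheorem1 (g : PlaneMap) (V : Set ℂ) (d : ℕ) (hg : g.IsUnicriticalGPL V d)
    (m n : ℕ) (hm : 0 < m) (hn : Real.logb 2 (m : ℝ) + 5 < (n : ℝ))
    (hdyn : g.DynastyReaches V n) :
    -- the return moments `l_0 < … < l_m` exist
    (∀ k ≤ m, g.IsReturnMoment V n (g.moment V n k)) ∧
    -- one of the five orbit pieces contains at least `m / 2` of the domains
    (∃ i ∈ Finset.Icc (2 * n - 3) (2 * n + 1), (m : ℝ) / 2 ≤ ((g.orbitPiece V m n i).card : ℝ)) ∧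
    ∀ i ∈ Finset.Icc (2 * n - 3) (2 * n + 1),
      (∀ k ∈ g.orbitPiece V m n i,
        -- `Ψ_k = g^{l_k}` is a branched covering `(Υ, F, W^n) → (V^0, Λ', Λ)`
        g.upsilon V n k ⊆ g.iterDom (g.moment V n k) ∧
        g.nestW V n ⊆ g.bufferF V n i ∧ g.bufferF V n i ⊆ g.upsilon V n k ∧
        g.lam V n k ⊆ g.lamBuffer V n i k ∧ g.lamBuffer V n i k ⊆ V ∧
        IsBranchedCovering (g.psi V n k) (g.upsilon V n k) V ∧
        IsBranchedCovering (g.psi V n k) (g.bufferF V n i) (g.lamBuffer V n i k) ∧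
        IsBranchedCovering (g.psi V n k) (g.nestW V n) (g.lam V n k) ∧
        -- (P1) - (P4)
        coveringDegree (g.psi V n k) (g.upsilon V n k) V ≤ (d : ℕ∞) ^ (2 * n + m) ∧
        coveringDegree (g.psi V n k) (g.bufferF V n i) (g.lamBuffer V n i k) ≤ (d : ℕ∞) ^ 5 ∧
        g.upsilon V n k ⊆ g.nestV V n ∧
        annulusModulus (g.lamBuffer V n i k) (g.lam V n k) =
          annulusModulus (g.hatE V (i - 1)) (g.nestE V (i - 1))) ∧
      -- the buffers are pairwise disjoint
      (g.orbitPiece V m n i : Set ℕ).PairwiseDisjoint (g.lamBuffer V n i) := by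
  have hg' := hg.toIsGPL
  obtain ⟨t, p, q, δ, T⟩ := hdyn.exists_nestTimes hg
  have hm1 : (1 : ℝ) ≤ m := by exact_mod_cast hm
  have hlog : 0 ≤ Real.logb 2 (m : ℝ) := Real.logb_nonneg one_lt_two hm1
  have hn6 : 6 ≤ n := by
    have : (5 : ℝ) < n := by linarith
    exact_mod_cast this
  have hm5 : m < 2 ^ (n - 5) := by
    have h1 : Real.logb 2 (m : ℝ) < ((n - 5 : ℕ) : ℝ) := by
      rw [Nat.cast_sub (by omega)]; push_cast; linarith
    rw [Real.logb_lt_iff_lt_rpow one_lt_two (by linarith), Real.rpow_natCast] at h1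
    exact_mod_cast h1
  have hm4 : m < 2 ^ (n - 4) := hm5.trans_le (Nat.pow_le_pow_right two_pos (by omega))
  have hm3 : m < 2 ^ (n - 3) := hm5.trans_le (Nat.pow_le_pow_right two_pos (by omega))
  have h0 := T.zero_mem_depth hg' (i := 2 * n + 1) le_rfl
  refine ⟨fun k hk => (T.moment_spec hg (by omega) hm3 hk).1,
    T.exists_large_orbitPiece hg (by omega) hm3, fun i hi => ?_⟩
  obtain ⟨hi1, hi2⟩ := Finset.mem_Icc.1 hi
  have he1 := T.hatDepth_le (show 1 ≤ i - 1 by omega) (by omega)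
  have he2 := T.depth_mono (show i - 1 ≤ 2 * n + 1 by omega) le_rfl
  refine ⟨fun k hk => ?_, fun k hk k' hk' hne => ?_⟩
  · obtain ⟨hkm, hk1, hk2⟩ := (T.mem_orbitPiece hg' hi2).1 hk
    obtain ⟨hlt, hlD, -⟩ := (T.isReturnMoment_iff hg).1 (T.moment_spec hg (by omega) hm3 hkm).1
    have hF := T.bufferF_eq hg (show 2 ≤ i by omega) hi2
    set s := PlaneMap.NestTimes.depth t p (2 * n + 1) - PlaneMap.NestTimes.depth t p (i - 1) with hs
    obtain ⟨r, hr⟩ := Nat.exists_eq_add_of_le hk2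
    have hFpre := hg'.preimage_anti
      (show s + PlaneMap.NestTimes.hatDepth t δ (i - 1) ≤ _ by omega) h0
    have hcov := hg'.isBranchedCovering_iterate (s := g.moment V n k)
      (t := r + PlaneMap.NestTimes.hatDepth t δ (i - 1)) (z := 0)
      (by rw [← add_assoc, ← hr]; exact hFpre)
    have hLpre := hg'.preimage_anti hlD.le h0
    obtain ⟨r', hr'⟩ := Nat.exists_eq_add_of_le hlD.le
    have hcovW := hg'.isBranchedCovering_iterate (s := g.moment V n k) (t := r') (z := 0)
      (by rw [← hr']; exact h0)
    have hcovU := hg'.isBranchedCovering_iterate (s := g.moment V n k) (t := 0) (z := 0) hLpre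
    have hWF : g.nestW V n ⊆ g.bufferF V n i := by
      rw [T.nestW_eq, hF]
      exact hg'.pullback_anti (by omega) 0
    have hFU : g.bufferF V n i ⊆ g.upsilon V n k := by
      rw [hF, PlaneMap.upsilon]
      exact hg'.pullback_anti (by omega) 0
    refine ⟨fun z hz => (PlaneMap.pullback_subset _ _ _ _ hz).1, hWF, hFU, image_mono hWF, ?_, ?_,
      ?_, ?_,
      T.coveringDegree_upsilon_le hg (by omega) hm3 hkm,
      T.coveringDegree_bufferF_le hg (by omega) hi1 hi2 hk2 _, ?_,
      T.annulusModulus_buffer hg (by omega) hi2 hk1 hk2⟩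
    · rintro _ ⟨z, hz, rfl⟩
      exact (PlaneMap.pullback_subset _ _ _ _ (hFU hz)).2
    · rwa [hg'.pullback_zero
        (PlaneMap.pullback_subset _ _ _ _ (PlaneMap.mem_pullback_self hLpre)).2] at hcovU
    · rw [PlaneMap.lamBuffer, PlaneMap.psi, hF, hr, add_assoc,
        hg'.image_iterate (by rw [← add_assoc, ← hr]; exact hFpre)]
      exact hcov
    · rw [PlaneMap.lam, PlaneMap.psi, T.nestW_eq, hr', hg'.image_iterate (by rw [← hr']; exact h0)]
      exact hcovW
    · rw [T.nestV n le_rfl, PlaneMap.upsilon]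
      exact hg'.pullback_anti hlt 0
  · obtain ⟨hkm, -, hk2⟩ := (T.mem_orbitPiece hg' hi2).1 hk
    obtain ⟨hkm', -, hk2'⟩ := (T.mem_orbitPiece hg' hi2).1 hk'
    rcases hne.lt_or_gt with h | h
    · exact T.disjoint_lamBuffer hg (by omega) hm4 hi1 hi2 h hkm' hk2'
    · exact (T.disjoint_lamBuffer hg (by omega) hm4 hi1 hi2 h hkm hk2).symm
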